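/- Let $(\Omega,\mathscr F,(\mathscr F(t))_{t\ge0},\mathbb P)$ be a filtered probability space, $(Z,\mathcal Z,\nu)$ a $\sigma$-finite measure space, $W$ an $\mathbb R^m$-valued standard Wiener process and $N$ a Poisson random measure on $(0,\infty)\times Z$ with intensity $dt\otimes\nu$, independent of $W$. Both are adapted to $(\mathscr F(t))$, and for every $t\ge0$ the increments of $(W,N)$ after time $t$ are (jointly) independent of $\mathscr F(t)$. Write $\widetilde N(dt,dz)=N(dt,dz)-dt\,\nu(dz)$. Let $b:\mathbb R^d\to\mathbb R^d$, $\sigma:\mathbb R^d\to\mathbb R^{d\times m}$ and $\gamma:\mathbb R^d\times Z\to\mathbb R^d$ be measurable. Write $|\cdot|$ for the Euclidean norm and $\|\cdot\|$ for the Hilbert--Schmidt norm. Assume that $\int_Z|\gamma(x,z)|^2\,\nu(dz)<\infty$ for all $x$, and that there are constants $L_1,L_2,L_3>0$ such that for all $x,y\in\mathbb R^d$ $$2\langle x-y,b(x)-b(y)\rangle+\|\sigma(x)-\sigma(y)\|^2+\int_Z|\gamma(x,z)-\gamma(y,z)|^2\,\nu(dz)\le L_1|x-y|^2,$$ $$2\langle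 x,b(x)\rangle+\|\sigma(x)\|^2+\int_Z|\gamma(x,z)|^2\,\nu(dz)\le L_2-L_3|x|^2.$$ Let $\theta\in[1/2,1]$ and $\tau\in(0,1)$ with $L_1\theta\tau\le1/2$, and put $t_n=n\tau$. For $x\in\mathbb R^d$, a solution of the stochastic theta method started at $x$ is a sequence $(Z_n^x)_{n\in\mathbb N}$ of $\mathbb R^d$-valued random variables, $Z_n^x$ being $\mathscr F(t_n)$-measurable, such that almost surely $Z_0^x=x$ and, for all $n\in\mathbb N$, $$Z_{n+1}^x=Z_n^x+(1-\theta)\,b(Z_n^x)\,\tau+\theta\, b(Z_{n+1}^x)\,\tau+\sigma(Z_n^x)\big(W(t_{n+1})-W(t_n)\big)+\int_{t_n}^{t_{n+1}}\!\!\int_Z\gamma(Z_n^x,z)\,\widetilde N(ds,dz),$$ where the last term is the $L^2$ Itô integral. (i) For all $x,y\in\mathbb R^d$, all solutions $(Z_n^x)$ and $(Z_n^y)$ started at $x$ and $y$, and all $n\in\mathbb N$, $$\mathbb E\,|Z_n^x-Z_n^y|^2\le\frac{e^{2L_1t_n}}{1-L_1\theta\tau}\,\big|(x-y)-\theta\tau\,(b(x)-b(y))\big|^2<\infty.$$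 (ii) If moreover $b$ is continuous, then for every $x\in\mathbb R^d$ the method has a solution started at $x$; the law of $Z_n^x$ does not depend on the choice of the solution, and $P_n\varphi(x)=\mathbb E\,\varphi(Z_n^x)$ defines a semigroup $(P_n)_{n\in\mathbb N}$ of Markov kernels on $\mathbb R^d$ (that is, $P_0=\mathrm{Id}$ and $P_{n+k}=P_nP_k$). This semigroup is Feller: each $P_n$ maps bounded continuous functions on $\mathbb R^d$ to bounded continuous functions. It has an invariant measure: there is a probability measure $\pi$ on $\mathbb R^d$ with $\pi P_n=\pi$ for all $n\in\mathbb N$. -/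

import Mathlib

open MeasureTheory ProbabilityTheory Filter Set Topology
open scoped NNReal ENNReal BoundedContinuousFunction

noncomputable section

namespace STM

/-- Squared Hilbert--Schmidt norm of a real matrix. -/
def hsNormSq {d m : ℕ} (A : Matrix (Fin d) (Fin m) ℝ) : ℝ := ∑ i, ∑ j, A i j ^ 2

/-- Measurability of the coefficients `b : ℝ^d → ℝ^d`, `σ : ℝ^d → ℝ^{d × m}`,
`γ : ℝ^d × Z → ℝ^d`. -/
structure MeasurableCoeffs {d m : ℕ} {Z : Type*} [MeasurableSpace Z]
    (b : EuclideanSpace ℝ (Fin d) → EuclideanSpace ℝ (Fin d))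
    (σ : EuclideanSpace ℝ (Fin d) → Matrix (Fin d) (Fin m) ℝ)
    (γ : EuclideanSpace ℝ (Fin d) → Z → EuclideanSpace ℝ (Fin d)) : Prop where
  drift : Measurable b
  diffusion : ∀ i j, Measurable fun x => σ x i j
  jump : Measurable (Function.uncurry γ)

/-- The coupled monotonicity and coercivity conditions with constants `L₁, L₂, L₃ > 0`.
The field `sq_integrable` says that the integral in the coercivity condition is finite. -/
structure CoupledMonotoneCoercive {d m : ℕ} {Z : Type*} [MeasurableSpace Z]
    (b : EuclideanSpace ℝ (Fin d) → EuclideanSpace ℝ (Fin d))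
    (σ : EuclideanSpace ℝ (Fin d) → Matrix (Fin d) (Fin m) ℝ)
    (γ : EuclideanSpace ℝ (Fin d) → Z → EuclideanSpace ℝ (Fin d))
    (ν : Measure Z) (L₁ L₂ L₃ : ℝ) : Prop where
  pos₁ : 0 < L₁
  pos₂ : 0 < L₂
  pos₃ : 0 < L₃
  sq_integrable : ∀ x, Integrable (fun z => ‖γ x z‖ ^ 2) ν
  monotone : ∀ x y, 2 * inner ℝ (x - y) (b x - b y) + hsNormSq (σ x - σ y)
      + ∫ z, ‖γ x z - γ y z‖ ^ 2 ∂ν ≤ L₁ * ‖x - y‖ ^ 2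
  coercive : ∀ x, 2 * inner ℝ x (b x) + hsNormSq (σ x)
      + ∫ z, ‖γ x z‖ ^ 2 ∂ν ≤ L₂ - L₃ * ‖x‖ ^ 2

/-- `W` is a standard `m`-dimensional Wiener process: its coordinates are independent
real Brownian motions. -/
structure IsWienerProcess {m : ℕ} {Ω : Type*} [MeasurableSpace Ω]
    (W : ℝ≥0 → Ω → EuclideanSpace ℝ (Fin m)) (P : Measure Ω) : Prop where
  coord : ∀ i, IsBrownianReal (fun t ω => W t ω i) P
  indep : iIndepFun (fun (i : Fin m) (ω : Ω) (t : ℝ≥0) => W t ω i) P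

/-- `N` is a Poisson random measure on `S` with intensity measure `μ`. -/
structure IsPoissonRandomMeasure {Ω S : Type*} [MeasurableSpace Ω] [MeasurableSpace S]
    (N : Ω → Measure S) (μ : Measure S) (P : Measure Ω) : Prop where
  measurable : Measurable N
  law : ∀ B, MeasurableSet B → μ B ≠ ∞ →
    HasLaw (fun ω => N ω B)
      ((poissonMeasure (μ B).toNNReal).map (fun k : ℕ => (k : ℝ≥0∞))) P
  law_top : ∀ B, MeasurableSet B → μ B = ∞ → ∀ᵐ ω ∂P, N ω B = ∞
  indep : ∀ (k : ℕ) (B : Fin k → Set S), (∀ i, MeasurableSet (B i)) →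
    Pairwise (fun i j => Disjoint (B i) (B j)) → iIndepFun (fun i ω => N ω (B i)) P

/-- The driving noise on the filtered probability space `(Ω, (F t), P)`: independent Wiener
process `W` and Poisson random measure `N` on `(0, ∞) × Z` with intensity `dt ⊗ ν`, both adapted
to `F`, the noise after time `t` being independent of `F t`. -/
structure IsDrivingNoise {m : ℕ} {Ω Z : Type*} [mΩ : MeasurableSpace Ω] [MeasurableSpace Z]
    (F : Filtration ℝ≥0 mΩ) (W : ℝ≥0 → Ω → EuclideanSpace ℝ (Fin m))
    (N : Ω → Measure (ℝ × Z)) (ν : Measure Z) (P : Measure Ω) : Prop where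
  wiener : IsWienerProcess W P
  poisson : IsPoissonRandomMeasure N ((volume.restrict (Ioi (0 : ℝ))).prod ν) P
  indep : IndepFun (fun ω t => W t ω) N P
  adapted_wiener : ∀ t, Measurable[F t] (W t)
  adapted_poisson : ∀ t : ℝ≥0,
    Measurable[F t] (fun ω => (N ω).restrict (Iic (t : ℝ) ×ˢ (univ : Set Z)))
  future_indep : ∀ t : ℝ≥0, Indep (F t) (MeasurableSpace.comap
    (fun ω => ((fun s : ℝ≥0 => W (t + s) ω - W t ω),
      (N ω).restrict (Ioi (t : ℝ) ×ˢ (univ : Set Z)))) inferInstance) P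

/-- Simple integrands `∑ i, ξ i (ω) 1_{A i}(z)` (constant in time), with `ξ i` bounded and
measurable for the sub-σ-algebra `𝓖`, and `ν (A i) < ∞`. -/
structure SimpleIntegrand (Ω : Type*) {Z : Type*} [MeasurableSpace Z] (𝓖 : MeasurableSpace Ω)
    (ν : Measure Z) (d : ℕ) where
  card : ℕ
  coef : Fin card → Ω → EuclideanSpace ℝ (Fin d)
  set : Fin card → Set Z
  measurable_coef : ∀ i, Measurable[𝓖] (coef i)
  bounded_coef : ∃ C : ℝ, ∀ i ω, ‖coef i ω‖ ≤ C
  measurableSet_set : ∀ i, MeasurableSet (set i)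
  measure_set_ne_top : ∀ i, ν (set i) ≠ ∞

/-- The function `(ω, z) ↦ ∑ i, ξ i (ω) 1_{A i}(z)`. -/
def SimpleIntegrand.eval {Ω Z : Type*} [MeasurableSpace Z] {𝓖 : MeasurableSpace Ω}
    {ν : Measure Z} {d : ℕ} (S : SimpleIntegrand Ω 𝓖 ν d) (ω : Ω) (z : Z) :
    EuclideanSpace ℝ (Fin d) :=
  ∑ i, (S.set i).indicator (fun _ => S.coef i ω) z

/-- The compensated integral `∑ i, Ñ((s, t] × A i) ξ i` of a simple integrand over
`(s, t] × Z`, where `Ñ((s, t] × A) = N((s, t] × A) - (t - s) ν(A)`. -/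
def SimpleIntegrand.integral {Ω Z : Type*} [MeasurableSpace Z] {𝓖 : MeasurableSpace Ω}
    {ν : Measure Z} {d : ℕ} (S : SimpleIntegrand Ω 𝓖 ν d) (N : Ω → Measure (ℝ × Z))
    (s t : ℝ≥0) (ω : Ω) : EuclideanSpace ℝ (Fin d) :=
  ∑ i, ((N ω (Ioc (s : ℝ) t ×ˢ S.set i)).toReal - ((t : ℝ) - s) * (ν (S.set i)).toReal)
    • S.coef i ω

/-- `I` is (a version of) the Itô integral `∫_s^t ∫_Z H(z) Ñ(dr, dz)` of the square integrable
`F s`-measurable random function `H : Ω × Z → ℝ^d`: the integral is the `L²(P)` limit of the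
integrals of simple integrands that converge to `H` in `L²(P ⊗ ν)`. -/
def IsCompensatedIntegral {d : ℕ} {Ω Z : Type*} [mΩ : MeasurableSpace Ω] [MeasurableSpace Z]
    (F : Filtration ℝ≥0 mΩ) (N : Ω → Measure (ℝ × Z)) (ν : Measure Z) (P : Measure Ω)
    (s t : ℝ≥0) (H : Ω → Z → EuclideanSpace ℝ (Fin d)) (I : Ω → EuclideanSpace ℝ (Fin d)) :
    Prop :=
  AEMeasurable I P ∧ ∃ S : ℕ → SimpleIntegrand Ω (F s) ν d,
    Tendsto (fun k => ∫⁻ ω, ∫⁻ z, ‖H ω z - (S k).eval ω z‖ₑ ^ 2 ∂ν ∂P) atTop (𝓝 0) ∧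
    Tendsto (fun k => ∫⁻ ω, ‖I ω - (S k).integral N s t ω‖ₑ ^ 2 ∂P) atTop (𝓝 0)

/-- `X` solves the stochastic theta method with step size `τ` and parameter `θ`, started
at the point `x`: `X j` is `F (j τ)`-measurable and, almost surely,
`X (j+1) = X j + (1-θ) b(X j) τ + θ b(X (j+1)) τ + σ(X j) (W_{(j+1)τ} - W_{jτ})
  + ∫_{jτ}^{(j+1)τ} ∫_Z γ(X j, z) Ñ(ds, dz)`. -/
structure IsSolution {d m : ℕ} {Ω Z : Type*} [mΩ : MeasurableSpace Ω] [MeasurableSpace Z]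
    (F : Filtration ℝ≥0 mΩ) (W : ℝ≥0 → Ω → EuclideanSpace ℝ (Fin m))
    (N : Ω → Measure (ℝ × Z)) (ν : Measure Z) (P : Measure Ω)
    (b : EuclideanSpace ℝ (Fin d) → EuclideanSpace ℝ (Fin d))
    (σ : EuclideanSpace ℝ (Fin d) → Matrix (Fin d) (Fin m) ℝ)
    (γ : EuclideanSpace ℝ (Fin d) → Z → EuclideanSpace ℝ (Fin d))
    (τ : ℝ≥0) (θ : ℝ) (x : EuclideanSpace ℝ (Fin d))
    (X : ℕ → Ω → EuclideanSpace ℝ (Fin d)) : Prop where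
  init : ∀ᵐ ω ∂P, X 0 ω = x
  adapted : ∀ j : ℕ, Measurable[F (j * τ)] (X j)
  step : ∀ j : ℕ, ∃ I : Ω → EuclideanSpace ℝ (Fin d),
    IsCompensatedIntegral F N ν P (j * τ) ((j + 1) * τ) (fun ω z => γ (X j ω) z) I ∧
    ∀ᵐ ω ∂P, X (j + 1) ω = X j ω + ((1 - θ) * τ) • b (X j ω) + (θ * τ) • b (X (j + 1) ω)
      + WithLp.toLp 2
          ((σ (X j ω)).mulVec (WithLp.ofLp (W ((j + 1) * τ) ω - W (j * τ) ω)))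
      + I ω

/-- `κ` is the discrete Markov semigroup of the stochastic theta method: from every starting
point the method has a solution, `κ n x` is the law of `X n` for every solution `X` started at
`x` (so that `(P_n φ)(x) = 𝔼 φ(X_n^x) = ∫ φ d(κ n x)`), and `(κ n)` is a semigroup of Markov
kernels. -/
structure IsMarkovSemigroup {d m : ℕ} {Ω Z : Type*} [mΩ : MeasurableSpace Ω] [MeasurableSpace Z]
    (F : Filtration ℝ≥0 mΩ) (W : ℝ≥0 → Ω → EuclideanSpace ℝ (Fin m))
    (N : Ω → Measure (ℝ × Z)) (ν : Measure Z) (P : Measure Ω)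
    (b : EuclideanSpace ℝ (Fin d) → EuclideanSpace ℝ (Fin d))
    (σ : EuclideanSpace ℝ (Fin d) → Matrix (Fin d) (Fin m) ℝ)
    (γ : EuclideanSpace ℝ (Fin d) → Z → EuclideanSpace ℝ (Fin d))
    (τ : ℝ≥0) (θ : ℝ)
    (κ : ℕ → Kernel (EuclideanSpace ℝ (Fin d)) (EuclideanSpace ℝ (Fin d))) : Prop where
  exists_solution : ∀ x, ∃ X, IsSolution F W N ν P b σ γ τ θ x X
  law : ∀ x X, IsSolution F W N ν P b σ γ τ θ x X → ∀ n, HasLaw (X n) (κ n x) P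
  isMarkov : ∀ n, IsMarkovKernel (κ n)
  zero : κ 0 = Kernel.id
  add : ∀ n k, κ (n + k) = κ k ∘ₖ κ n

/-- Feller property: each `P_n` maps bounded continuous functions to (bounded) continuous
functions. -/
def IsFeller {E : Type*} [TopologicalSpace E] [MeasurableSpace E] (κ : ℕ → Kernel E E) : Prop :=
  ∀ (n : ℕ) (φ : E →ᵇ ℝ), Continuous fun x => ∫ y, φ y ∂(κ n x)

/-- `π` is an invariant (probability) measure of the semigroup `κ`. -/
def IsInvariantMeasure {E : Type*} [MeasurableSpace E] (κ : ℕ → Kernel E E)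
    (π : Measure E) : Prop :=
  IsProbabilityMeasure π ∧ ∀ n, Kernel.Invariant (κ n) π

end STM

end

/-! Write T(x) = x − θτ b(x) (`implicitMap`). One step of the method reads T(X_{n+1}) = G_n, where
G_n (`explicitPart`) depends only on X_n and on the noise in (t_n, t_{n+1}]. The natural energy is
therefore |T(X_n)|² and not |X_n|². Since the noise is centred and independent of the past, the Itô
isometry gives E|G_n|² = E|X_n + (1−θ)τ b(X_n)|² + τ E‖σ(X_n)‖² + τ E∫|γ(X_n,z)|² ν(dz). For θ ≥ 1/2
one has |x + (1−θ)τ v|² ≤ |x − θτ v|² + 2τ⟨x,v⟩, because the difference of the two sides is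
(2θ−1)τ²|v|². The scalar product then combines with the noise terms to form exactly the left side of
the coercivity condition, or of the monotonicity condition when two solutions are subtracted.

For differences this yields E|T(X_{n+1}) − T(Y_{n+1})|² ≤ (1 + 2L₁τ) E|T(X_n) − T(Y_n)|², using
|x−y|² ≤ 2|T(x)−T(y)|². Iterating and returning to X_n − Y_n through (1 − L₁θτ)|x−y|² ≤ |T(x)−T(y)|²
proves (i). No growth condition is needed: T(X_n) ∈ L² forces X_n, b(X_n), σ(X_n), γ(X_n,·) into L²
by coercivity.

If b is continuous, T is continuous and strongly monotone, hence a bijection of ℝ^d with Lipschitz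
inverse (`StronglyMonotone.surjective`), so X_{n+1} = T⁻¹(G_n) constructs solutions. For a
deterministic state v, the integral of γ(v,·) is an L² limit of functions of finitely many Poisson
counts on disjoint sets. Hence the law of a step depends only on v and τ, and the step is
independent of the past (`IsCompensatedIntegral.setIntegral_const`). Random states are reached by
finitely valued approximation and the stability estimate
(`IsTransitionKernel.integral_explicitPart`). The law of X_n is thus κⁿ(x) for a single kernel κ,
and the same stability makes κ Feller.

Summing the coercive energy inequality over time bounds the averages of E|X_k|² uniformly, so the
averaged laws are tight, and the Krylov–Bogoliubov argument (`exists_invariant`) produces the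
invariant measure. -/

noncomputable section

namespace STM

/-! ### Surjectivity of strongly monotone maps in finite dimension -/

section StronglyMonotone

variable {E : Type*} [NormedAddCommGroup E] [InnerProductSpace ℝ E]

/-- `T` is strongly monotone with constant `c`. -/
def StronglyMonotone (c : ℝ) (T : E → E) : Prop :=
  ∀ x y, c * ‖x - y‖ ^ 2 ≤ inner ℝ (x - y) (T x - T y)

lemma StronglyMonotone.mul_norm_sub_le {c : ℝ} {T : E → E} (h : StronglyMonotone c T) (x y : E) :
    c * ‖x - y‖ ≤ ‖T x - T y‖ := by
  rcases eq_or_ne x y with rfl | hxy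
  · simp
  have hp : 0 < ‖x - y‖ := norm_pos_iff.2 (sub_ne_zero.2 hxy)
  have h1 := (h x y).trans (real_inner_le_norm _ _)
  nlinarith

lemma StronglyMonotone.injective {c : ℝ} (hc : 0 < c) {T : E → E} (h : StronglyMonotone c T) :
    Function.Injective T := by
  intro x y hxy
  have h1 := h.mul_norm_sub_le x y
  rw [hxy, sub_self, norm_zero] at h1
  have : ‖x - y‖ ≤ 0 := by nlinarith [norm_nonneg (x - y)]
  exact sub_eq_zero.1 (norm_le_zero_iff.1 this)

/-- Divide the monotonicity inequality for x + tv and x by t² and let t decrease to 0. -/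
lemma StronglyMonotone.mul_sq_norm_le_inner_fderiv {c : ℝ} {T : E → E} (h : StronglyMonotone c T)
    {A : E →L[ℝ] E} {x : E} (hA : HasFDerivAt T A x) (v : E) : c * ‖v‖ ^ 2 ≤ inner ℝ v (A v) := by
  have h1 : HasDerivAt (fun t : ℝ => x + t • v) v 0 := by
    simpa using ((hasDerivAt_id (0 : ℝ)).smul_const v).const_add x
  have h2 : HasDerivAt (fun t : ℝ => T (x + t • v)) (A v) 0 := by
    have : HasFDerivAt T A (x + (0 : ℝ) • v) := by simpa using hA
    exact this.comp_hasDerivAt (0 : ℝ) h1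
  have h4 := (h2.tendsto_slope_zero_right).inner (𝕜 := ℝ) (tendsto_const_nhds (x := v))
  simp only [zero_add, zero_smul, add_zero] at h4
  rw [real_inner_comm]
  refine ge_of_tendsto h4 ?_
  filter_upwards [self_mem_nhdsWithin] with t ht
  have ht : (0 : ℝ) < t := ht
  have h5 := h (x + t • v) x
  rw [add_sub_cancel_left, norm_smul, inner_smul_left, mul_pow, Real.norm_eq_abs, sq_abs] at h5
  simp only [conj_trivial] at h5
  rw [real_inner_comm, inner_smul_right]
  have h6 : t * (c * ‖v‖ ^ 2) ≤ inner ℝ v (T (x + t • v) - T x) := by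
    nlinarith
  rw [inv_mul_eq_div, le_div_iff₀ ht]
  linarith

variable [FiniteDimensional ℝ E]

/-- Coercivity: c|x_k| ≤ |T_k(x_k) − T_k(0)|, so convergent images come from bounded points, and
bounded sequences have convergent subsequences. The maps may vary with k so that the same lemma
serves both for closedness of a range and for the mollification limit. -/
lemma StronglyMonotone.exists_tendsto_subseq {c : ℝ} (hc : 0 < c) {T : ℕ → E → E}
    (h : ∀ k, StronglyMonotone c (T k)) {z : E} (hz : Tendsto (fun k => T k 0) atTop (𝓝 z))
    {x : ℕ → E} {y : E} (hy : Tendsto (fun k => T k (x k)) atTop (𝓝 y)) :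
    ∃ a, ∃ φ : ℕ → ℕ, StrictMono φ ∧ Tendsto (x ∘ φ) atTop (𝓝 a) := by
  obtain ⟨R, hR⟩ := (Metric.isBounded_range_of_tendsto _ (hy.sub hz)).exists_norm_le
  have hb : ∀ k, x k ∈ Metric.closedBall (0 : E) (R / c) := by
    intro k
    have h1 := (h k).mul_norm_sub_le (x k) 0
    have h2 := hR _ (mem_range_self k)
    rw [mem_closedBall_zero_iff, le_div_iff₀ hc]
    rw [sub_zero] at h1
    linarith
  obtain ⟨a, -, φ, hφ, ha⟩ := tendsto_subseq_of_bounded Metric.isBounded_closedBall hb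
  exact ⟨a, φ, hφ, ha⟩

/-- The derivative is injective, hence bijective in finite dimension, so the range is open by the
inverse function theorem. It is also closed by coercivity, and the space is connected. -/
lemma StronglyMonotone.surjective_of_contDiff {c : ℝ} (hc : 0 < c) {T : E → E}
    (h : StronglyMonotone c T) (hT : ContDiff ℝ 1 T) : Function.Surjective T := by
  have hopen : IsOpen (range T) := by
    refine IsOpenMap.isOpen_range (isOpenMap_iff_nhds_le.2 fun x => ?_)
    have hs := hT.contDiffAt.hasStrictFDerivAt (x := x) one_ne_zero
    have hinj : Function.Injective (fderiv ℝ T x) := by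
      refine (injective_iff_map_eq_zero _).2 fun v hv => ?_
      have h1 := h.mul_sq_norm_le_inner_fderiv hs.hasFDerivAt v
      rw [hv, inner_zero_right] at h1
      have h3 : ‖v‖ ^ 2 ≤ 0 := by nlinarith [sq_nonneg ‖v‖]
      have h2 : ‖v‖ = 0 := pow_eq_zero_iff two_ne_zero |>.1 (le_antisymm h3 (sq_nonneg _))
      exact norm_eq_zero.1 h2
    have hsurj : Function.Surjective (fderiv ℝ T x) :=
      (LinearMap.injective_iff_surjective (f := (fderiv ℝ T x : E →ₗ[ℝ] E))).1 hinj
    exact (hs.map_nhds_eq_of_surj (LinearMap.range_eq_top.2 hsurj)).ge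
  have hclosed : IsClosed (range T) := by
    refine isClosed_of_closure_subset fun y hy => ?_
    obtain ⟨u, hu, huy⟩ := mem_closure_iff_seq_limit.1 hy
    choose x hx using hu
    obtain ⟨a, φ, hφ, ha⟩ := StronglyMonotone.exists_tendsto_subseq hc (T := fun _ => T)
      (fun _ => h) tendsto_const_nhds (x := x) (y := y) (by simpa [hx] using huy)
    refine ⟨a, tendsto_nhds_unique ((hT.continuous.tendsto a).comp ha) ?_⟩
    have : (T ∘ x ∘ φ) = u ∘ φ := by ext k; simp [hx]
    rw [this]
    exact huy.comp hφ.tendsto_atTop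
  exact range_eq_univ.1 (IsClopen.eq_univ ⟨hclosed, hopen⟩ (range_nonempty T))

/-- A mollification averages the translates of T with weights of total mass one; each translate
satisfies the same inequality, and the inequality survives averaging. -/
lemma StronglyMonotone.convolution [MeasurableSpace E] [BorelSpace E] {c : ℝ} {T : E → E}
    (h : StronglyMonotone c T) (hT : Continuous T) (φ : ContDiffBump (0 : E)) :
    StronglyMonotone c
      (MeasureTheory.convolution (φ.normed volume) T (ContinuousLinearMap.lsmul ℝ ℝ) volume) := by
  intro x y
  have hex : ∀ z, Integrable (fun t => φ.normed volume t • T (z - t)) volume := fun z =>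
    (HasCompactSupport.convolutionExists_left (ContinuousLinearMap.lsmul ℝ ℝ)
      φ.hasCompactSupport_normed φ.continuous_normed (hT.locallyIntegrable (μ := volume)) z)
  simp only [convolution_def, ContinuousLinearMap.lsmul_apply]
  have h2 := integral_inner (𝕜 := ℝ) ((hex x).sub (hex y)) (x - y)
  simp only [Pi.sub_apply] at h2
  rw [← integral_sub (hex x) (hex y), ← h2]
  have h1 : c * ‖x - y‖ ^ 2 = ∫ t, φ.normed volume t * (c * ‖x - y‖ ^ 2) := by
    rw [integral_mul_const, φ.integral_normed, one_mul]
  rw [h1]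
  refine integral_mono (φ.integrable_normed.mul_const _)
    (((hex x).sub (hex y)).const_inner _) fun t => ?_
  simp only [← smul_sub, inner_smul_right]
  refine mul_le_mul_of_nonneg_left ?_ (φ.nonneg_normed t)
  simpa using h (x - t) (y - t)

/-- A continuous strongly monotone map of a finite-dimensional space is surjective. -/
theorem StronglyMonotone.surjective {c : ℝ} (hc : 0 < c) {T : E → E}
    (h : StronglyMonotone c T) (hT : Continuous T) : Function.Surjective T := by
  borelize E
  let φ : ℕ → ContDiffBump (0 : E) := fun k =>
    ⟨1 / (2 * ((k : ℝ) + 1)), 1 / ((k : ℝ) + 1), by positivity, by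
      apply one_div_lt_one_div_of_lt <;> linarith [(Nat.cast_nonneg k : (0 : ℝ) ≤ k)]⟩
  have hφ : Tendsto (fun k => (φ k).rOut) atTop (𝓝 0) := tendsto_one_div_add_atTop_nhds_zero_nat
  -- The mollified maps are smooth and keep the constant c, so each S k attains y at some x k; a
  -- limit point of these solves the equation for T. The radii 1/(k+1) shrink to 0.
  let S : ℕ → E → E := fun k =>
    MeasureTheory.convolution ((φ k).normed volume) T (ContinuousLinearMap.lsmul ℝ ℝ) volume
  have hS : ∀ k, StronglyMonotone c (S k) := fun k => h.convolution hT (φ k)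
  -- Convergence at moving points and along subsequences: it is used at the fixed point 0 for
  -- boundedness and at the extracted preimages for the conclusion.
  have hlim : ∀ (ψ : ℕ → ℕ) (_ : Tendsto ψ atTop atTop) (x : ℕ → E) (a : E)
      (_ : Tendsto x atTop (𝓝 a)), Tendsto (fun k => S (ψ k) (x k)) atTop (𝓝 (T a)) := by
    intro ψ hψ x a hx
    refine ContDiffBump.convolution_tendsto_right (φ := fun k => φ (ψ k)) (g := fun _ => T)
      (hφ.comp hψ) (Eventually.of_forall fun _ => hT.aestronglyMeasurable) ?_ hx
    exact (hT.tendsto a).comp tendsto_snd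
  intro y
  have hsm : ∀ k, ContDiff ℝ 1 (S k) := fun k =>
    HasCompactSupport.contDiff_convolution_left (n := 1) _ (φ k).hasCompactSupport_normed
      (φ k).contDiff_normed hT.locallyIntegrable
  choose x hx using fun k => (hS k).surjective_of_contDiff hc (hsm k) y
  obtain ⟨a, ψ, hψ, ha⟩ := StronglyMonotone.exists_tendsto_subseq hc hS
    (hlim id tendsto_id (fun _ => 0) 0 tendsto_const_nhds) (x := x) (y := y)
    (by simp [hx])
  refine ⟨a, tendsto_nhds_unique (hlim ψ hψ.tendsto_atTop _ a ha) ?_⟩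
  simp [hx]

end StronglyMonotone

/-! ### Convergence in L² -/

section SquareIntegrable

variable {α : Type*} {mα : MeasurableSpace α} {μ : Measure α} {F : Type*} [NormedAddCommGroup F]

lemma eLpNorm_two_sq (f : α → F) : eLpNorm f 2 μ ^ 2 = ∫⁻ a, ‖f a‖ₑ ^ 2 ∂μ := by
  have h := eLpNorm_nnreal_pow_eq_lintegral (μ := μ) (f := f) (p := 2) two_ne_zero
  have h2 : ((2 : ℝ≥0) : ℝ) = ((2 : ℕ) : ℝ) := by norm_num
  rw [h2] at h
  simp only [ENNReal.rpow_natCast] at h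
  exact_mod_cast h

/-- The Itô integral is defined by squared Lebesgue integrals, whereas the triangle inequality and
completeness are available for the L² seminorm. -/
lemma tendsto_lintegral_sq_iff {ι : Type*} {l : Filter ι} {f : ι → α → F} :
    Tendsto (fun k => ∫⁻ a, ‖f k a‖ₑ ^ 2 ∂μ) l (𝓝 0) ↔
      Tendsto (fun k => eLpNorm (f k) 2 μ) l (𝓝 0) := by
  simp only [← eLpNorm_two_sq]
  constructor
  · intro h
    have := (ENNReal.continuous_rpow_const (y := (1 / 2 : ℝ))).tendsto 0 |>.comp h
    rw [ENNReal.zero_rpow_of_pos (by norm_num)] at this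
    refine this.congr fun k => ?_
    simp only [Function.comp, ← ENNReal.rpow_natCast, ← ENNReal.rpow_mul]
    norm_num
  · intro h
    simpa using ENNReal.Tendsto.pow (n := 2) h

lemma integral_norm_sq_eq {f : α → F} (hf : AEStronglyMeasurable f μ) :
    ∫ a, ‖f a‖ ^ 2 ∂μ = (eLpNorm f 2 μ).toReal ^ 2 := by
  rw [← ENNReal.toReal_pow, eLpNorm_two_sq, integral_eq_lintegral_of_nonneg_ae
    (Eventually.of_forall fun _ => by positivity) (by fun_prop)]
  congr 1
  refine lintegral_congr fun a => ?_
  rw [ENNReal.ofReal_pow (norm_nonneg _), ofReal_norm]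

lemma lintegral_enorm_sq_eq_ofReal {f : α → F} (hf : MemLp f 2 μ) :
    ∫⁻ a, ‖f a‖ₑ ^ 2 ∂μ = ENNReal.ofReal (∫ a, ‖f a‖ ^ 2 ∂μ) := by
  rw [integral_norm_sq_eq hf.1, ← ENNReal.toReal_pow, ENNReal.ofReal_toReal, eLpNorm_two_sq]
  exact (ENNReal.pow_lt_top hf.2).ne

lemma memLp_of_tendsto_eLpNorm_sub {f : ℕ → α → F} {g : α → F} (hf : ∀ k, MemLp (f k) 2 μ)
    (hg : AEStronglyMeasurable g μ) (h : Tendsto (fun k => eLpNorm (g - f k) 2 μ) atTop (𝓝 0)) :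
    MemLp g 2 μ := by
  obtain ⟨k, hk⟩ := (h.eventually (gt_mem_nhds ENNReal.zero_lt_top)).exists
  have h1 : MemLp (g - f k) 2 μ := ⟨hg.sub (hf k).1, hk⟩
  simpa using h1.add (hf k)

/-- The reverse triangle inequality for the L² norm. It carries the isometry from simple integrands
to general ones. -/
lemma tendsto_integral_norm_sq {f : ℕ → α → F} {g : α → F} (hf : ∀ k, MemLp (f k) 2 μ)
    (hg : AEStronglyMeasurable g μ) (h : Tendsto (fun k => eLpNorm (g - f k) 2 μ) atTop (𝓝 0)) :
    Tendsto (fun k => ∫ a, ‖f k a‖ ^ 2 ∂μ) atTop (𝓝 (∫ a, ‖g a‖ ^ 2 ∂μ)) := by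
  have hg2 := memLp_of_tendsto_eLpNorm_sub hf hg h
  simp only [integral_norm_sq_eq (hf _).1, integral_norm_sq_eq hg]
  refine Tendsto.pow ?_ 2
  rw [tendsto_iff_dist_tendsto_zero]
  have h0 : Tendsto (fun k => (eLpNorm (g - f k) 2 μ).toReal) atTop (𝓝 0) := by
    simpa [Function.comp_def] using (ENNReal.tendsto_toReal ENNReal.zero_ne_top).comp h
  refine squeeze_zero (fun _ => dist_nonneg) (fun k => ?_) h0
  have hd : eLpNorm (g - f k) 2 μ ≠ ∞ := (hg2.sub (hf k)).2.ne
  rw [Real.dist_eq, abs_sub_le_iff, sub_le_iff_le_add, sub_le_iff_le_add]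
  constructor
  · rw [← ENNReal.toReal_add hd hg2.2.ne]
    refine ENNReal.toReal_mono (ENNReal.add_ne_top.2 ⟨hd, hg2.2.ne⟩) ?_
    have : f k = (f k - g) + g := by simp
    rw [eLpNorm_sub_comm]
    exact (congrArg (eLpNorm · 2 μ) this).le.trans
      (eLpNorm_add_le ((hf k).1.sub hg) hg one_le_two)
  · rw [← ENNReal.toReal_add hd (hf k).2.ne]
    refine ENNReal.toReal_mono (ENNReal.add_ne_top.2 ⟨hd, (hf k).2.ne⟩) ?_
    have : g = (g - f k) + f k := by simp
    exact (congrArg (eLpNorm · 2 μ) this).le.trans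
      (eLpNorm_add_le (hg.sub (hf k).1) (hf k).1 one_le_two)

lemma exists_tendsto_of_cauchy [CompleteSpace F] {f : ℕ → α → F} (hf : ∀ k, MemLp (f k) 2 μ)
    (h : ∀ ε : ℝ≥0∞, 0 < ε → ∃ n₀, ∀ k ≥ n₀, ∀ l ≥ n₀, eLpNorm (f k - f l) 2 μ < ε) :
    ∃ g, MemLp g 2 μ ∧ Tendsto (fun k => eLpNorm (g - f k) 2 μ) atTop (𝓝 0) := by
  have hc : CauchySeq fun k => (hf k).toLp (f k) := by
    refine EMetric.cauchySeq_iff.2 fun ε hε => ?_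
    obtain ⟨n₀, hn⟩ := h ε hε
    refine ⟨n₀, fun k hk l hl => ?_⟩
    rw [Lp.edist_toLp_toLp]
    exact hn k hk l hl
  obtain ⟨g, hg⟩ := cauchySeq_tendsto_of_complete hc
  refine ⟨g, Lp.memLp g, ?_⟩
  have := (Lp.tendsto_Lp_iff_tendsto_eLpNorm' _ _).1 hg
  refine this.congr fun k => ?_
  rw [eLpNorm_sub_comm]
  exact eLpNorm_congr_ae (EventuallyEq.rfl.sub (hf k).coeFn_toLp)

/-- Completeness of L² is applied to the trimmed measure on the smaller σ-algebra, so the limit is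
genuinely measurable for it. The filtration is not assumed complete and solutions must be adapted in
the strict sense. -/
lemma exists_stronglyMeasurable_tendsto_of_cauchy [CompleteSpace F] {m : MeasurableSpace α}
    (hm : m ≤ mα) {f : ℕ → α → F} (hfm : ∀ k, StronglyMeasurable[m] (f k))
    (hf : ∀ k, MemLp (f k) 2 μ)
    (h : ∀ ε : ℝ≥0∞, 0 < ε → ∃ n₀, ∀ k ≥ n₀, ∀ l ≥ n₀, eLpNorm (f k - f l) 2 μ < ε) :
    ∃ g, StronglyMeasurable[m] g ∧
      Tendsto (fun k => eLpNorm (g - f k) 2 μ) atTop (𝓝 0) := by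
  obtain ⟨g, hg, hlim⟩ := exists_tendsto_of_cauchy (mα := m) (μ := μ.trim hm) (f := f)
    (fun k => ⟨(hfm k).aestronglyMeasurable, (eLpNorm_trim hm (hfm k)).trans_lt (hf k).2⟩) (by
      intro ε hε
      obtain ⟨n₀, hn⟩ := h ε hε
      refine ⟨n₀, fun k hk l hl => ?_⟩
      rw [eLpNorm_trim hm ((hfm k).sub (hfm l))]
      exact hn k hk l hl)
  refine ⟨hg.1.mk g, hg.1.stronglyMeasurable_mk, hlim.congr fun k => ?_⟩
  rw [← eLpNorm_trim hm (hg.1.stronglyMeasurable_mk.sub (hfm k))]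
  exact eLpNorm_congr_ae (hg.1.ae_eq_mk.sub EventuallyEq.rfl)

/-- L² convergence gives convergence in measure, hence almost sure convergence along a further
subsequence of any subsequence; dominated convergence with the bound ‖φ‖ then applies. -/
lemma tendsto_setIntegral_boundedContinuous [MeasurableSpace F] [BorelSpace F]
    [SecondCountableTopology F]
    [IsFiniteMeasure μ] {f : ℕ → α → F} {g : α → F} (hf : ∀ k, AEMeasurable (f k) μ)
    (hg : AEMeasurable g μ) (h : Tendsto (fun k => eLpNorm (g - f k) 2 μ) atTop (𝓝 0))
    (φ : F →ᵇ ℝ) (A : Set α) :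
    Tendsto (fun k => ∫ a in A, φ (f k a) ∂μ) atTop (𝓝 (∫ a in A, φ (g a) ∂μ)) := by
  have hm : TendstoInMeasure μ f atTop g :=
    tendstoInMeasure_of_tendsto_eLpNorm two_ne_zero (fun k => (hf k).aestronglyMeasurable)
      hg.aestronglyMeasurable (h.congr fun k => eLpNorm_sub_comm _ _ _ _)
  refine tendsto_of_subseq_tendsto fun ns hns => ?_
  obtain ⟨ms, -, hms⟩ := (hm.comp hns).exists_seq_tendsto_ae'
  refine ⟨ms, tendsto_integral_of_dominated_convergence (fun _ => ‖φ‖)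
    (fun k => ?_) (integrable_const _) (fun k => ?_) ?_⟩
  · exact (φ.continuous.measurable.comp_aemeasurable (hf _)).aestronglyMeasurable.restrict
  · exact Eventually.of_forall fun a => φ.norm_coe_le_norm _
  · filter_upwards [ae_restrict_of_ae hms] with a ha
    exact (φ.continuous.tendsto _).comp ha

end SquareIntegrable

/-! ### Algebra of simple integrands -/

section SimpleIntegrand

variable {Ω Ω' Z : Type*} [MeasurableSpace Z] {𝓖 : MeasurableSpace Ω} {𝓗 : MeasurableSpace Ω'}
  {ν : Measure Z} {d : ℕ}

namespace SimpleIntegrand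

/-- The zero simple integrand. -/
def zero (𝓖 : MeasurableSpace Ω) (ν : Measure Z) (d : ℕ) : SimpleIntegrand Ω 𝓖 ν d where
  card := 0
  coef := fun i => i.elim0
  set := fun i => i.elim0
  measurable_coef := fun i => i.elim0
  bounded_coef := ⟨0, fun i => i.elim0⟩
  measurableSet_set := fun i => i.elim0
  measure_set_ne_top := fun i => i.elim0

/-- The sum of two simple integrands. -/
def add (S S' : SimpleIntegrand Ω 𝓖 ν d) : SimpleIntegrand Ω 𝓖 ν d where
  card := S.card + S'.card
  coef := Fin.append S.coef S'.coef
  set := Fin.append S.set S'.set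
  measurable_coef := fun i => by
    refine Fin.addCases (fun i => ?_) (fun i => ?_) i
    · simpa using S.measurable_coef i
    · simpa using S'.measurable_coef i
  bounded_coef := by
    obtain ⟨C, hC⟩ := S.bounded_coef
    obtain ⟨C', hC'⟩ := S'.bounded_coef
    refine ⟨max C C', fun i => ?_⟩
    refine Fin.addCases (fun i ω => ?_) (fun i ω => ?_) i
    · simpa using Or.inl (hC i ω)
    · simpa using Or.inr (hC' i ω)
  measurableSet_set := fun i => by
    refine Fin.addCases (fun i => ?_) (fun i => ?_) i
    · simpa using S.measurableSet_set i
    · simpa using S'.measurableSet_set i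
  measure_set_ne_top := fun i => by
    refine Fin.addCases (fun i => ?_) (fun i => ?_) i
    · simpa using S.measure_set_ne_top i
    · simpa using S'.measure_set_ne_top i

/-- The product of a simple integrand and a bounded random variable. -/
def mulCoef (S : SimpleIntegrand Ω 𝓖 ν d) (c : Ω → ℝ) (hc : Measurable c)
    (hb : ∀ ω, |c ω| ≤ 1) : SimpleIntegrand Ω 𝓖 ν d where
  card := S.card
  coef := fun i ω => c ω • S.coef i ω
  set := S.set
  measurable_coef := fun i => hc.smul (S.measurable_coef i)
  bounded_coef := by
    obtain ⟨C, hC⟩ := S.bounded_coef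
    refine ⟨C, fun i ω => ?_⟩
    rw [norm_smul, Real.norm_eq_abs]
    exact (mul_le_of_le_one_left (norm_nonneg _) (hb ω)).trans (hC i ω)
  measurableSet_set := S.measurableSet_set
  measure_set_ne_top := S.measure_set_ne_top

/-- The composition of a simple integrand with a measurable map. -/
def comp (S : SimpleIntegrand Ω 𝓖 ν d) (X : Ω' → Ω) (hX : Measurable X) :
    SimpleIntegrand Ω' 𝓗 ν d where
  card := S.card
  coef := fun i ω => S.coef i (X ω)
  set := S.set
  measurable_coef := fun i => (S.measurable_coef i).comp hX
  bounded_coef := by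
    obtain ⟨C, hC⟩ := S.bounded_coef
    exact ⟨C, fun i ω => hC i (X ω)⟩
  measurableSet_set := S.measurableSet_set
  measure_set_ne_top := S.measure_set_ne_top

/-- The simple integrand `1_{A × B} c`. -/
def rect (ν : Measure Z) {A : Set Ω} (hA : MeasurableSet[𝓖] A) {B : Set Z} (hB : MeasurableSet B)
    (hν : ν B ≠ ∞) (c : EuclideanSpace ℝ (Fin d)) : SimpleIntegrand Ω 𝓖 ν d where
  card := 1
  coef := fun _ => A.indicator fun _ => c
  set := fun _ => B
  measurable_coef := fun _ => measurable_const.indicator hA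
  bounded_coef := ⟨‖c‖, fun _ ω => norm_indicator_le_norm_self _ ω⟩
  measurableSet_set := fun _ => hB
  measure_set_ne_top := fun _ => hν

@[simp] lemma eval_zero (ω : Ω) (z : Z) : (zero 𝓖 ν d).eval ω z = 0 :=
  Finset.sum_eq_zero fun i => i.elim0

@[simp] lemma eval_add (S S' : SimpleIntegrand Ω 𝓖 ν d) (ω : Ω) (z : Z) :
    (S.add S').eval ω z = S.eval ω z + S'.eval ω z := by
  exact (Fin.sum_univ_add _).trans (by simp [eval, add])

@[simp] lemma eval_mulCoef (S : SimpleIntegrand Ω 𝓖 ν d) {c : Ω → ℝ} (hc : Measurable c)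
    (hb : ∀ ω, |c ω| ≤ 1) (ω : Ω) (z : Z) :
    (S.mulCoef c hc hb).eval ω z = c ω • S.eval ω z := by
  simp only [eval, mulCoef, Finset.smul_sum]
  refine Finset.sum_congr rfl fun i _ => ?_
  by_cases h : z ∈ S.set i <;> simp [h]

lemma eval_rect {A : Set Ω} (hA : MeasurableSet[𝓖] A) {B : Set Z} (hB : MeasurableSet B)
    (hν : ν B ≠ ∞) (c : EuclideanSpace ℝ (Fin d)) :
    Function.uncurry (rect ν hA hB hν c).eval = (A ×ˢ B).indicator fun _ => c := by
  ext ⟨ω, z⟩ : 1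
  by_cases h1 : ω ∈ A <;> by_cases h2 : z ∈ B <;> simp [eval, rect, h1, h2]

@[simp] lemma integral_add (S S' : SimpleIntegrand Ω 𝓖 ν d) (N : Ω → Measure (ℝ × Z)) (s t : ℝ≥0)
    (ω : Ω) : (S.add S').integral N s t ω = S.integral N s t ω + S'.integral N s t ω := by
  exact (Fin.sum_univ_add _).trans (by simp [integral, add])

@[simp] lemma integral_zero (N : Ω → Measure (ℝ × Z)) (s t : ℝ≥0)
    (ω : Ω) : (zero 𝓖 ν d).integral N s t ω = 0 :=
  Finset.sum_eq_zero fun i => i.elim0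

@[simp] lemma integral_mulCoef (S : SimpleIntegrand Ω 𝓖 ν d) {c : Ω → ℝ} (hc : Measurable c)
    (hb : ∀ ω, |c ω| ≤ 1) (N : Ω → Measure (ℝ × Z)) (s t : ℝ≥0) (ω : Ω) :
    (S.mulCoef c hc hb).integral N s t ω = c ω • S.integral N s t ω := by
  simp only [integral, mulCoef, Finset.smul_sum]
  exact Finset.sum_congr rfl fun i _ => smul_comm _ _ _

lemma measurable_eval (S : SimpleIntegrand Ω 𝓖 ν d) : Measurable (Function.uncurry S.eval) := by
  have : Function.uncurry S.eval = fun p => ∑ i, (univ ×ˢ S.set i).indicator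
      (fun p : Ω × Z => S.coef i p.1) p := by
    ext p : 1
    simp only [Function.uncurry, eval]
    refine Finset.sum_congr rfl fun i _ => ?_
    by_cases h : p.2 ∈ S.set i <;> simp [h, indicator]
  rw [this]
  refine Finset.measurable_sum _ fun i _ => ?_
  exact ((S.measurable_coef i).comp measurable_fst).indicator
    (MeasurableSet.univ.prod (S.measurableSet_set i))

lemma memLp_eval (S : SimpleIntegrand Ω 𝓖 ν d) (μ : Measure Ω) [IsFiniteMeasure μ]
    [SFinite ν] : MemLp (Function.uncurry S.eval) 2 (μ.prod ν) := by
  have : Function.uncurry S.eval = fun p => ∑ i, (univ ×ˢ S.set i).indicator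
      (fun p : Ω × Z => S.coef i p.1) p := by
    ext p : 1
    simp only [Function.uncurry, eval]
    refine Finset.sum_congr rfl fun i _ => ?_
    by_cases h : p.2 ∈ S.set i <;> simp [h, indicator]
  rw [this]
  obtain ⟨C, hC⟩ := S.bounded_coef
  refine memLp_finsetSum _ fun i _ => ?_
  have hs : MeasurableSet ((univ : Set Ω) ×ˢ S.set i) :=
    MeasurableSet.univ.prod (S.measurableSet_set i)
  refine (memLp_indicator_iff_restrict hs).2 ?_
  have : IsFiniteMeasure ((μ.prod ν).restrict (univ ×ˢ S.set i)) := by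
    refine ⟨?_⟩
    rw [Measure.restrict_apply_univ, Measure.prod_prod]
    exact ENNReal.mul_lt_top (measure_lt_top _ _) (S.measure_set_ne_top i).lt_top
  exact MemLp.of_bound ((S.measurable_coef i).comp measurable_fst).aestronglyMeasurable C
    (Eventually.of_forall fun p => hC i p.1)

end SimpleIntegrand

end SimpleIntegrand

/-! ### Density of simple integrands in L²(μ ⊗ ν) -/

section Density

variable {Ω Z : Type*} [MeasurableSpace Z] {𝓖 : MeasurableSpace Ω} {ν : Measure Z}
  {d : ℕ}

/-- `f` is in the `L²(μ ⊗ ν)`-closure of the simple integrands. -/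
def IsSimpleApproximable (μ : Measure Ω) (ν : Measure Z) (f : Ω × Z → EuclideanSpace ℝ (Fin d)) :
    Prop :=
  ∀ ε : ℝ≥0∞, ε ≠ 0 → ∃ S : SimpleIntegrand Ω 𝓖 ν d,
    eLpNorm (Function.uncurry S.eval - f) 2 (μ.prod ν) ≤ ε

variable {μ : Measure Ω} {f g : Ω × Z → EuclideanSpace ℝ (Fin d)}

lemma IsSimpleApproximable.of_eq (S : SimpleIntegrand Ω 𝓖 ν d) :
    IsSimpleApproximable μ ν (Function.uncurry S.eval) :=
  fun ε _ => ⟨S, by simp⟩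

lemma IsSimpleApproximable.add (hf : IsSimpleApproximable μ ν f)
    (hg : IsSimpleApproximable μ ν g) (hfm : AEStronglyMeasurable f (μ.prod ν))
    (hgm : AEStronglyMeasurable g (μ.prod ν)) : IsSimpleApproximable μ ν (f + g) := by
  intro ε hε
  obtain ⟨S, hS⟩ := hf (ε / 2) (by simpa using hε)
  obtain ⟨S', hS'⟩ := hg (ε / 2) (by simpa using hε)
  refine ⟨S.add S', ?_⟩
  have : Function.uncurry (S.add S').eval - (f + g)
      = (Function.uncurry S.eval - f) + (Function.uncurry S'.eval - g) := by
    ext p : 1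
    simp only [Function.uncurry, Pi.sub_apply, Pi.add_apply, SimpleIntegrand.eval_add]
    abel
  rw [this]
  refine (eLpNorm_add_le (S.measurable_eval.aestronglyMeasurable.sub hfm)
    (S'.measurable_eval.aestronglyMeasurable.sub hgm) one_le_two).trans ?_
  exact (add_le_add hS hS').trans_eq (ENNReal.add_halves ε)

lemma IsSimpleApproximable.neg (hf : IsSimpleApproximable μ ν f) :
    IsSimpleApproximable μ ν (-f) := by
  intro ε hε
  obtain ⟨S, hS⟩ := hf ε hε
  refine ⟨S.mulCoef (fun _ => -1) measurable_const (by simp), ?_⟩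
  have : Function.uncurry (S.mulCoef (fun _ => -1) measurable_const (by simp)).eval - -f
      = -(Function.uncurry S.eval - f) := by
    ext p : 1
    simp only [Function.uncurry, Pi.sub_apply, Pi.neg_apply, SimpleIntegrand.eval_mulCoef, neg_smul, one_smul]
    abel
  rwa [this, eLpNorm_neg]

/-- The error of replacing the union by s k has norm ‖c‖ times the square root of the measure of the
remainder, which tends to 0 by continuity from above, the union having finite measure. -/
lemma IsSimpleApproximable.of_monotone {c : EuclideanSpace ℝ (Fin d)} {s : ℕ → Set (Ω × Z)}
    (hs : ∀ k, MeasurableSet (s k)) (hmono : Monotone s) (hfin : μ.prod ν (⋃ k, s k) ≠ ∞)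
    (h : ∀ k, IsSimpleApproximable μ ν ((s k).indicator fun _ => c)) :
    IsSimpleApproximable μ ν ((⋃ k, s k).indicator fun _ => c) := by
  intro ε hε
  have hU : MeasurableSet (⋃ k, s k) := MeasurableSet.iUnion hs
  have hlim : Tendsto (fun k => μ.prod ν ((⋃ k, s k) \ s k)) atTop (𝓝 0) := by
    have := tendsto_measure_iInter_atTop (μ := μ.prod ν) (s := fun k => (⋃ k, s k) \ s k)
      (fun k => (hU.diff (hs k)).nullMeasurableSet)
      (fun k l hkl => sdiff_subset_sdiff_right (hmono hkl))
      ⟨0, ne_top_of_le_ne_top hfin (measure_mono sdiff_subset)⟩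
    rwa [← sdiff_iUnion, sdiff_self, measure_empty] at this
  have hlim2 : Tendsto (fun k => eLpNorm (((⋃ k, s k) \ s k).indicator fun _ => c) 2 (μ.prod ν))
      atTop (𝓝 0) := by
    have h1 := (ENNReal.continuous_rpow_const (y := (1 / (2 : ℝ≥0∞).toReal))).tendsto 0
      |>.comp hlim
    rw [ENNReal.zero_rpow_of_pos (by simp)] at h1
    have h2 := ENNReal.Tendsto.const_mul (a := ‖c‖ₑ) h1 (Or.inr enorm_ne_top)
    rw [mul_zero] at h2
    refine h2.congr fun k => ?_
    rw [eLpNorm_indicator_const (hU.diff (hs k)) two_ne_zero ENNReal.ofNat_ne_top]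
    rfl
  have hε2 : 0 < ε / 2 := by simpa [pos_iff_ne_zero] using hε
  obtain ⟨k, hk⟩ := (hlim2.eventually (gt_mem_nhds hε2)).exists
  obtain ⟨S, hS⟩ := h k (ε / 2) hε2.ne'
  refine ⟨S, ?_⟩
  have : Function.uncurry S.eval - (⋃ k, s k).indicator (fun _ => c)
      = (Function.uncurry S.eval - (s k).indicator fun _ => c)
        - ((⋃ k, s k) \ s k).indicator fun _ => c := by
    rw [sub_sub, indicator_sdiff' (subset_iUnion s k)]
    simp
  rw [this]
  refine (eLpNorm_sub_le (S.measurable_eval.aestronglyMeasurable.sub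
    (aestronglyMeasurable_const.indicator (hs k)))
    (aestronglyMeasurable_const.indicator (hU.diff (hs k))) one_le_two).trans ?_
  exact (add_le_add hS hk.le).trans_eq (ENNReal.add_halves ε)

variable [IsFiniteMeasure μ]

/-- A π-λ induction starting from measurable rectangles. Everything is intersected with Ω × B, where
ν(B) < ∞, so that complements keep finite measure. -/
lemma IsSimpleApproximable.indicator_inter [SFinite ν] {B : Set Z} (hB : MeasurableSet B) (hν : ν B ≠ ∞)
    (c : EuclideanSpace ℝ (Fin d)) {s : Set (Ω × Z)} (hs : MeasurableSet s) :
    IsSimpleApproximable μ ν ((s ∩ univ ×ˢ B).indicator fun _ => c) := by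
  have hR : MeasurableSet ((univ : Set Ω) ×ˢ B) := MeasurableSet.univ.prod hB
  have hRfin : μ.prod ν (univ ×ˢ B) ≠ ∞ := by
    rw [Measure.prod_prod]
    exact ENNReal.mul_ne_top (measure_ne_top _ _) hν
  have hm : ∀ {u : Set (Ω × Z)}, MeasurableSet u →
      AEStronglyMeasurable (u.indicator fun _ => c) (μ.prod ν) := fun hu =>
    aestronglyMeasurable_const.indicator hu
  have hrect : ∀ {A : Set Ω} {B' : Set Z}, MeasurableSet A → MeasurableSet B' → ν B' ≠ ∞ →
      IsSimpleApproximable μ ν ((A ×ˢ B').indicator fun _ => c) := by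
    intro A B' hA hB' hν'
    rw [← SimpleIntegrand.eval_rect hA hB' hν' c]
    exact .of_eq _
  induction s, hs using MeasurableSpace.induction_on_inter generateFrom_prod.symm
    isPiSystem_prod with
  | empty =>
    have h0 := IsSimpleApproximable.of_eq (μ := μ) (SimpleIntegrand.zero 𝓖 ν d)
    have h1 : Function.uncurry (SimpleIntegrand.zero 𝓖 ν d).eval = fun _ => 0 := by
      ext p : 1
      simp [Function.uncurry]
    simpa [h1] using h0
  | basic t ht =>
    obtain ⟨A, hA, B', hB', rfl⟩ := ht
    rw [prod_inter_prod]
    exact hrect (hA.inter .univ) (hB'.inter hB)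
      (ne_top_of_le_ne_top hν (measure_mono inter_subset_right))
  | compl t htm ih =>
    have : (tᶜ ∩ univ ×ˢ B).indicator (fun _ => c)
        = (univ ×ˢ B).indicator (fun _ => c) + -(t ∩ univ ×ˢ B).indicator fun _ => c := by
      rw [← sub_eq_add_neg, ← indicator_sdiff inter_subset_right]
      congr 1
      ext p
      simp only [mem_inter_iff, mem_compl_iff, Set.mem_sdiff]
      tauto
    rw [this]
    exact (hrect .univ hB hν).add ih.neg (hm hR) (hm (htm.inter hR)).neg
  | iUnion f hd hfm ih =>
    have hacm : ∀ k, MeasurableSet (accumulate f k) := fun k =>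
      MeasurableSet.biUnion (to_countable _) fun i _ => hfm i
    have hacc : ∀ k, IsSimpleApproximable μ ν
        ((accumulate f k ∩ univ ×ˢ B).indicator fun _ => c) := by
      intro k
      induction k with
      | zero => simpa using ih 0
      | succ k ihk =>
        have hdis : Disjoint (accumulate f k ∩ univ ×ˢ B) (f (k + 1) ∩ univ ×ˢ B) :=
          (disjoint_accumulate hd k.lt_succ_self).mono inter_subset_left inter_subset_left
        rw [accumulate_succ, union_inter_distrib_right, indicator_union_of_disjoint hdis]
        exact ihk.add (ih (k + 1)) (hm ((hacm k).inter hR))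
          (hm ((hfm _).inter hR))
    have := IsSimpleApproximable.of_monotone (μ := μ) (ν := ν) (c := c)
      (s := fun k => accumulate f k ∩ univ ×ˢ B)
      (fun k => (hacm k).inter hR)
      (fun k l hkl => inter_subset_inter_left _ (monotone_accumulate hkl))
      (ne_top_of_le_ne_top hRfin (measure_mono (iUnion_subset fun k => inter_subset_right))) hacc
    rwa [← iUnion_inter, iUnion_accumulate] at this

/-- The simple integrands are dense in `L²(μ ⊗ ν)`. -/
theorem IsSimpleApproximable.of_memLp {ν : Measure Z} [SigmaFinite ν]
    (hf : MemLp f 2 (μ.prod ν)) : IsSimpleApproximable μ ν f := by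
  intro ε hε
  obtain ⟨g, hg, S, rfl⟩ := MemLp.induction_dense (p := 2) (μ := μ.prod ν) ENNReal.ofNat_ne_top
    (fun g => ∃ S : SimpleIntegrand Ω 𝓖 ν d, g = Function.uncurry S.eval)
    (by
      intro c s hs hfin ε hε
      -- By σ-finiteness, a set of finite product measure is the increasing union of its traces on
      -- strips of finite ν-measure, to which the two preceding lemmas apply.
      have hu : (⋃ k, s ∩ univ ×ˢ spanningSets ν k) = s := by
        rw [← inter_iUnion, ← prod_iUnion, iUnion_spanningSets, univ_prod_univ, inter_univ]
      have := IsSimpleApproximable.of_monotone (μ := μ) (ν := ν) (c := c)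
        (s := fun k => s ∩ univ ×ˢ spanningSets ν k)
        (fun k => hs.inter (MeasurableSet.univ.prod (measurableSet_spanningSets ν k)))
        (fun k l hkl => inter_subset_inter_right _
          (prod_mono_right (monotone_spanningSets ν hkl)))
        (by rw [hu]; exact hfin.ne)
        (fun k => IsSimpleApproximable.indicator_inter (measurableSet_spanningSets ν k)
          (measure_spanningSets_lt_top ν k).ne c hs)
      rw [hu] at this
      obtain ⟨S, hS⟩ := this ε hε
      exact ⟨_, hS, S, rfl⟩)
    (by
      rintro _ _ ⟨S, rfl⟩ ⟨S', rfl⟩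
      refine ⟨S.add S', ?_⟩
      ext p : 1
      simp [Function.uncurry])
    (by
      rintro _ ⟨S, rfl⟩
      exact S.measurable_eval.aestronglyMeasurable) hf hε
  exact ⟨S, by rwa [eLpNorm_sub_comm]⟩

end Density

/-! ### Moments of the Poisson distribution -/

section Poisson

/-- The identity E[n g(n)] = r E[g(n+1)], obtained by the index shift n/n! = 1/(n−1)!, the term n =
0 being zero. With g = 1 and g(n) = n it gives the first two moments. -/
lemma hasSum_poisson_natCast_mul {r : ℝ≥0} {g : ℕ → ℝ} {S : ℝ}
    (h : HasSum (fun n : ℕ => Real.exp (-r) * r ^ n / n.factorial * g (n + 1)) S) :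
    HasSum (fun n : ℕ => Real.exp (-r) * r ^ n / n.factorial * (n * g n)) (r * S) := by
  have h1 := (hasSum_nat_add_iff (f := fun n : ℕ =>
    Real.exp (-r) * (r : ℝ) ^ n / n.factorial * (n * g n)) (g := r * S) 1).1 (by
      refine (h.mul_left (r : ℝ)).congr_fun ?_ |> id
      intro n
      rw [Nat.factorial_succ]
      push_cast
      have := Nat.factorial_ne_zero n
      field_simp
      ring)
  simpa using h1

lemma hasSum_poisson_id (r : ℝ≥0) :
    HasSum (fun n : ℕ => Real.exp (-r) * r ^ n / n.factorial * (n : ℝ)) r := by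
  have := hasSum_poisson_natCast_mul (r := r) (g := fun _ => 1) (S := 1)
    (by simpa using hasSum_one_poissonMeasure r)
  simpa using this

lemma hasSum_poisson_sq (r : ℝ≥0) :
    HasSum (fun n : ℕ => Real.exp (-r) * r ^ n / n.factorial * (n : ℝ) ^ 2)
      ((r : ℝ) * (r + 1)) := by
  have h := hasSum_poisson_natCast_mul (r := r) (g := fun n => n) (S := r + 1) (by
    refine ((hasSum_poisson_id r).add (hasSum_one_poissonMeasure r)).congr_fun ?_ |> id
    intro n
    push_cast
    ring)
  simpa [sq] using h

lemma integral_id_poissonMeasure (r : ℝ≥0) : ∫ n, (n : ℝ) ∂(poissonMeasure r) = r := by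
  rw [integral_poissonMeasure]
  exact (hasSum_poisson_id r).tsum_eq

lemma integrable_sq_poissonMeasure (r : ℝ≥0) :
    Integrable (fun n : ℕ => (n : ℝ) ^ 2) (poissonMeasure r) := by
  rw [integrable_poissonMeasure_iff]
  simpa using (hasSum_poisson_sq r).summable

lemma memLp_id_poissonMeasure (r : ℝ≥0) : MemLp (fun n : ℕ => (n : ℝ)) 2 (poissonMeasure r) :=
  (memLp_two_iff_integrable_sq .of_discrete).2 (integrable_sq_poissonMeasure r)

lemma integral_sub_sq_poissonMeasure (r : ℝ≥0) :
    ∫ n, ((n : ℝ) - r) ^ 2 ∂(poissonMeasure r) = r := by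
  have h1 := (memLp_id_poissonMeasure r).integrable one_le_two
  have h2 := integrable_sq_poissonMeasure r
  have h3 : ∫ n, (n : ℝ) ^ 2 ∂(poissonMeasure r) = r * (r + 1) := by
    rw [integral_poissonMeasure]
    exact (hasSum_poisson_sq r).tsum_eq
  have : ∀ n : ℕ, ((n : ℝ) - r) ^ 2 = (n : ℝ) ^ 2 - (2 * r) * n + r ^ 2 := fun n => by ring
  simp only [this]
  have h4 : Integrable (fun n : ℕ => (n : ℝ) ^ 2 - 2 * r * n) (poissonMeasure r) :=
    h2.sub (h1.const_mul _)
  rw [integral_add h4 (integrable_const _),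
    integral_sub h2 (h1.const_mul _), integral_const_mul, h3, integral_id_poissonMeasure]
  simp
  ring

variable {Ω : Type*} [MeasurableSpace Ω] {P : Measure Ω} {Y : Ω → ℝ≥0∞} {r : ℝ≥0}

/-- Counts take values in [0,∞]; finiteness is what makes `ENNReal.toReal` additive on them. -/
lemma ae_ne_top_of_hasLaw_poisson
    (h : HasLaw Y ((poissonMeasure r).map (fun k : ℕ => (k : ℝ≥0∞))) P) : ∀ᵐ ω ∂P, Y ω ≠ ∞ := by
  have : ∀ᵐ y ∂((poissonMeasure r).map (fun k : ℕ => (k : ℝ≥0∞))), y ≠ ∞ := by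
    refine (ae_map_iff Measurable.of_discrete.aemeasurable
      (measurableSet_singleton ∞).compl).2 ?_
    exact Eventually.of_forall fun k => ENNReal.natCast_ne_top k
  rw [← h.map_eq] at this
  exact ae_of_ae_map h.aemeasurable this

lemma hasLaw_toReal_poisson
    (h : HasLaw Y ((poissonMeasure r).map (fun k : ℕ => (k : ℝ≥0∞))) P) :
    HasLaw (fun ω => (Y ω).toReal) ((poissonMeasure r).map (fun k : ℕ => (k : ℝ))) P := by
  refine ⟨h.aemeasurable.ennreal_toReal, ?_⟩
  have : (fun ω => (Y ω).toReal) = ENNReal.toReal ∘ Y := rfl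
  rw [this, ← AEMeasurable.map_map_of_aemeasurable ENNReal.measurable_toReal.aemeasurable
    h.aemeasurable, h.map_eq, Measure.map_map ENNReal.measurable_toReal .of_discrete]
  congr 1

lemma memLp_toReal_of_hasLaw_poisson
    (h : HasLaw Y ((poissonMeasure r).map (fun k : ℕ => (k : ℝ≥0∞))) P) :
    MemLp (fun ω => (Y ω).toReal) 2 P := by
  have h' := hasLaw_toReal_poisson h
  have h2 : MemLp (id : ℝ → ℝ) 2 ((poissonMeasure r).map (fun k : ℕ => (k : ℝ))) := by
    rw [memLp_map_measure_iff aestronglyMeasurable_id Measurable.of_discrete.aemeasurable]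
    exact memLp_id_poissonMeasure r
  rw [← h'.map_eq, memLp_map_measure_iff aestronglyMeasurable_id h'.aemeasurable] at h2
  exact h2

lemma integral_toReal_of_hasLaw_poisson
    (h : HasLaw Y ((poissonMeasure r).map (fun k : ℕ => (k : ℝ≥0∞))) P) :
    ∫ ω, (Y ω).toReal ∂P = r := by
  rw [(hasLaw_toReal_poisson h).integral_eq]
  refine (integral_map Measurable.of_discrete.aemeasurable aestronglyMeasurable_id).trans ?_
  exact integral_id_poissonMeasure r

lemma integral_toReal_sub_sq_of_hasLaw_poisson
    (h : HasLaw Y ((poissonMeasure r).map (fun k : ℕ => (k : ℝ≥0∞))) P) :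
    ∫ ω, ((Y ω).toReal - r) ^ 2 ∂P = r := by
  have hm : Measurable fun x : ℝ => (x - r) ^ 2 := by fun_prop
  have := (hasLaw_toReal_poisson h).integral_comp (f := fun x => (x - r) ^ 2)
    hm.aestronglyMeasurable
  simp only [Function.comp_def] at this
  rw [this, integral_map Measurable.of_discrete.aemeasurable hm.aestronglyMeasurable]
  exact integral_sub_sq_poissonMeasure r

end Poisson

/-! ### Second moment of a random combination of independent noise -/

section IndependentCombination

variable {Ω ι E : Type*} {mΩ : MeasurableSpace Ω} [Fintype ι] [NormedAddCommGroup E]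
  [InnerProductSpace ℝ E] {P : Measure Ω}

lemma indepFun_of_indep_comap {β γ : Type*} [MeasurableSpace β] [MeasurableSpace γ]
    {𝓖 : MeasurableSpace Ω} {η : Ω → β} {g : Ω → γ}
    (h : Indep 𝓖 (MeasurableSpace.comap η inferInstance) P) (hg : Measurable[𝓖] g) :
    IndepFun g η P :=
  (IndepFun_iff_Indep _ _ _).2 (indep_of_indep_of_le_left h hg.comap_le)

/-- A product of two L² variables is in general only in L¹; independence makes |Y|²|V|² a product of
independent integrable variables. -/
lemma memLp_smul_of_indepFun [MeasurableSpace E] [BorelSpace E] {Y : Ω → ℝ} {V : Ω → E}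
    (h : IndepFun V Y P) (hV : MemLp V 2 P) (hY : MemLp Y 2 P) :
    MemLp (fun ω => Y ω • V ω) 2 P := by
  refine (memLp_two_iff_integrable_sq_norm (hY.1.smul hV.1)).2 ?_
  have h1 : IndepFun (fun ω => ‖V ω‖ ^ 2) (fun ω => (Y ω) ^ 2) P :=
    h.comp (φ := fun x => ‖x‖ ^ 2) (ψ := fun y => y ^ 2) (by fun_prop) (by fun_prop)
  have h2 := h1.integrable_mul ((memLp_two_iff_integrable_sq_norm hV.1).1 hV)
    ((memLp_two_iff_integrable_sq hY.1).1 hY)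
  refine h2.congr (Eventually.of_forall fun ω => ?_)
  simp [norm_smul, mul_pow, mul_comm]

variable [IsProbabilityMeasure P]

/-- Second moment of `V + ∑ i, η i • A i` when `V`, `A` are `𝓖`-measurable and the centred random
vector `η` is independent of `𝓖` with covariance `c`. -/
theorem integral_norm_sq_add_sum_smul [MeasurableSpace E] [BorelSpace E]
    [SecondCountableTopology E] {𝓖 : MeasurableSpace Ω} {η : Ω → ι → ℝ} (hind : Indep 𝓖 (MeasurableSpace.comap η inferInstance) P)
    (hη : ∀ i, MemLp (fun ω => η ω i) 2 P) (hmean : ∀ i, ∫ ω, η ω i ∂P = 0)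
    {c : ι → ι → ℝ} (hcov : ∀ i j, ∫ ω, η ω i * η ω j ∂P = c i j)
    {V : Ω → E} (hVm : Measurable[𝓖] V) (hV : MemLp V 2 P)
    {A : ι → Ω → E} (hAm : ∀ i, Measurable[𝓖] (A i)) (hA : ∀ i, MemLp (A i) 2 P) :
    MemLp (fun ω => V ω + ∑ i, η ω i • A i ω) 2 P ∧
      ∫ ω, ‖V ω + ∑ i, η ω i • A i ω‖ ^ 2 ∂P
        = ∫ ω, ‖V ω‖ ^ 2 ∂P + ∑ i, ∑ j, c i j * ∫ ω, inner ℝ (A i ω) (A j ω) ∂P := by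
  have hηA : ∀ i, MemLp (fun ω => η ω i • A i ω) 2 P := fun i =>
    memLp_smul_of_indepFun ((indepFun_of_indep_comap hind (hAm i)).comp measurable_id
      (measurable_pi_apply i)) (hA i) (hη i)
  have hsum : MemLp (fun ω => ∑ i, η ω i • A i ω) 2 P := memLp_finsetSum _ fun i _ => hηA i
  refine ⟨hV.add hsum, ?_⟩
  have hinner : ∀ {f g : Ω → E}, Measurable[𝓖] f → Measurable[𝓖] g →
      Measurable[𝓖] fun ω => inner ℝ (f ω) (g ω) := fun hf hg => hf.inner hg
  have hI : ∀ {f g : Ω → E}, MemLp f 2 P → MemLp g 2 P →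
      Integrable (fun ω => inner ℝ (f ω) (g ω)) P := fun hf hg =>
    (hf.norm.integrable_mul hg.norm).mono' (hf.1.inner hg.1)
      (Eventually.of_forall fun ω => norm_inner_le_norm _ _)
  -- In each term the 𝓖-measurable factor is separated from a linear or quadratic function of η, so
  -- expectations factor. The linear terms vanish by centring and the quadratic ones produce the
  -- covariances.
  have e1 : ∀ ω, ‖V ω + ∑ i, η ω i • A i ω‖ ^ 2 = ‖V ω‖ ^ 2
      + (2 * ∑ i, inner ℝ (V ω) (A i ω) * η ω i)
      + ∑ i, ∑ j, inner ℝ (A i ω) (A j ω) * (η ω i * η ω j) := by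
    intro ω
    rw [norm_add_sq_real, ← real_inner_self_eq_norm_sq (∑ i, η ω i • A i ω), sum_inner, inner_sum]
    congr 1
    · congr 2
      refine Finset.sum_congr rfl fun i _ => ?_
      rw [inner_smul_right, mul_comm]
    · refine Finset.sum_congr rfl fun i _ => ?_
      rw [inner_sum]
      refine Finset.sum_congr rfl fun j _ => ?_
      rw [inner_smul_left, inner_smul_right]
      simp only [conj_trivial]
      ring
  have hind1 : ∀ i, IndepFun (fun ω => inner ℝ (V ω) (A i ω)) (fun ω => η ω i) P := fun i =>
    (indepFun_of_indep_comap hind (hinner hVm (hAm i))).comp measurable_id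
      (measurable_pi_apply i)
  have hind2 : ∀ i j, IndepFun (fun ω => inner ℝ (A i ω) (A j ω)) (fun ω => η ω i * η ω j) P :=
    fun i j => (indepFun_of_indep_comap hind (hinner (hAm i) (hAm j))).comp measurable_id
      (ψ := fun y : ι → ℝ => y i * y j) ((measurable_pi_apply i).mul (measurable_pi_apply j))
  have hη1 : ∀ i, Integrable (fun ω => η ω i) P := fun i => (hη i).integrable one_le_two
  have hη2 : ∀ i j, Integrable (fun ω => η ω i * η ω j) P := fun i j =>
    (hη i).integrable_mul (hη j)
  have i1 : ∀ i, Integrable (fun ω => inner ℝ (V ω) (A i ω) * η ω i) P := fun i =>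
    (hind1 i).integrable_mul (hI hV (hA i)) (hη1 i)
  have i2 : ∀ i j, Integrable (fun ω => inner ℝ (A i ω) (A j ω) * (η ω i * η ω j)) P :=
    fun i j => (hind2 i j).integrable_mul (hI (hA i) (hA j)) (hη2 i j)
  have i0 : Integrable (fun ω => ‖V ω‖ ^ 2) P := (memLp_two_iff_integrable_sq_norm hV.1).1 hV
  have v1 : ∀ i, ∫ ω, inner ℝ (V ω) (A i ω) * η ω i ∂P = 0 := fun i => by
    rw [(hind1 i).integral_fun_mul_eq_mul_integral (hI hV (hA i)).1 (hη1 i).1, hmean, mul_zero]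
  have v2 : ∀ i j, ∫ ω, inner ℝ (A i ω) (A j ω) * (η ω i * η ω j) ∂P
      = c i j * ∫ ω, inner ℝ (A i ω) (A j ω) ∂P := fun i j => by
    rw [(hind2 i j).integral_fun_mul_eq_mul_integral (hI (hA i) (hA j)).1 (hη2 i j).1, hcov,
      mul_comm]
  simp only [e1]
  have j1 : Integrable (fun ω => 2 * ∑ i, inner ℝ (V ω) (A i ω) * η ω i) P :=
    (integrable_finsetSum _ fun i _ => i1 i).const_mul 2
  have j2 : Integrable (fun ω => ∑ i, ∑ j, inner ℝ (A i ω) (A j ω) * (η ω i * η ω j)) P :=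
    integrable_finsetSum _ fun i _ => integrable_finsetSum _ fun j _ => i2 i j
  have j0 : Integrable (fun ω => ‖V ω‖ ^ 2 + 2 * ∑ i, inner ℝ (V ω) (A i ω) * η ω i) P :=
    i0.add j1
  rw [integral_add j0 j2, integral_add i0 j1, integral_const_mul,
    integral_finsetSum _ fun i _ => i1 i,
    integral_finsetSum _ fun i _ => integrable_finsetSum _ fun j _ => i2 i j]
  simp only [v1, Finset.sum_const_zero, mul_zero, add_zero]
  congr 1
  refine Finset.sum_congr rfl fun i _ => ?_
  rw [integral_finsetSum _ fun j _ => i2 i j]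
  exact Finset.sum_congr rfl fun j _ => v2 i j

end IndependentCombination

/-! ### Increments of the driving noise: adaptedness, independence, covariances -/

section Noise

variable {m : ℕ} {Ω Z : Type*} [mΩ : MeasurableSpace Ω] [MeasurableSpace Z]
  {F : Filtration ℝ≥0 mΩ} {W : ℝ≥0 → Ω → EuclideanSpace ℝ (Fin m)} {N : Ω → Measure (ℝ × Z)}
  {ν : Measure Z} {P : Measure Ω} {s t : ℝ≥0} {A B : Set Z}

/-- The compensated number of points `Ñ((s, t] × A)`. -/
def compensated (N : Ω → Measure (ℝ × Z)) (ν : Measure Z) (s t : ℝ≥0) (A : Set Z) (ω : Ω) : ℝ :=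
  (N ω (Ioc (s : ℝ) t ×ˢ A)).toReal - ((t : ℝ) - s) * (ν A).toReal

lemma SimpleIntegrand.integral_eq {Ω : Type*} {N : Ω → Measure (ℝ × Z)}
    {𝓖 : MeasurableSpace Ω} {d : ℕ} (S : SimpleIntegrand Ω 𝓖 ν d) (ω : Ω) :
    S.integral N s t ω = ∑ i, compensated N ν s t (S.set i) ω • S.coef i ω := rfl

/-- The increment of the driving noise over `(s, t]`. -/
def noiseIncrement (W : ℝ≥0 → Ω → EuclideanSpace ℝ (Fin m)) (N : Ω → Measure (ℝ × Z))
    (s t : ℝ≥0) (ω : Ω) : EuclideanSpace ℝ (Fin m) × Measure (ℝ × Z) :=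
  (W t ω - W s ω, (N ω).restrict (Ioc (s : ℝ) t ×ˢ (univ : Set Z)))

lemma measurableSet_strip (hA : MeasurableSet A) (s t : ℝ≥0) :
    MeasurableSet (Ioc (s : ℝ) t ×ˢ A) := measurableSet_Ioc.prod hA

lemma measurable_restrict_measure {S : Type*} [MeasurableSpace S] {D : Set S}
    (hD : MeasurableSet D) : Measurable fun κ : Measure S => κ.restrict D := by
  refine Measure.measurable_of_measurable_coe _ fun C hC => ?_
  simp only [Measure.restrict_apply hC]
  exact Measure.measurable_coe (hC.inter hD)

lemma restrict_strip_apply {Ω : Type*} {N : Ω → Measure (ℝ × Z)} (hA : MeasurableSet A)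
    (ω : Ω) :
    (N ω).restrict (Ioc (s : ℝ) t ×ˢ (univ : Set Z)) (Ioc (s : ℝ) t ×ˢ A)
      = N ω (Ioc (s : ℝ) t ×ˢ A) := by
  rw [Measure.restrict_apply (measurableSet_strip hA s t), prod_inter_prod]
  simp

lemma intensity_strip [SFinite ν] (A : Set Z) (s t : ℝ≥0) :
    ((volume.restrict (Ioi (0 : ℝ))).prod ν) (Ioc (s : ℝ) t ×ˢ A)
      = ENNReal.ofReal ((t : ℝ) - s) * ν A := by
  rw [Measure.prod_prod, Measure.restrict_apply measurableSet_Ioc, inter_eq_left.2,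
    Real.volume_Ioc]
  exact fun x hx => lt_of_le_of_lt s.2 hx.1

lemma toReal_intensity (hst : s ≤ t) (A : Set Z) :
    (((ENNReal.ofReal ((t : ℝ) - s) * ν A).toNNReal : ℝ≥0) : ℝ)
      = ((t : ℝ) - s) * (ν A).toReal := by
  rw [ENNReal.coe_toNNReal_eq_toReal, ENNReal.toReal_mul, ENNReal.toReal_ofReal]
  exact sub_nonneg.2 (NNReal.coe_le_coe.2 hst)

namespace IsDrivingNoise

lemma measurable_poisson (h : IsDrivingNoise F W N ν P) (hA : MeasurableSet A) :
    Measurable (fun ω => N ω (Ioc (s : ℝ) t ×ˢ A)) :=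
  (Measure.measurable_coe (measurableSet_strip hA s t)).comp h.poisson.measurable

lemma measurable_compensated (h : IsDrivingNoise F W N ν P) (hA : MeasurableSet A) :
    Measurable (compensated N ν s t A) :=
  (h.measurable_poisson hA).ennreal_toReal.sub measurable_const

lemma measurable_compensated_filtration (h : IsDrivingNoise F W N ν P)
    (hA : MeasurableSet A) : Measurable[F t] (compensated N ν s t A) := by
  have h1 : Measurable[F t] fun ω => (N ω).restrict (Iic (t : ℝ) ×ˢ (univ : Set Z))
      (Ioc (s : ℝ) t ×ˢ A) :=
    (Measure.measurable_coe (measurableSet_strip hA s t)).comp (h.adapted_poisson t)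
  have h2 : (fun ω => (N ω).restrict (Iic (t : ℝ) ×ˢ (univ : Set Z)) (Ioc (s : ℝ) t ×ˢ A))
      = fun ω => N ω (Ioc (s : ℝ) t ×ˢ A) := by
    ext ω
    rw [Measure.restrict_apply (measurableSet_strip hA s t), prod_inter_prod, inter_univ,
      inter_eq_left.2 Ioc_subset_Iic_self]
  rw [h2] at h1
  exact h1.ennreal_toReal.sub measurable_const

/-- The increment over (s, t] is a measurable function of the whole noise after s: evaluate the
shifted Wiener path at t − s and restrict the random measure further. -/
lemma indep_noiseIncrement (h : IsDrivingNoise F W N ν P) (hst : s ≤ t) :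
    Indep (F s) (MeasurableSpace.comap (noiseIncrement W N s t) inferInstance) P := by
  refine indep_of_indep_of_le_right (h.future_indep s) ?_
  have hm : Measurable fun p : (ℝ≥0 → EuclideanSpace ℝ (Fin m)) × Measure (ℝ × Z) =>
      (p.1 (t - s), p.2.restrict (Ioc (s : ℝ) t ×ˢ (univ : Set Z))) :=
    ((measurable_pi_apply _).comp measurable_fst).prodMk
      ((measurable_restrict_measure (measurableSet_strip .univ s t)).comp measurable_snd)
  have : noiseIncrement W N s t
      = (fun p : (ℝ≥0 → EuclideanSpace ℝ (Fin m)) × Measure (ℝ × Z) =>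
        (p.1 (t - s), p.2.restrict (Ioc (s : ℝ) t ×ˢ (univ : Set Z)))) ∘
        fun ω => ((fun r : ℝ≥0 => W (s + r) ω - W s ω),
          (N ω).restrict (Ioi (s : ℝ) ×ˢ (univ : Set Z))) := by
    ext ω : 1
    simp only [noiseIncrement, Function.comp, add_tsub_cancel_of_le hst]
    rw [Measure.restrict_restrict (measurableSet_strip .univ s t), prod_inter_prod,
      inter_eq_left.2 Ioc_subset_Ioi_self, inter_univ]
  rw [this, ← MeasurableSpace.comap_comp]
  exact MeasurableSpace.comap_mono hm.comap_le

lemma indepFun_wiener_poisson (h : IsDrivingNoise F W N ν P) (s t : ℝ≥0) :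
    IndepFun (fun ω => W t ω - W s ω)
      (fun ω => (N ω).restrict (Ioc (s : ℝ) t ×ˢ (univ : Set Z))) P :=
  h.indep.comp (φ := fun f : ℝ≥0 → EuclideanSpace ℝ (Fin m) => f t - f s)
    ((measurable_pi_apply t).sub (measurable_pi_apply s))
    (measurable_restrict_measure (measurableSet_strip .univ s t))

lemma compensated_eq {Ω : Type*} {N : Ω → Measure (ℝ × Z)} (hA : MeasurableSet A) : compensated N ν s t A =
    (fun κ : Measure (ℝ × Z) => (κ (Ioc (s : ℝ) t ×ˢ A)).toReal - ((t : ℝ) - s) * (ν A).toReal) ∘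
      fun ω => (N ω).restrict (Ioc (s : ℝ) t ×ˢ (univ : Set Z)) := by
  ext ω
  simp only [compensated, Function.comp, restrict_strip_apply hA]

lemma measurable_eval_strip (hA : MeasurableSet A) : Measurable (fun κ : Measure (ℝ × Z) =>
    (κ (Ioc (s : ℝ) t ×ˢ A)).toReal - ((t : ℝ) - s) * (ν A).toReal) :=
  (Measure.measurable_coe (measurableSet_strip hA s t)).ennreal_toReal.sub measurable_const

lemma iIndepFun_strip (h : IsDrivingNoise F W N ν P) {k : ℕ} {A : Fin k → Set Z}
    (hA : ∀ i, MeasurableSet (A i)) (hd : Pairwise fun i j => Disjoint (A i) (A j)) :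
    iIndepFun (fun i ω => N ω (Ioc (s : ℝ) t ×ˢ A i)) P :=
  h.poisson.indep k (fun i => Ioc (s : ℝ) t ×ˢ A i) (fun i => measurableSet_strip (hA i) s t)
    fun _ _ hij => Disjoint.set_prod_right (hd hij) _ _

section Poisson

variable [SFinite ν]

lemma hasLaw_strip (h : IsDrivingNoise F W N ν P) (hA : MeasurableSet A)
    (hν : ν A ≠ ∞) : HasLaw (fun ω => N ω (Ioc (s : ℝ) t ×ˢ A))
      ((poissonMeasure (ENNReal.ofReal ((t : ℝ) - s) * ν A).toNNReal).map
        (fun k : ℕ => (k : ℝ≥0∞))) P := by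
  rw [← intensity_strip A s t]
  refine h.poisson.law _ (measurableSet_strip hA s t) ?_
  rw [intensity_strip A s t]
  exact ENNReal.mul_ne_top ENNReal.ofReal_ne_top hν

lemma integral_compensated_sq (h : IsDrivingNoise F W N ν P) (hst : s ≤ t) (hA : MeasurableSet A)
    (hν : ν A ≠ ∞) : ∫ ω, compensated N ν s t A ω * compensated N ν s t A ω ∂P
      = ((t : ℝ) - s) * (ν A).toReal := by
  have := integral_toReal_sub_sq_of_hasLaw_poisson (h.hasLaw_strip (s := s) (t := t) hA hν)
  rw [toReal_intensity hst] at this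
  rw [← this]
  exact integral_congr_ae (Eventually.of_forall fun ω => (sq _).symm)

/-- Additivity holds only almost surely, on the event where the two partial counts are finite. -/
lemma compensated_ae_eq_add (h : IsDrivingNoise F W N ν P)
    (hA : MeasurableSet A) (hνA : ν A ≠ ∞) (hB : MeasurableSet B) :
    ∀ᵐ ω ∂P, compensated N ν s t A ω
      = compensated N ν s t (A ∩ B) ω + compensated N ν s t (A \ B) ω := by
  have hi : ν (A ∩ B) ≠ ∞ := ne_top_of_le_ne_top hνA (measure_mono inter_subset_left)
  have hd : ν (A \ B) ≠ ∞ := ne_top_of_le_ne_top hνA (measure_mono sdiff_subset)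
  filter_upwards [ae_ne_top_of_hasLaw_poisson (h.hasLaw_strip (hA.inter hB) hi),
    ae_ne_top_of_hasLaw_poisson (h.hasLaw_strip (hA.diff hB) hd)] with ω h1 h2
  have e1 : N ω (Ioc (s : ℝ) t ×ˢ A)
      = N ω (Ioc (s : ℝ) t ×ˢ (A ∩ B)) + N ω (Ioc (s : ℝ) t ×ˢ (A \ B)) := by
    rw [← measure_union (Disjoint.set_prod_right disjoint_sdiff_inter.symm _ _)
      (measurableSet_strip (hA.diff hB) s t), ← prod_union, inter_union_sdiff]
  have e2 : ν A = ν (A ∩ B) + ν (A \ B) := (measure_inter_add_sdiff A hB).symm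
  unfold compensated
  rw [e1, e2, ENNReal.toReal_add h1 h2, ENNReal.toReal_add hi hd]
  ring

variable [IsProbabilityMeasure P]

lemma memLp_compensated (h : IsDrivingNoise F W N ν P) (hA : MeasurableSet A)
    (hν : ν A ≠ ∞) : MemLp (compensated N ν s t A) 2 P :=
  (memLp_toReal_of_hasLaw_poisson (h.hasLaw_strip hA hν)).sub (memLp_const _)

lemma integral_compensated (h : IsDrivingNoise F W N ν P) (hst : s ≤ t) (hA : MeasurableSet A)
    (hν : ν A ≠ ∞) : ∫ ω, compensated N ν s t A ω ∂P = 0 := by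
  have hl := h.hasLaw_strip (s := s) (t := t) hA hν
  unfold compensated
  rw [integral_sub ((memLp_toReal_of_hasLaw_poisson hl).integrable one_le_two)
    (integrable_const _), integral_toReal_of_hasLaw_poisson hl, toReal_intensity hst]
  simp

lemma integral_compensated_mul_of_disjoint (h : IsDrivingNoise F W N ν P) (hst : s ≤ t)
    (hA : MeasurableSet A) (hνA : ν A ≠ ∞) (hB : MeasurableSet B)
    (hd : Disjoint A B) : ∫ ω, compensated N ν s t A ω * compensated N ν s t B ω ∂P = 0 := by
  have hi := h.iIndepFun_strip (s := s) (t := t) (A := ![A, B])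
    (by intro i; fin_cases i <;> simpa)
    (by
      intro i j hij
      fin_cases i <;> fin_cases j <;> simp_all [disjoint_comm])
  have h01 := hi.indepFun (i := 0) (j := 1) (by decide)
  have h02 : IndepFun (compensated N ν s t A) (compensated N ν s t B) P :=
    IndepFun.comp (f := fun ω => N ω (Ioc (s : ℝ) t ×ˢ A)) (g := fun ω => N ω (Ioc (s : ℝ) t ×ˢ B))
      h01 (φ := fun x : ℝ≥0∞ => x.toReal - ((t : ℝ) - s) * (ν A).toReal)
      (ψ := fun x : ℝ≥0∞ => x.toReal - ((t : ℝ) - s) * (ν B).toReal)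
      (ENNReal.measurable_toReal.sub measurable_const)
      (ENNReal.measurable_toReal.sub measurable_const)
  rw [h02.integral_fun_mul_eq_mul_integral (h.measurable_compensated hA).aestronglyMeasurable
    (h.measurable_compensated hB).aestronglyMeasurable, h.integral_compensated hst hA hνA, zero_mul]

/-- Independence is given for disjoint sets only, while the sets of a simple integrand may overlap.
Splitting along A ∩ B leaves the variance of the common part. -/
lemma integral_compensated_mul (h : IsDrivingNoise F W N ν P) (hst : s ≤ t)
    (hA : MeasurableSet A) (hνA : ν A ≠ ∞) (hB : MeasurableSet B) (hνB : ν B ≠ ∞) :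
    ∫ ω, compensated N ν s t A ω * compensated N ν s t B ω ∂P
      = ((t : ℝ) - s) * (ν (A ∩ B)).toReal := by
  have hI : MeasurableSet (A ∩ B) := hA.inter hB
  have hνI : ν (A ∩ B) ≠ ∞ := ne_top_of_le_ne_top hνA (measure_mono inter_subset_left)
  have hνAB : ν (A \ B) ≠ ∞ := ne_top_of_le_ne_top hνA (measure_mono sdiff_subset)
  have hνBA : ν (B \ A) ≠ ∞ := ne_top_of_le_ne_top hνB (measure_mono sdiff_subset)
  have mI := h.memLp_compensated (s := s) (t := t) hI hνI
  have mA := h.memLp_compensated (s := s) (t := t) (hA.diff hB) hνAB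
  have mB := h.memLp_compensated (s := s) (t := t) hB hνB
  have mC := h.memLp_compensated (s := s) (t := t) (hB.diff hA) hνBA
  -- A is split along B, then B along A in the product with the common part: of the three resulting
  -- products two involve disjoint sets and have mean zero.
  calc ∫ ω, compensated N ν s t A ω * compensated N ν s t B ω ∂P
      = ∫ ω, (compensated N ν s t (A ∩ B) ω * compensated N ν s t (A ∩ B) ω
          + compensated N ν s t (A ∩ B) ω * compensated N ν s t (B \ A) ω)
          + compensated N ν s t (A \ B) ω * compensated N ν s t B ω ∂P := by
        refine integral_congr_ae ?_
        filter_upwards [h.compensated_ae_eq_add hA hνA hB,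
          h.compensated_ae_eq_add hB hνB hA] with ω h1 h2
        rw [h1, add_mul, ← mul_add]
        congr 2
        rw [h2, inter_comm]
    _ = ((t : ℝ) - s) * (ν (A ∩ B)).toReal := by
        have iII : Integrable (fun ω => compensated N ν s t (A ∩ B) ω
            * compensated N ν s t (A ∩ B) ω) P :=
          mI.integrable_mul mI
        have iIC : Integrable (fun ω => compensated N ν s t (A ∩ B) ω
            * compensated N ν s t (B \ A) ω) P :=
          mI.integrable_mul mC
        have iAB : Integrable (fun ω => compensated N ν s t (A \ B) ω
            * compensated N ν s t B ω) P :=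
          mA.integrable_mul mB
        have iS : Integrable (fun ω => compensated N ν s t (A ∩ B) ω * compensated N ν s t (A ∩ B) ω
          + compensated N ν s t (A ∩ B) ω * compensated N ν s t (B \ A) ω) P := iII.add iIC
        rw [integral_add iS iAB, integral_add iII iIC, h.integral_compensated_sq hst hI hνI,
          h.integral_compensated_mul_of_disjoint hst hI hνI (hB.diff hA)
            (disjoint_sdiff_self_right.mono_left inter_subset_left),
          h.integral_compensated_mul_of_disjoint hst (hA.diff hB) hνAB hB
            disjoint_sdiff_self_left]
        ring

end Poisson

section Wiener

lemma measurable_wienerIncrement (h : IsDrivingNoise F W N ν P) (i : Fin m) :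
    Measurable (fun ω => (W t ω - W s ω) i) := by
  have hW : ∀ t, Measurable (W t) := fun t => (h.adapted_wiener t).mono (F.le t) le_rfl
  exact ((EuclideanSpace.proj i : EuclideanSpace ℝ (Fin m) →L[ℝ] ℝ).measurable).comp
    ((hW t).sub (hW s))

lemma hasLaw_wienerIncrement (h : IsDrivingNoise F W N ν P) (hst : s ≤ t) (i : Fin m) :
    HasLaw (fun ω => (W t ω - W s ω) i) (gaussianReal 0 (t - s)) P := by
  have := (h.wiener.coord i).toIsPreBrownianReal.hasLaw_sub t s
  have e : nndist t.1 s.1 = t - s := by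
    ext
    rw [coe_nndist, Real.dist_eq, NNReal.coe_sub hst]
    exact abs_of_nonneg (sub_nonneg.2 (NNReal.coe_le_coe.2 hst))
  rw [e] at this
  exact this

lemma memLp_wienerIncrement (h : IsDrivingNoise F W N ν P) (hst : s ≤ t) (i : Fin m) :
    MemLp (fun ω => (W t ω - W s ω) i) 2 P := by
  have hl := h.hasLaw_wienerIncrement hst i
  have h2 : MemLp (id : ℝ → ℝ) 2 (gaussianReal 0 (t - s)) := memLp_id_gaussianReal 2
  rw [← hl.map_eq, memLp_map_measure_iff aestronglyMeasurable_id hl.aemeasurable] at h2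
  exact h2

lemma integral_wienerIncrement (h : IsDrivingNoise F W N ν P) (hst : s ≤ t) (i : Fin m) :
    ∫ ω, (W t ω - W s ω) i ∂P = 0 := by
  rw [(h.hasLaw_wienerIncrement hst i).integral_eq, integral_id_gaussianReal]

lemma iIndepFun_wienerIncrement (h : IsDrivingNoise F W N ν P) (s t : ℝ≥0) :
    iIndepFun (fun (i : Fin m) ω => (W t ω - W s ω) i) P :=
  h.wiener.indep.comp (fun _ f => f t - f s)
    fun _ => (measurable_pi_apply t).sub (measurable_pi_apply s)

lemma integral_wienerIncrement_mul (h : IsDrivingNoise F W N ν P) (hst : s ≤ t) (i j : Fin m) :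
    ∫ ω, (W t ω - W s ω) i * (W t ω - W s ω) j ∂P = if i = j then (t : ℝ) - s else 0 := by
  split_ifs with hij
  · subst hij
    have hl := h.hasLaw_wienerIncrement hst i
    have hm : Measurable fun x : ℝ => x * x := by fun_prop
    have h1 := hl.integral_comp (f := fun x => x * x) hm.aestronglyMeasurable
    simp only [Function.comp_def] at h1
    rw [h1]
    have h2 := variance_id_gaussianReal (μ := 0) (v := t - s)
    rw [variance_eq_integral aemeasurable_id] at h2
    simp only [id, integral_id_gaussianReal, sub_zero] at h2
    rw [← NNReal.coe_sub hst, ← h2]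
    exact integral_congr_ae (Eventually.of_forall fun x => (sq x).symm)
  · have hi := (h.iIndepFun_wienerIncrement s t).indepFun hij
    rw [hi.integral_fun_mul_eq_mul_integral (h.measurable_wienerIncrement i).aestronglyMeasurable
      (h.measurable_wienerIncrement j).aestronglyMeasurable, h.integral_wienerIncrement hst,
      zero_mul]

lemma integral_wienerIncrement_mul_compensated (h : IsDrivingNoise F W N ν P) (hst : s ≤ t) (i : Fin m)
    (hA : MeasurableSet A) :
    ∫ ω, (W t ω - W s ω) i * compensated N ν s t A ω ∂P = 0 := by
  have hi : IndepFun (fun ω => (W t ω - W s ω) i) (compensated N ν s t A) P := by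
    rw [compensated_eq hA]
    exact (h.indepFun_wiener_poisson s t).comp
      (EuclideanSpace.proj i : EuclideanSpace ℝ (Fin m) →L[ℝ] ℝ).measurable
      (measurable_eval_strip hA)
  rw [hi.integral_fun_mul_eq_mul_integral (h.measurable_wienerIncrement i).aestronglyMeasurable
    (h.measurable_compensated hA).aestronglyMeasurable, h.integral_wienerIncrement hst, zero_mul]

end Wiener

end IsDrivingNoise
end Noise

/-! ### The Itô isometry -/

section Isometry

variable {d m : ℕ} {Ω Z : Type*} [mΩ : MeasurableSpace Ω] [MeasurableSpace Z]
  {F : Filtration ℝ≥0 mΩ} {W : ℝ≥0 → Ω → EuclideanSpace ℝ (Fin m)} {N : Ω → Measure (ℝ × Z)}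
  {ν : Measure Z} {P : Measure Ω} {s t : ℝ≥0}

lemma SimpleIntegrand.memLp_uncurry_eval [SFinite ν] [IsFiniteMeasure P]
    (S : SimpleIntegrand Ω (F s) ν d) :
    MemLp (Function.uncurry S.eval) 2 (P.prod ν) :=
  (S.comp (𝓗 := mΩ) id (measurable_id'' (F.le s))).memLp_eval P

lemma SimpleIntegrand.memLp_coef [IsFiniteMeasure P]
    (S : SimpleIntegrand Ω (F s) ν d) (i : Fin S.card) : MemLp (S.coef i) 2 P := by
  obtain ⟨C, hC⟩ := S.bounded_coef
  exact MemLp.of_bound ((S.measurable_coef i).mono (F.le s) le_rfl).aestronglyMeasurable C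
    (Eventually.of_forall fun ω => hC i ω)

/-- The sets may overlap, so the square expands into a full double sum weighted by ν(A_i ∩ A_j).
These weights are the covariances of the compensated counts per unit of time. -/
lemma SimpleIntegrand.integral_norm_sq_eval {Ω : Type*} {𝓖 : MeasurableSpace Ω} (S : SimpleIntegrand Ω 𝓖 ν d)
    (ω : Ω) : ∫ z, ‖S.eval ω z‖ ^ 2 ∂ν
      = ∑ i, ∑ j, (ν (S.set i ∩ S.set j)).toReal * inner ℝ (S.coef i ω) (S.coef j ω) := by
  have e : ∀ z, ‖S.eval ω z‖ ^ 2 = ∑ i, ∑ j, (S.set i ∩ S.set j).indicator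
      (fun _ => inner ℝ (S.coef i ω) (S.coef j ω)) z := by
    intro z
    rw [SimpleIntegrand.eval, ← real_inner_self_eq_norm_sq, sum_inner]
    refine Finset.sum_congr rfl fun i _ => ?_
    rw [inner_sum]
    refine Finset.sum_congr rfl fun j _ => ?_
    by_cases h1 : z ∈ S.set i <;> by_cases h2 : z ∈ S.set j <;> simp [h1, h2]
  have hms : ∀ i j, MeasurableSet (S.set i ∩ S.set j) := fun i j =>
    (S.measurableSet_set i).inter (S.measurableSet_set j)
  have hint : ∀ i j, Integrable ((S.set i ∩ S.set j).indicator
      (fun _ => inner ℝ (S.coef i ω) (S.coef j ω))) ν := fun i j => by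
    refine (integrable_indicator_iff (hms i j)).2 (integrableOn_const ?_)
    exact ne_top_of_le_ne_top (S.measure_set_ne_top i) (measure_mono inter_subset_left)
  simp only [e]
  rw [integral_finsetSum _ fun i _ => integrable_finsetSum _ fun j _ => hint i j]
  refine Finset.sum_congr rfl fun i _ => ?_
  rw [integral_finsetSum _ fun j _ => hint i j]
  refine Finset.sum_congr rfl fun j _ => ?_
  rw [integral_indicator (hms i j), setIntegral_const, smul_eq_mul]
  rfl

lemma SimpleIntegrand.integral_norm_sq_uncurry_eval [SFinite ν] [IsFiniteMeasure P]
    (S : SimpleIntegrand Ω (F s) ν d) :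
    ∫ p, ‖Function.uncurry S.eval p‖ ^ 2 ∂(P.prod ν)
      = ∑ i, ∑ j, (ν (S.set i ∩ S.set j)).toReal * ∫ ω, inner ℝ (S.coef i ω) (S.coef j ω) ∂P := by
  have h1 := S.memLp_uncurry_eval (P := P)
  have h2 := (memLp_two_iff_integrable_sq_norm h1.1).1 h1
  have hint : ∀ i j, Integrable (fun ω => inner ℝ (S.coef i ω) (S.coef j ω)) P := fun i j =>
    ((S.memLp_coef i).norm.integrable_mul (S.memLp_coef j).norm).mono'
      ((S.memLp_coef i).1.inner (S.memLp_coef j).1)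
      (Eventually.of_forall fun ω => norm_inner_le_norm _ _)
  rw [integral_prod _ h2]
  simp only [Function.uncurry_apply_pair, S.integral_norm_sq_eval]
  rw [integral_finsetSum _ fun i _ => integrable_finsetSum _ fun j _ => (hint i j).const_mul _]
  refine Finset.sum_congr rfl fun i _ => ?_
  rw [integral_finsetSum _ fun j _ => (hint i j).const_mul _]
  exact Finset.sum_congr rfl fun j _ => integral_const_mul _ _

/-- The `j`-th column of a matrix. -/
def column (A : Matrix (Fin d) (Fin m) ℝ) (j : Fin m) : EuclideanSpace ℝ (Fin d) :=
  WithLp.toLp 2 fun i => A i j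

lemma toLp_mulVec (A : Matrix (Fin d) (Fin m) ℝ) (w : EuclideanSpace ℝ (Fin m)) :
    WithLp.toLp 2 (A.mulVec (WithLp.ofLp w)) = ∑ j, w j • column A j := by
  ext i
  simp [column, Matrix.mulVec, dotProduct, mul_comm]

lemma norm_column_sq (A : Matrix (Fin d) (Fin m) ℝ) (j : Fin m) :
    ‖column A j‖ ^ 2 = ∑ i, A i j ^ 2 := by
  simp [EuclideanSpace.norm_sq_eq, column]

lemma hsNormSq_eq_sum (A : Matrix (Fin d) (Fin m) ℝ) : hsNormSq A = ∑ j, ‖column A j‖ ^ 2 := by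
  simp only [norm_column_sq, hsNormSq]
  exact Finset.sum_comm

lemma measurable_column {Ω : Type*} {𝓖 : MeasurableSpace Ω} {A : Ω → Matrix (Fin d) (Fin m) ℝ}
    (hA : ∀ i j, Measurable[𝓖] fun ω => A ω i j) (j : Fin m) :
    Measurable[𝓖] fun ω => column (A ω) j :=
  (WithLp.measurable_toLp 2 _).comp (measurable_pi_iff.2 fun i => hA i j)

lemma memLp_column {A : Ω → Matrix (Fin d) (Fin m) ℝ}
    (hA : ∀ i j, MemLp (fun ω => A ω i j) 2 P) (hAm : ∀ i j, Measurable fun ω => A ω i j)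
    (j : Fin m) : MemLp (fun ω => column (A ω) j) 2 P := by
  rw [memLp_two_iff_integrable_sq_norm (measurable_column hAm j).aestronglyMeasurable]
  simp only [norm_column_sq]
  exact integrable_finsetSum _ fun i _ => (hA i j).integrable_sq

variable [SFinite ν] [IsProbabilityMeasure P]

/-- The Itô isometry for simple integrands. -/
theorem IsDrivingNoise.integral_norm_sq_simple (h : IsDrivingNoise F W N ν P) (hst : s ≤ t)
    {V : Ω → EuclideanSpace ℝ (Fin d)} (hVm : Measurable[F s] V) (hV : MemLp V 2 P)
    {A : Ω → Matrix (Fin d) (Fin m) ℝ} (hAm : ∀ i j, Measurable[F s] fun ω => A ω i j)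
    (hA : ∀ i j, MemLp (fun ω => A ω i j) 2 P) (S : SimpleIntegrand Ω (F s) ν d) :
    MemLp (fun ω => V ω + WithLp.toLp 2 ((A ω).mulVec (WithLp.ofLp (W t ω - W s ω)))
      + S.integral N s t ω) 2 P ∧
    ∫ ω, ‖V ω + WithLp.toLp 2 ((A ω).mulVec (WithLp.ofLp (W t ω - W s ω)))
      + S.integral N s t ω‖ ^ 2 ∂P
      = ∫ ω, ‖V ω‖ ^ 2 ∂P + ((t : ℝ) - s) * ∫ ω, hsNormSq (A ω) ∂P
        + ((t : ℝ) - s) * ∫ p, ‖Function.uncurry S.eval p‖ ^ 2 ∂(P.prod ν) := by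
  -- Wiener coordinates and compensated counts form one centred noise vector independent of F s,
  -- with coefficients the columns of A and the values of S. Its covariance c is block diagonal
  -- because W and N are independent.
  let η : Ω → Fin m ⊕ Fin S.card → ℝ := fun ω =>
    Sum.elim (fun j => (W t ω - W s ω) j) fun i => compensated N ν s t (S.set i) ω
  let B : Fin m ⊕ Fin S.card → Ω → EuclideanSpace ℝ (Fin d) :=
    Sum.elim (fun j ω => column (A ω) j) S.coef
  let c : Fin m ⊕ Fin S.card → Fin m ⊕ Fin S.card → ℝ := fun i j =>
    Sum.elim (fun i => Sum.elim (fun j => if i = j then (t : ℝ) - s else 0) (fun _ => 0) j)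
      (fun i => Sum.elim (fun _ => 0)
        (fun j => ((t : ℝ) - s) * (ν (S.set i ∩ S.set j)).toReal) j) i
  have hAm' : ∀ i j, Measurable fun ω => A ω i j := fun i j => (hAm i j).mono (F.le s) le_rfl
  have hcol := memLp_column hA hAm'
  have hcov : ∀ i j, ∫ ω, η ω i * η ω j ∂P = c i j := by
    rintro (i | i) (j | j)
    · exact h.integral_wienerIncrement_mul hst i j
    · exact h.integral_wienerIncrement_mul_compensated hst i (S.measurableSet_set j)
    · simp only [η, c, Sum.elim_inl, Sum.elim_inr]
      rw [← h.integral_wienerIncrement_mul_compensated hst j (S.measurableSet_set i)]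
      simp only [mul_comm]
    · exact h.integral_compensated_mul hst (S.measurableSet_set i) (S.measure_set_ne_top i)
        (S.measurableSet_set j) (S.measure_set_ne_top j)
  have hind : Indep (F s) (MeasurableSpace.comap η inferInstance) P := by
    refine indep_of_indep_of_le_right (h.indep_noiseIncrement hst) ?_
    let g : EuclideanSpace ℝ (Fin m) × Measure (ℝ × Z) → Fin m ⊕ Fin S.card → ℝ := fun p =>
      Sum.elim (fun j => p.1 j) fun i =>
        (p.2 (Ioc (s : ℝ) t ×ˢ S.set i)).toReal - ((t : ℝ) - s) * (ν (S.set i)).toReal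
    have hg : Measurable g := by
      refine measurable_pi_iff.2 ?_
      rintro (j | i)
      · exact (EuclideanSpace.proj j : EuclideanSpace ℝ (Fin m) →L[ℝ] ℝ).measurable.comp
          measurable_fst
      · exact (IsDrivingNoise.measurable_eval_strip (S.measurableSet_set i)).comp measurable_snd
    have : η = g ∘ noiseIncrement W N s t := by
      ext ω (j | i)
      · rfl
      · simp only [η, g, Function.comp, noiseIncrement, Sum.elim_inr, compensated,
          restrict_strip_apply (S.measurableSet_set i)]
    rw [this, ← MeasurableSpace.comap_comp]
    exact MeasurableSpace.comap_mono hg.comap_le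
  have key := integral_norm_sq_add_sum_smul (P := P) (η := η) (c := c) (V := V) (A := B) hind
    (by
      rintro (j | i)
      · exact h.memLp_wienerIncrement hst j
      · exact h.memLp_compensated (S.measurableSet_set i) (S.measure_set_ne_top i))
    (by
      rintro (j | i)
      · exact h.integral_wienerIncrement hst j
      · exact h.integral_compensated hst (S.measurableSet_set i) (S.measure_set_ne_top i))
    hcov hVm hV
    (by
      rintro (j | i)
      · exact measurable_column hAm j
      · exact S.measurable_coef i)
    (by
      rintro (j | i)
      · exact hcol j
      · exact S.memLp_coef i)
  have e : ∀ ω, V ω + ∑ i, η ω i • B i ω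
      = V ω + WithLp.toLp 2 ((A ω).mulVec (WithLp.ofLp (W t ω - W s ω)))
        + S.integral N s t ω := by
    intro ω
    rw [toLp_mulVec, SimpleIntegrand.integral_eq, add_assoc, Fintype.sum_sum_type]
    rfl
  simp only [e] at key
  refine ⟨key.1, key.2.trans ?_⟩
  rw [S.integral_norm_sq_uncurry_eval, add_assoc]
  congr 1
  rw [Fintype.sum_sum_type]
  congr 1
  · simp only [Fintype.sum_sum_type, c, B, Sum.elim_inl, Sum.elim_inr, ite_mul, zero_mul,
      Finset.sum_ite_eq, Finset.mem_univ, if_true, Finset.sum_const_zero, add_zero,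
      real_inner_self_eq_norm_sq, hsNormSq_eq_sum]
    rw [← Finset.mul_sum, integral_finsetSum]
    exact fun j _ => (memLp_two_iff_integrable_sq_norm (hcol j).1).1 (hcol j)
  · simp only [Fintype.sum_sum_type, c, B, Sum.elim_inl, Sum.elim_inr, zero_mul,
      Finset.sum_const_zero, zero_add, Finset.mul_sum, mul_assoc]

/-- Tonelli: the iterated integral in the definition of the Itô integral is the squared norm in L²(P
⊗ ν). -/
lemma IsCompensatedIntegral.tendsto_eval {H : Ω → Z → EuclideanSpace ℝ (Fin d)}
    (hH : Measurable (Function.uncurry H)) {S : ℕ → SimpleIntegrand Ω (F s) ν d} :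
    Tendsto (fun k => ∫⁻ ω, ∫⁻ z, ‖H ω z - (S k).eval ω z‖ₑ ^ 2 ∂ν ∂P) atTop (𝓝 0) ↔
    Tendsto (fun k => eLpNorm (Function.uncurry H - Function.uncurry (S k).eval) 2 (P.prod ν))
      atTop (𝓝 0) := by
  rw [← tendsto_lintegral_sq_iff]
  refine tendsto_congr fun k => ?_
  have hm := ((S k).memLp_uncurry_eval (P := P)).1
  rw [lintegral_prod]
  · rfl
  · exact ((hH.aestronglyMeasurable.sub hm).enorm.pow_const 2)

/-- The Itô isometry: second moment of `V + A (W t - W s) + ∫∫ H dÑ`. -/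
theorem IsDrivingNoise.integral_norm_sq (h : IsDrivingNoise F W N ν P) (hst : s ≤ t)
    {V : Ω → EuclideanSpace ℝ (Fin d)} (hVm : Measurable[F s] V) (hV : MemLp V 2 P)
    {A : Ω → Matrix (Fin d) (Fin m) ℝ} (hAm : ∀ i j, Measurable[F s] fun ω => A ω i j)
    (hA : ∀ i j, MemLp (fun ω => A ω i j) 2 P) {H : Ω → Z → EuclideanSpace ℝ (Fin d)}
    (hH : Measurable (Function.uncurry H)) {I : Ω → EuclideanSpace ℝ (Fin d)}
    (hI : IsCompensatedIntegral F N ν P s t H I) :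
    MemLp (fun ω => V ω + WithLp.toLp 2 ((A ω).mulVec (WithLp.ofLp (W t ω - W s ω)))
      + I ω) 2 P ∧
    ∫ ω, ‖V ω + WithLp.toLp 2 ((A ω).mulVec (WithLp.ofLp (W t ω - W s ω))) + I ω‖ ^ 2 ∂P
      = ∫ ω, ‖V ω‖ ^ 2 ∂P + ((t : ℝ) - s) * ∫ ω, hsNormSq (A ω) ∂P
        + ((t : ℝ) - s) * ∫ p, ‖Function.uncurry H p‖ ^ 2 ∂(P.prod ν) := by
  obtain ⟨hIm, S, h1, h2⟩ := hI
  rw [IsCompensatedIntegral.tendsto_eval hH] at h1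
  have h2' := tendsto_lintegral_sq_iff.1 h2
  have hs := fun k => h.integral_norm_sq_simple hst hVm hV hAm hA (S k)
  have hWm : Measurable fun ω => WithLp.toLp 2
      ((A ω).mulVec (WithLp.ofLp (W t ω - W s ω))) := by
    simp only [toLp_mulVec]
    exact Finset.measurable_sum _ fun j _ => (h.measurable_wienerIncrement j).smul
      (measurable_column (fun i j => (hAm i j).mono (F.le s) le_rfl) j)
  have hGm : AEStronglyMeasurable (fun ω => V ω + WithLp.toLp 2
      ((A ω).mulVec (WithLp.ofLp (W t ω - W s ω))) + I ω) P :=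
    (hV.1.add hWm.aestronglyMeasurable).add hIm.aestronglyMeasurable
  have h3 : Tendsto (fun k => eLpNorm ((fun ω => V ω + WithLp.toLp 2
      ((A ω).mulVec (WithLp.ofLp (W t ω - W s ω))) + I ω) - fun ω => V ω + WithLp.toLp 2
      ((A ω).mulVec (WithLp.ofLp (W t ω - W s ω))) + (S k).integral N s t ω) 2 P)
      atTop (𝓝 0) := by
    refine h2'.congr fun k => ?_
    congr 1
    ext ω : 1
    simp
  refine ⟨memLp_of_tendsto_eLpNorm_sub (fun k => (hs k).1) hGm h3, ?_⟩
  -- Both sides of the identity for the simple integrands S k converge, so the identity passes to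
  -- the limit.
  have l1 := tendsto_integral_norm_sq (fun k => (hs k).1) hGm h3
  simp only [(hs _).2] at l1
  have l2 := tendsto_integral_norm_sq
    (fun k => (S k).memLp_uncurry_eval (P := P)) hH.aestronglyMeasurable h1
  exact tendsto_nhds_unique l1 ((l2.const_mul _).const_add _)

end Isometry

/-! ### Linearity, norm and existence of the compensated integral -/

section CompensatedIntegral

variable {d m : ℕ} {Ω Z : Type*} [mΩ : MeasurableSpace Ω] [MeasurableSpace Z]
  {F : Filtration ℝ≥0 mΩ} {W : ℝ≥0 → Ω → EuclideanSpace ℝ (Fin m)} {N : Ω → Measure (ℝ × Z)}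
  {ν : Measure Z} {P : Measure Ω} {s t : ℝ≥0}
  {H H' : Ω → Z → EuclideanSpace ℝ (Fin d)} {I I' : Ω → EuclideanSpace ℝ (Fin d)}

lemma SimpleIntegrand.measurable_uncurry_eval (S : SimpleIntegrand Ω (F s) ν d) :
    Measurable (Function.uncurry S.eval) :=
  (S.comp (𝓗 := mΩ) id (measurable_id'' (F.le s))).measurable_eval

lemma SimpleIntegrand.measurable_integral_filtration (S : SimpleIntegrand Ω (F s) ν d)
    (h : IsDrivingNoise F W N ν P) (hst : s ≤ t) : Measurable[F t] (S.integral N s t) :=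
  Finset.measurable_sum _ fun i _ =>
    (h.measurable_compensated_filtration (S.measurableSet_set i)).smul
      ((S.measurable_coef i).mono (F.mono hst) le_rfl)

lemma SimpleIntegrand.isCompensatedIntegral (S : SimpleIntegrand Ω (F s) ν d)
    (h : IsDrivingNoise F W N ν P) (hst : s ≤ t) :
    IsCompensatedIntegral F N ν P s t S.eval (S.integral N s t) :=
  ⟨((S.measurable_integral_filtration h hst).mono (F.le t) le_rfl).aemeasurable, fun _ => S,
    by simp, by simp⟩

variable [SFinite ν] [IsProbabilityMeasure P]

namespace IsCompensatedIntegral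

lemma add (hH : Measurable (Function.uncurry H)) (hH' : Measurable (Function.uncurry H'))
    (h : IsDrivingNoise F W N ν P) (hst : s ≤ t)
    (hI : IsCompensatedIntegral F N ν P s t H I) (hI' : IsCompensatedIntegral F N ν P s t H' I') :
    IsCompensatedIntegral F N ν P s t (fun ω z => H ω z + H' ω z) (fun ω => I ω + I' ω) := by
  obtain ⟨hm, S, h1, h2⟩ := hI
  obtain ⟨hm', S', h1', h2'⟩ := hI'
  rw [tendsto_eval hH] at h1
  rw [tendsto_eval hH'] at h1'
  refine ⟨hm.add hm', fun k => (S k).add (S' k),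
    (tendsto_eval (H := fun ω z => H ω z + H' ω z) (hH.add hH')).2 ?_, ?_⟩
  · refine tendsto_of_tendsto_of_tendsto_of_le_of_le tendsto_const_nhds
      (by simpa using h1.add h1') (fun _ => zero_le) fun k => ?_
    refine le_trans (le_of_eq ?_) (eLpNorm_add_le
      (hH.sub (S k).measurable_uncurry_eval).aestronglyMeasurable
      (hH'.sub (S' k).measurable_uncurry_eval).aestronglyMeasurable one_le_two)
    congr 1
    ext p : 1
    simp only [Function.uncurry, Pi.sub_apply, Pi.add_apply, SimpleIntegrand.eval_add]
    abel
  · rw [tendsto_lintegral_sq_iff] at h2 h2' ⊢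
    refine tendsto_of_tendsto_of_tendsto_of_le_of_le tendsto_const_nhds
      (by simpa using h2.add h2') (fun _ => zero_le) fun k => ?_
    have hS : ∀ S : SimpleIntegrand Ω (F s) ν d, AEStronglyMeasurable (S.integral N s t) P :=
      fun S => ((S.measurable_integral_filtration h hst).mono (F.le t) le_rfl).aestronglyMeasurable
    refine le_trans (le_of_eq ?_) (eLpNorm_add_le (hm.aestronglyMeasurable.sub (hS (S k)))
      (hm'.aestronglyMeasurable.sub (hS (S' k))) one_le_two)
    congr 1
    ext ω : 1
    simp only [Pi.add_apply, SimpleIntegrand.integral_add]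
    abel

/-- An F s-measurable factor can be pulled through the integral. The bound 1 covers the two uses:
the constant −1 and indicators of F s-events. -/
lemma smul (hH : Measurable (Function.uncurry H)) (hI : IsCompensatedIntegral F N ν P s t H I)
    {c : Ω → ℝ} (hc : Measurable[F s] c) (hb : ∀ ω, |c ω| ≤ 1) :
    IsCompensatedIntegral F N ν P s t (fun ω z => c ω • H ω z) (fun ω => c ω • I ω) := by
  have hc' : Measurable c := hc.mono (F.le s) le_rfl
  obtain ⟨hm, S, h1, h2⟩ := hI
  rw [tendsto_eval hH] at h1
  have hle : ∀ (ω : Ω) (x : EuclideanSpace ℝ (Fin d)), ‖c ω • x‖ ≤ ‖x‖ := fun ω x => by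
    rw [norm_smul, Real.norm_eq_abs]
    exact mul_le_of_le_one_left (norm_nonneg _) (hb ω)
  refine ⟨hc'.aemeasurable.smul hm, fun k => (S k).mulCoef c hc hb,
    (tendsto_eval (H := fun ω z => c ω • H ω z) ((hc'.comp measurable_fst).smul hH)).2 ?_, ?_⟩
  · refine tendsto_of_tendsto_of_tendsto_of_le_of_le tendsto_const_nhds h1
      (fun _ => zero_le) fun k => eLpNorm_mono fun p => ?_
    simp only [Function.uncurry, Pi.sub_apply, SimpleIntegrand.eval_mulCoef, ← smul_sub]
    exact hle _ _
  · rw [tendsto_lintegral_sq_iff] at h2 ⊢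
    refine tendsto_of_tendsto_of_tendsto_of_le_of_le tendsto_const_nhds h2
      (fun _ => zero_le) fun k => eLpNorm_mono fun ω => ?_
    simp only [SimpleIntegrand.integral_mulCoef, ← smul_sub]
    exact hle _ _

lemma sub (hH : Measurable (Function.uncurry H)) (hH' : Measurable (Function.uncurry H'))
    (h : IsDrivingNoise F W N ν P) (hst : s ≤ t)
    (hI : IsCompensatedIntegral F N ν P s t H I) (hI' : IsCompensatedIntegral F N ν P s t H' I') :
    IsCompensatedIntegral F N ν P s t (fun ω z => H ω z - H' ω z) (fun ω => I ω - I' ω) := by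
  have h1 := hI'.smul hH' (c := fun _ => -1) measurable_const (by simp)
  have h2 := hI.add (H' := fun ω z => (-1 : ℝ) • H' ω z) hH (hH'.const_smul (-1 : ℝ)) h hst h1
  simpa [← sub_eq_add_neg] using h2

lemma sum (h : IsDrivingNoise F W N ν P) (hst : s ≤ t) {ι : Type*} (a : Finset ι)
    {G : ι → Ω → Z → EuclideanSpace ℝ (Fin d)} {J : ι → Ω → EuclideanSpace ℝ (Fin d)}
    (hG : ∀ i, Measurable (Function.uncurry (G i)))
    (hJ : ∀ i, IsCompensatedIntegral F N ν P s t (G i) (J i)) :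
    IsCompensatedIntegral F N ν P s t (fun ω z => ∑ i ∈ a, G i ω z) fun ω => ∑ i ∈ a, J i ω := by
  classical
  induction a using Finset.induction_on with
  | empty =>
    have := (SimpleIntegrand.zero (F s) ν d).isCompensatedIntegral h hst
    exact ⟨aemeasurable_const, by simpa [IsCompensatedIntegral] using this.2⟩
  | insert i a hi ih =>
    simp only [Finset.sum_insert hi]
    refine (hJ i).add (H' := fun ω z => ∑ i ∈ a, G i ω z) (hG i) ?_ h hst ih
    exact Finset.measurable_sum _ fun j _ => hG j

lemma memLp (hH : Measurable (Function.uncurry H))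
    (hI : IsCompensatedIntegral F N ν P s t H I) : MemLp (Function.uncurry H) 2 (P.prod ν) := by
  obtain ⟨-, S, h1, -⟩ := hI
  rw [tendsto_eval hH] at h1
  exact memLp_of_tendsto_eLpNorm_sub (fun k => (S k).memLp_uncurry_eval)
    hH.aestronglyMeasurable h1

lemma memLp_integral (h : IsDrivingNoise F W N ν P) (hst : s ≤ t)
    (hH : Measurable (Function.uncurry H))
    (hI : IsCompensatedIntegral F N ν P s t H I) : MemLp I 2 P := by
  have := (h.integral_norm_sq (V := fun _ => 0) (A := fun _ => 0) hst measurable_const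
    (memLp_const _) (fun _ _ => measurable_const) (fun _ _ => memLp_const _) hH hI).1
  simpa using this

/-- The isometry with V = 0 and A = 0. Combined with linearity it controls differences of integrals
by differences of integrands, whichever versions are chosen. -/
lemma eLpNorm_eq (h : IsDrivingNoise F W N ν P) (hst : s ≤ t)
    (hH : Measurable (Function.uncurry H)) (hI : IsCompensatedIntegral F N ν P s t H I) :
    eLpNorm I 2 P = ENNReal.ofReal (√((t : ℝ) - s)) * eLpNorm (Function.uncurry H) 2 (P.prod ν) := by
  have h1 := (h.integral_norm_sq (V := fun _ => 0) (A := fun _ => 0) hst measurable_const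
    (memLp_const _) (fun _ _ => measurable_const) (fun _ _ => memLp_const _) hH hI).2
  have hm := hI.memLp hH
  have hmI := hI.memLp_integral h hst hH
  have h0 : (0 : ℝ) ≤ t - s := sub_nonneg.2 (NNReal.coe_le_coe.2 hst)
  simp only [Matrix.zero_mulVec, WithLp.toLp_zero, zero_add, norm_zero, hsNormSq,
    Matrix.zero_apply, ne_eq, OfNat.ofNat_ne_zero, not_false_eq_true, zero_pow,
    Finset.sum_const_zero, integral_zero, mul_zero] at h1
  rw [integral_norm_sq_eq hm.1, integral_norm_sq_eq hmI.1] at h1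
  rw [← ENNReal.toReal_eq_toReal_iff' hmI.2.ne (ENNReal.mul_ne_top ENNReal.ofReal_ne_top hm.2.ne),
    ENNReal.toReal_mul, ENNReal.toReal_ofReal (Real.sqrt_nonneg _)]
  rw [← Real.sqrt_sq ENNReal.toReal_nonneg, h1, Real.sqrt_mul h0,
    Real.sqrt_sq ENNReal.toReal_nonneg]

/-- Existence of the compensated integral of `γ (X ω) z` for an `F s`-measurable `X`. -/
theorem exists_of_memLp {ν : Measure Z} [SigmaFinite ν] (h : IsDrivingNoise F W N ν P)
    (hst : s ≤ t) {E : Type*} [MeasurableSpace E] {g : E → Z → EuclideanSpace ℝ (Fin d)}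
    (hg : Measurable (Function.uncurry g)) {X : Ω → E} (hX : Measurable[F s] X)
    (hgX : MemLp (Function.uncurry fun ω z => g (X ω) z) 2 (P.prod ν)) :
    ∃ I, Measurable[F t] I ∧ IsCompensatedIntegral F N ν P s t (fun ω z => g (X ω) z) I := by
  have hX' : Measurable X := hX.mono (F.le s) le_rfl
  -- The function g is approximated in L²(law of X ⊗ ν) and the approximants are composed with X.
  -- Their coefficients are then functions of X, hence F s-measurable.
  have hmp : MeasurePreserving (Prod.map X id) (P.prod ν) ((P.map X).prod ν) :=
    (MeasurePreserving.mk hX' rfl).prod (MeasurePreserving.id ν)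
  have : IsProbabilityMeasure (P.map X) := Measure.isProbabilityMeasure_map hX'.aemeasurable
  have hg2 : MemLp (Function.uncurry g) 2 ((P.map X).prod ν) := by
    rw [← hmp.map_eq, memLp_map_measure_iff hg.aestronglyMeasurable hmp.measurable.aemeasurable]
    exact hgX
  have hap := fun k : ℕ => IsSimpleApproximable.of_memLp hg2 ((k : ℝ≥0∞) + 1)⁻¹ (by simp)
  choose S' hS' using hap
  let S : ℕ → SimpleIntegrand Ω (F s) ν d := fun k => (S' k).comp X hX
  have hle : ∀ k, eLpNorm (Function.uncurry (fun ω z => g (X ω) z) - Function.uncurry (S k).eval) 2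
      (P.prod ν) ≤ ((k : ℝ≥0∞) + 1)⁻¹ := by
    intro k
    refine le_trans (le_of_eq ?_) (hS' k)
    rw [eLpNorm_sub_comm, ← eLpNorm_comp_measurePreserving
      ((S' k).measurable_eval.sub hg).aestronglyMeasurable hmp]
    rfl
  have hlim0 : Tendsto (fun k : ℕ => ((k : ℝ≥0∞) + 1)⁻¹) atTop (𝓝 0) := by
    have := (tendsto_add_atTop_iff_nat 1).2 ENNReal.tendsto_inv_nat_nhds_zero
    simpa using this
  have hlim := tendsto_of_tendsto_of_tendsto_of_le_of_le tendsto_const_nhds hlim0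
    (fun _ => zero_le) hle
  have hgm : Measurable (Function.uncurry fun ω z => g (X ω) z) :=
    hg.comp ((hX'.comp measurable_fst).prodMk measurable_snd)
  have hSI := fun k => (S k).isCompensatedIntegral h hst
  -- Two approximants are compared through g(X); the isometry transfers the Cauchy property to their
  -- integrals.
  have hdiff : ∀ k l, eLpNorm ((S k).integral N s t - (S l).integral N s t) 2 P
      ≤ ENNReal.ofReal (√((t : ℝ) - s)) * (((k : ℝ≥0∞) + 1)⁻¹ + ((l : ℝ≥0∞) + 1)⁻¹) := by
    intro k l
    have hm := (S k).measurable_uncurry_eval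
    have hm' := (S l).measurable_uncurry_eval
    have e := ((hSI k).sub hm hm' h hst (hSI l)).eLpNorm_eq
      (H := fun ω z => (S k).eval ω z - (S l).eval ω z) h hst (hm.sub hm')
    refine e.trans_le (mul_le_mul_right ?_ _)
    refine le_trans (le_of_eq ?_) ((eLpNorm_sub_le (hgm.sub hm').aestronglyMeasurable
      (hgm.sub hm).aestronglyMeasurable one_le_two).trans
      ((add_le_add (hle l) (hle k)).trans_eq (add_comm _ _)))
    congr 1
    ext p : 1
    simp [Function.uncurry]
  obtain ⟨I, hIm, hI⟩ := exists_stronglyMeasurable_tendsto_of_cauchy (μ := P) (F.le t)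
    (f := fun k => (S k).integral N s t)
    (fun k => ((S k).measurable_integral_filtration h hst).stronglyMeasurable)
    (fun k => (hSI k).memLp_integral h hst (S k).measurable_uncurry_eval)
    (by
      intro ε hε
      have h1 : Tendsto (fun k : ℕ => ENNReal.ofReal (√((t : ℝ) - s)) * (2 * ((k : ℝ≥0∞) + 1)⁻¹))
          atTop (𝓝 0) := by
        have := ENNReal.Tendsto.const_mul (a := ENNReal.ofReal (√((t : ℝ) - s)))
          (ENNReal.Tendsto.const_mul (a := 2) hlim0 (Or.inr (by simp)))
          (Or.inr ENNReal.ofReal_ne_top)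
        simpa using this
      obtain ⟨n₀, hn⟩ := (h1.eventually (gt_mem_nhds hε)).exists
      refine ⟨n₀, fun k hk l hl => (hdiff k l).trans_lt (lt_of_le_of_lt ?_ hn)⟩
      rw [two_mul]
      gcongr)
  exact ⟨I, hIm.measurable, (hIm.measurable.mono (F.le t) le_rfl).aemeasurable, S,
    (tendsto_eval hgm).2 hlim, tendsto_lintegral_sq_iff.2 hI⟩

end IsCompensatedIntegral
end CompensatedIntegral

/-! ### Energy estimates for one step of the method -/

section OneStep

variable {d m : ℕ} {Ω Z : Type*} [mΩ : MeasurableSpace Ω] [MeasurableSpace Z]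
  {F : Filtration ℝ≥0 mΩ} {W : ℝ≥0 → Ω → EuclideanSpace ℝ (Fin m)} {N : Ω → Measure (ℝ × Z)}
  {ν : Measure Z} {P : Measure Ω} {s t : ℝ≥0}
  {b : EuclideanSpace ℝ (Fin d) → EuclideanSpace ℝ (Fin d)}
  {σ : EuclideanSpace ℝ (Fin d) → Matrix (Fin d) (Fin m) ℝ}
  {γ : EuclideanSpace ℝ (Fin d) → Z → EuclideanSpace ℝ (Fin d)}
  {L₁ L₂ L₃ θ : ℝ} {τ : ℝ≥0}

/-- The standing assumptions on coefficients, parameter and step size. -/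
structure Admissible (b : EuclideanSpace ℝ (Fin d) → EuclideanSpace ℝ (Fin d))
    (σ : EuclideanSpace ℝ (Fin d) → Matrix (Fin d) (Fin m) ℝ)
    (γ : EuclideanSpace ℝ (Fin d) → Z → EuclideanSpace ℝ (Fin d)) (ν : Measure Z)
    (L₁ L₂ L₃ θ : ℝ) (τ : ℝ≥0) : Prop where
  meas : MeasurableCoeffs b σ γ
  coeffs : CoupledMonotoneCoercive b σ γ ν L₁ L₂ L₃
  half_le : 1 / 2 ≤ θ
  pos : 0 < τ
  small : L₁ * θ * τ ≤ 1 / 2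

/-- The implicit part `x - θ τ b(x)` of the method. -/
def implicitMap (b : EuclideanSpace ℝ (Fin d) → EuclideanSpace ℝ (Fin d)) (θ : ℝ) (τ : ℝ≥0)
    (x : EuclideanSpace ℝ (Fin d)) : EuclideanSpace ℝ (Fin d) :=
  x - (θ * τ) • b x

/-- The explicit part `x + (1 - θ) τ b(x) + σ(x) (W t - W s) + I` of the method. -/
def explicitPart (W : ℝ≥0 → Ω → EuclideanSpace ℝ (Fin m))
    (b : EuclideanSpace ℝ (Fin d) → EuclideanSpace ℝ (Fin d))
    (σ : EuclideanSpace ℝ (Fin d) → Matrix (Fin d) (Fin m) ℝ) (θ : ℝ) (τ s t : ℝ≥0)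
    (X I : Ω → EuclideanSpace ℝ (Fin d)) (ω : Ω) : EuclideanSpace ℝ (Fin d) :=
  X ω + ((1 - θ) * τ) • b (X ω)
    + WithLp.toLp 2 ((σ (X ω)).mulVec (WithLp.ofLp (W t ω - W s ω))) + I ω

lemma hsNormSq_nonneg (A : Matrix (Fin d) (Fin m) ℝ) : 0 ≤ hsNormSq A :=
  Finset.sum_nonneg fun _ _ => Finset.sum_nonneg fun _ _ => sq_nonneg _

lemma sq_le_hsNormSq (A : Matrix (Fin d) (Fin m) ℝ) (i : Fin d) (j : Fin m) :
    A i j ^ 2 ≤ hsNormSq A :=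
  (Finset.single_le_sum (f := fun j => A i j ^ 2) (fun _ _ => sq_nonneg _)
    (Finset.mem_univ j)).trans (Finset.single_le_sum (f := fun i => ∑ j, A i j ^ 2)
      (fun _ _ => Finset.sum_nonneg fun _ _ => sq_nonneg _) (Finset.mem_univ i))

/-- The nonnegative term (θτ)²|v|² of the expanded square is discarded. -/
lemma norm_implicit_sq_ge (x v : EuclideanSpace ℝ (Fin d)) :
    ‖x‖ ^ 2 - θ * τ * (2 * inner ℝ x v) ≤ ‖x - (θ * τ) • v‖ ^ 2 := by
  rw [norm_sub_sq_real, norm_smul, inner_smul_right, mul_pow]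
  nlinarith [mul_nonneg (sq_nonneg ‖θ * (τ : ℝ)‖) (sq_nonneg ‖v‖)]

namespace Admissible

lemma theta_tau_pos (D : Admissible b σ γ ν L₁ L₂ L₃ θ τ) : 0 < θ * τ :=
  mul_pos (by linarith [D.half_le]) (NNReal.coe_pos.2 D.pos)

/-- The right side minus the left side equals (2θ − 1)τ²|v|². This is where θ ≥ 1/2 enters. -/
lemma norm_explicit_sq_le (D : Admissible b σ γ ν L₁ L₂ L₃ θ τ) (x v : EuclideanSpace ℝ (Fin d)) :
    ‖x + ((1 - θ) * τ) • v‖ ^ 2 ≤ ‖x - (θ * τ) • v‖ ^ 2 + 2 * τ * inner ℝ x v := by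
  rw [norm_add_sq_real, norm_sub_sq_real, norm_smul, norm_smul, inner_smul_right,
    inner_smul_right, mul_pow, mul_pow, Real.norm_eq_abs, Real.norm_eq_abs, sq_abs, sq_abs]
  have h1 : 0 ≤ (2 * θ - 1) * ((τ : ℝ) ^ 2 * ‖v‖ ^ 2) :=
    mul_nonneg (by linarith [D.half_le]) (by positivity)
  nlinarith

/-- Coercivity bounds 2⟨x, b(x)⟩ by L₂, all other terms having a favourable sign. It makes square
integrability of T(X) sufficient for that of X. -/
lemma norm_sq_le (D : Admissible b σ γ ν L₁ L₂ L₃ θ τ) (x : EuclideanSpace ℝ (Fin d)) :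
    ‖x‖ ^ 2 ≤ ‖implicitMap b θ τ x‖ ^ 2 + θ * τ * L₂ := by
  have h1 := norm_implicit_sq_ge (θ := θ) (τ := τ) x (b x)
  have h2 := D.coeffs.coercive x
  have h3 : 0 ≤ ∫ z, ‖γ x z‖ ^ 2 ∂ν := integral_nonneg fun _ => by positivity
  have h4 := hsNormSq_nonneg (σ x)
  have h5 : 0 ≤ L₃ * ‖x‖ ^ 2 := mul_nonneg D.coeffs.pos₃.le (by positivity)
  have h6 : θ * τ * (2 * inner ℝ x (b x)) ≤ θ * τ * L₂ :=
    mul_le_mul_of_nonneg_left (by linarith) D.theta_tau_pos.le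
  unfold implicitMap
  linarith

lemma two_inner_le (D : Admissible b σ γ ν L₁ L₂ L₃ θ τ) (x y : EuclideanSpace ℝ (Fin d)) :
    2 * inner ℝ (x - y) (b x - b y) ≤ L₁ * ‖x - y‖ ^ 2 := by
  have h2 := D.coeffs.monotone x y
  have h3 : 0 ≤ ∫ z, ‖γ x z - γ y z‖ ^ 2 ∂ν := integral_nonneg fun _ => by positivity
  linarith [hsNormSq_nonneg (σ x - σ y)]

lemma implicitMap_sub (x y : EuclideanSpace ℝ (Fin d)) :
    implicitMap b θ τ x - implicitMap b θ τ y = (x - y) - (θ * τ) • (b x - b y) := by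
  simp only [implicitMap, smul_sub]
  abel

lemma norm_sub_sq_le (D : Admissible b σ γ ν L₁ L₂ L₃ θ τ) (x y : EuclideanSpace ℝ (Fin d)) :
    (1 - L₁ * θ * τ) * ‖x - y‖ ^ 2 ≤ ‖implicitMap b θ τ x - implicitMap b θ τ y‖ ^ 2 := by
  have h1 := norm_implicit_sq_ge (θ := θ) (τ := τ) (x - y) (b x - b y)
  have h6 : θ * τ * (2 * inner ℝ (x - y) (b x - b y)) ≤ θ * τ * (L₁ * ‖x - y‖ ^ 2) :=
    mul_le_mul_of_nonneg_left (D.two_inner_le x y) D.theta_tau_pos.le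
  rw [implicitMap_sub]
  linarith

/-- The one-sided Lipschitz bound costs at most L₁θτ/2 ≤ 1/4 of the identity, which leaves 3/4. -/
lemma stronglyMonotone (D : Admissible b σ γ ν L₁ L₂ L₃ θ τ) :
    StronglyMonotone (3 / 4) (implicitMap b θ τ) := by
  intro x y
  rw [implicitMap_sub, inner_sub_right, inner_smul_right, real_inner_self_eq_norm_sq]
  have h1 : θ * τ * (2 * inner ℝ (x - y) (b x - b y)) ≤ θ * τ * (L₁ * ‖x - y‖ ^ 2) :=
    mul_le_mul_of_nonneg_left (D.two_inner_le x y) D.theta_tau_pos.le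
  have h2 : L₁ * θ * τ * ‖x - y‖ ^ 2 ≤ 1 / 2 * ‖x - y‖ ^ 2 :=
    mul_le_mul_of_nonneg_right D.small (by positivity)
  linarith

/-- Coercivity replaces any growth assumption on σ and γ: with X and b(X) in L² the right side is
integrable. -/
lemma noise_bound (D : Admissible b σ γ ν L₁ L₂ L₃ θ τ) (x : EuclideanSpace ℝ (Fin d)) :
    hsNormSq (σ x) + ∫ z, ‖γ x z‖ ^ 2 ∂ν ≤ L₂ + 2 * (‖x‖ * ‖b x‖) := by
  have h2 := D.coeffs.coercive x
  have h5 : 0 ≤ L₃ * ‖x‖ ^ 2 := mul_nonneg D.coeffs.pos₃.le (by positivity)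
  have := (abs_le.1 (abs_real_inner_le_norm x (b x))).1
  linarith

section Moments

variable {X Y : Ω → EuclideanSpace ℝ (Fin d)} [IsFiniteMeasure P]

lemma memLp_state (D : Admissible b σ γ ν L₁ L₂ L₃ θ τ) (hX : Measurable X)
    (hTX : MemLp (fun ω => implicitMap b θ τ (X ω)) 2 P) : MemLp X 2 P := by
  rw [memLp_two_iff_integrable_sq_norm hX.aestronglyMeasurable]
  have h1 := (memLp_two_iff_integrable_sq_norm hTX.1).1 hTX
  refine (h1.add (integrable_const (θ * τ * L₂))).mono' (by fun_prop)
    (Eventually.of_forall fun ω => ?_)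
  rw [Real.norm_of_nonneg (by positivity)]
  exact D.norm_sq_le (X ω)

/-- No growth condition on b is needed, since b(x) = (x − T(x))/(θτ). -/
lemma memLp_drift (D : Admissible b σ γ ν L₁ L₂ L₃ θ τ) (hX : Measurable X)
    (hTX : MemLp (fun ω => implicitMap b θ τ (X ω)) 2 P) : MemLp (fun ω => b (X ω)) 2 P := by
  have h1 := ((D.memLp_state hX hTX).sub hTX).const_smul (θ * τ)⁻¹
  convert! h1 using 2 with ω
  simp only [Pi.smul_apply, Pi.sub_apply, implicitMap, sub_sub_cancel,
    inv_smul_smul₀ D.theta_tau_pos.ne']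

lemma integrable_noise_bound (D : Admissible b σ γ ν L₁ L₂ L₃ θ τ) (hX : Measurable X)
    (hTX : MemLp (fun ω => implicitMap b θ τ (X ω)) 2 P) :
    Integrable (fun ω => L₂ + 2 * (‖X ω‖ * ‖b (X ω)‖)) P :=
  (integrable_const _).add
    (((D.memLp_state hX hTX).norm.integrable_mul (D.memLp_drift hX hTX).norm).const_mul 2)

lemma memLp_diffusion (D : Admissible b σ γ ν L₁ L₂ L₃ θ τ) (hX : Measurable X)
    (hTX : MemLp (fun ω => implicitMap b θ τ (X ω)) 2 P) (i : Fin d) (j : Fin m) :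
    MemLp (fun ω => σ (X ω) i j) 2 P := by
  have hm : Measurable fun ω => σ (X ω) i j := (D.meas.diffusion i j).comp hX
  rw [memLp_two_iff_integrable_sq hm.aestronglyMeasurable]
  refine (D.integrable_noise_bound hX hTX).mono' (hm.pow_const 2).aestronglyMeasurable
    (Eventually.of_forall fun ω => ?_)
  rw [Real.norm_of_nonneg (by positivity)]
  have h3 : 0 ≤ ∫ z, ‖γ (X ω) z‖ ^ 2 ∂ν := integral_nonneg fun _ => by positivity
  linarith [D.noise_bound (X ω), sq_le_hsNormSq (σ (X ω)) i j]

lemma measurable_jump (D : Admissible b σ γ ν L₁ L₂ L₃ θ τ) (hX : Measurable X) :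
    Measurable (Function.uncurry fun ω z => γ (X ω) z) :=
  D.meas.jump.comp ((hX.comp measurable_fst).prodMk measurable_snd)

lemma memLp_jump [SFinite ν] (D : Admissible b σ γ ν L₁ L₂ L₃ θ τ) (hX : Measurable X)
    (hTX : MemLp (fun ω => implicitMap b θ τ (X ω)) 2 P) :
    MemLp (Function.uncurry fun ω z => γ (X ω) z) 2 (P.prod ν) := by
  have hm := D.measurable_jump hX
  rw [memLp_two_iff_integrable_sq_norm hm.aestronglyMeasurable]
  have hm2 : AEStronglyMeasurable
      (fun p : Ω × Z => ‖Function.uncurry (fun ω z => γ (X ω) z) p‖ ^ 2) (P.prod ν) :=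
    (hm.norm.pow_const 2).aestronglyMeasurable
  rw [integrable_prod_iff hm2]
  refine ⟨Eventually.of_forall fun ω => D.coeffs.sq_integrable (X ω), ?_⟩
  refine (D.integrable_noise_bound hX hTX).mono' hm2.norm.integral_prod_right'
    (Eventually.of_forall fun ω => ?_)
  simp only [Function.uncurry_apply_pair, norm_pow, norm_norm]
  rw [Real.norm_of_nonneg (integral_nonneg fun _ => by positivity)]
  linarith [D.noise_bound (X ω), hsNormSq_nonneg (σ (X ω))]

end Moments

section Energy

variable {X Y I J : Ω → EuclideanSpace ℝ (Fin d)}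

lemma integrable_hsNormSq {A : Ω → Matrix (Fin d) (Fin m) ℝ}
    (hA : ∀ i j, MemLp (fun ω => A ω i j) 2 P) : Integrable (fun ω => hsNormSq (A ω)) P :=
  integrable_finsetSum _ fun i _ => integrable_finsetSum _ fun j _ => (hA i j).integrable_sq

variable [SFinite ν] [IsProbabilityMeasure P]

/-- By the isometry the second moment is that of the explicit drift part plus the noise terms.
Comparing |X + (1−θ)τ b(X)|² with |T(X)|² leaves 2τ⟨X, b(X)⟩, which coercivity absorbs together with
the noise. -/
lemma memLp_explicitPart (D : Admissible b σ γ ν L₁ L₂ L₃ θ τ) (h : IsDrivingNoise F W N ν P)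
    (ht : t = s + τ) (hX : Measurable[F s] X)
    (hTX : MemLp (fun ω => implicitMap b θ τ (X ω)) 2 P)
    (hI : IsCompensatedIntegral F N ν P s t (fun ω z => γ (X ω) z) I) :
    MemLp (explicitPart W b σ θ τ s t X I) 2 P ∧
    ∫ ω, ‖explicitPart W b σ θ τ s t X I ω‖ ^ 2 ∂P
      ≤ ∫ ω, ‖implicitMap b θ τ (X ω)‖ ^ 2 ∂P + τ * (L₂ - L₃ * ∫ ω, ‖X ω‖ ^ 2 ∂P) := by
  have hX' : Measurable X := hX.mono (F.le s) le_rfl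
  have hst : s ≤ t := ht ▸ le_self_add
  have hτ : (t : ℝ) - s = τ := by rw [ht]; push_cast; ring
  have mX := D.memLp_state hX' hTX
  have mV : MemLp (fun ω => X ω + ((1 - θ) * τ) • b (X ω)) 2 P :=
    mX.add ((D.memLp_drift hX' hTX).const_smul ((1 - θ) * τ : ℝ))
  have mA := D.memLp_diffusion hX' hTX
  have mH := D.memLp_jump hX' hTX
  obtain ⟨h1, h2⟩ := h.integral_norm_sq hst (V := fun ω => X ω + ((1 - θ) * τ) • b (X ω))
    (A := fun ω => σ (X ω)) (hX.add ((D.meas.drift.comp hX).const_smul ((1 - θ) * τ : ℝ))) mV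
    (fun i j => (D.meas.diffusion i j).comp hX) mA (D.measurable_jump hX') hI
  refine ⟨h1, h2.trans_le ?_⟩
  have iV := (memLp_two_iff_integrable_sq_norm mV.1).1 mV
  have iA := integrable_hsNormSq mA
  have iH := (memLp_two_iff_integrable_sq_norm mH.1).1 mH
  have iT := (memLp_two_iff_integrable_sq_norm hTX.1).1 hTX
  have iX := (memLp_two_iff_integrable_sq_norm mX.1).1 mX
  have iH1 := iH.integral_prod_left
  rw [integral_prod _ iH, hτ, ← integral_const_mul, ← integral_const_mul]
  simp only [Function.uncurry_apply_pair] at iH1 ⊢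
  have i1 : Integrable (fun ω => ‖X ω + ((1 - θ) * τ) • b (X ω)‖ ^ 2
    + τ * hsNormSq (σ (X ω))) P := iV.add (iA.const_mul _)
  have i3 : Integrable (fun ω => L₂ - L₃ * ‖X ω‖ ^ 2) P :=
    (integrable_const _).sub (iX.const_mul _)
  rw [← integral_add iV (iA.const_mul _), ← integral_add i1 (iH1.const_mul _)]
  have e : L₂ - L₃ * ∫ ω, ‖X ω‖ ^ 2 ∂P = ∫ ω, (L₂ - L₃ * ‖X ω‖ ^ 2) ∂P := by
    rw [integral_sub (integrable_const _) (iX.const_mul _), integral_const_mul]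
    simp
  rw [e, ← integral_const_mul, ← integral_add iT (i3.const_mul _)]
  refine integral_mono (i1.add (iH1.const_mul _)) (iT.add (i3.const_mul _)) fun ω => ?_
  have e1 := D.norm_explicit_sq_le (X ω) (b (X ω))
  have e2 := mul_le_mul_of_nonneg_left (D.coeffs.coercive (X ω)) τ.2
  simp only [implicitMap]
  simp only [NNReal.val_eq_coe] at e2
  linarith

/-- The same computation for the difference of two states, with monotonicity in place of coercivity.
The resulting L₁τ|X − Y|² is converted back into the energy of T(X) − T(Y). -/
lemma explicitPart_sub (D : Admissible b σ γ ν L₁ L₂ L₃ θ τ) (h : IsDrivingNoise F W N ν P)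
    (ht : t = s + τ) (hX : Measurable[F s] X) (hY : Measurable[F s] Y)
    (hTX : MemLp (fun ω => implicitMap b θ τ (X ω)) 2 P)
    (hTY : MemLp (fun ω => implicitMap b θ τ (Y ω)) 2 P)
    (hI : IsCompensatedIntegral F N ν P s t (fun ω z => γ (X ω) z) I)
    (hJ : IsCompensatedIntegral F N ν P s t (fun ω z => γ (Y ω) z) J) :
    ∫ ω, ‖explicitPart W b σ θ τ s t X I ω - explicitPart W b σ θ τ s t Y J ω‖ ^ 2 ∂P
      ≤ (1 + 2 * L₁ * τ) * ∫ ω, ‖implicitMap b θ τ (X ω) - implicitMap b θ τ (Y ω)‖ ^ 2 ∂P := by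
  have hX' : Measurable X := hX.mono (F.le s) le_rfl
  have hY' : Measurable Y := hY.mono (F.le s) le_rfl
  have hst : s ≤ t := ht ▸ le_self_add
  have hτ : (t : ℝ) - s = τ := by rw [ht]; push_cast; ring
  have mX := (D.memLp_state hX' hTX).sub (D.memLp_state hY' hTY)
  have mV : MemLp (fun ω => (X ω - Y ω) + ((1 - θ) * τ) • (b (X ω) - b (Y ω))) 2 P :=
    mX.add (((D.memLp_drift hX' hTX).sub (D.memLp_drift hY' hTY)).const_smul ((1 - θ) * τ : ℝ))
  have mA : ∀ i j, MemLp (fun ω => (σ (X ω) - σ (Y ω)) i j) 2 P := fun i j =>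
    (D.memLp_diffusion hX' hTX i j).sub (D.memLp_diffusion hY' hTY i j)
  have mH : MemLp (Function.uncurry fun ω z => γ (X ω) z - γ (Y ω) z) 2 (P.prod ν) :=
    (D.memLp_jump hX' hTX).sub (D.memLp_jump hY' hTY)
  have mT : MemLp (fun ω => implicitMap b θ τ (X ω) - implicitMap b θ τ (Y ω)) 2 P := hTX.sub hTY
  have h2 := (h.integral_norm_sq hst
    (V := fun ω => (X ω - Y ω) + ((1 - θ) * τ) • (b (X ω) - b (Y ω)))
    (A := fun ω => σ (X ω) - σ (Y ω))
    ((hX.sub hY).add (((D.meas.drift.comp hX).sub (D.meas.drift.comp hY)).const_smul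
      ((1 - θ) * τ : ℝ))) mV
    (fun i j => ((D.meas.diffusion i j).comp hX).sub ((D.meas.diffusion i j).comp hY)) mA
    (H := fun ω z => γ (X ω) z - γ (Y ω) z)
    ((D.measurable_jump hX').sub (D.measurable_jump hY'))
    (hI.sub (D.measurable_jump hX') (D.measurable_jump hY') h hst hJ)).2
  have e0 : ∀ ω, explicitPart W b σ θ τ s t X I ω - explicitPart W b σ θ τ s t Y J ω
      = (X ω - Y ω) + ((1 - θ) * τ) • (b (X ω) - b (Y ω)) + WithLp.toLp 2
        ((σ (X ω) - σ (Y ω)).mulVec (WithLp.ofLp (W t ω - W s ω))) + (I ω - J ω) := by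
    intro ω
    simp only [explicitPart, Matrix.sub_mulVec, WithLp.toLp_sub, smul_sub]
    abel
  simp only [e0]
  refine h2.trans_le ?_
  have iV := (memLp_two_iff_integrable_sq_norm mV.1).1 mV
  have iA := integrable_hsNormSq mA
  have iH := (memLp_two_iff_integrable_sq_norm mH.1).1 mH
  have iT := (memLp_two_iff_integrable_sq_norm mT.1).1 mT
  have iH1 := iH.integral_prod_left
  rw [integral_prod _ iH, hτ, ← integral_const_mul, ← integral_const_mul]
  simp only [Function.uncurry_apply_pair] at iH1 ⊢
  have i1 : Integrable (fun ω => ‖(X ω - Y ω) + ((1 - θ) * τ) • (b (X ω) - b (Y ω))‖ ^ 2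
    + τ * hsNormSq (σ (X ω) - σ (Y ω))) P := iV.add (iA.const_mul _)
  rw [← integral_add iV (iA.const_mul _), ← integral_add i1 (iH1.const_mul _),
    ← integral_const_mul]
  refine integral_mono (i1.add (iH1.const_mul _)) (iT.const_mul _) fun ω => ?_
  have e1 := D.norm_explicit_sq_le (X ω - Y ω) (b (X ω) - b (Y ω))
  have e2 := mul_le_mul_of_nonneg_left (D.coeffs.monotone (X ω) (Y ω)) τ.2
  have e3 := D.norm_sub_sq_le (X ω) (Y ω)
  -- Since L₁θτ ≤ 1/2, the factor 1 − L₁θτ in `e3` is at least 1/2; this is the origin of the 2 in 1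
  -- + 2L₁τ.
  have e4 : ‖X ω - Y ω‖ ^ 2 ≤ 2 * ‖implicitMap b θ τ (X ω) - implicitMap b θ τ (Y ω)‖ ^ 2 := by
    have := mul_le_mul_of_nonneg_right D.small (sq_nonneg ‖X ω - Y ω‖)
    linarith
  have e5 := mul_le_mul_of_nonneg_left e4 (mul_nonneg τ.2 D.coeffs.pos₁.le)
  simp only [NNReal.val_eq_coe] at e2 e5
  rw [← implicitMap_sub] at e1
  linarith

end Energy
end Admissible
end OneStep

/-! ### Moment bounds, stability and existence of solutions -/

section Solutions

variable {d m : ℕ} {Ω Z : Type*} [mΩ : MeasurableSpace Ω] [MeasurableSpace Z]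
  {F : Filtration ℝ≥0 mΩ} {W : ℝ≥0 → Ω → EuclideanSpace ℝ (Fin m)} {N : Ω → Measure (ℝ × Z)}
  {ν : Measure Z} {P : Measure Ω} {s t : ℝ≥0}
  {b : EuclideanSpace ℝ (Fin d) → EuclideanSpace ℝ (Fin d)}
  {σ : EuclideanSpace ℝ (Fin d) → Matrix (Fin d) (Fin m) ℝ}
  {γ : EuclideanSpace ℝ (Fin d) → Z → EuclideanSpace ℝ (Fin d)}
  {L₁ L₂ L₃ θ : ℝ} {τ : ℝ≥0} {x y : EuclideanSpace ℝ (Fin d)}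
  {X Y : ℕ → Ω → EuclideanSpace ℝ (Fin d)}

lemma succ_mul_eq (j : ℕ) (τ : ℝ≥0) : ((j : ℝ≥0) + 1) * τ = j * τ + τ := by ring

/-- Moving the implicit drift to the left turns the recursion into T(X_{j+1}) = G_j, the form in
which the energy estimates apply. -/
lemma IsSolution.exists_step (hX : IsSolution F W N ν P b σ γ τ θ x X) (j : ℕ) :
    ∃ I, IsCompensatedIntegral F N ν P (j * τ) ((j + 1) * τ) (fun ω z => γ (X j ω) z) I ∧
      (fun ω => implicitMap b θ τ (X (j + 1) ω)) =ᵐ[P]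
        explicitPart W b σ θ τ (j * τ) ((j + 1) * τ) (X j) I := by
  obtain ⟨I, hI, he⟩ := hX.step j
  refine ⟨I, hI, ?_⟩
  filter_upwards [he] with ω hω
  rw [implicitMap, sub_eq_iff_eq_add]
  conv_lhs => rw [hω]
  simp only [explicitPart]
  abel

lemma IsSolution.measurable (hX : IsSolution F W N ν P b σ γ τ θ x X) (j : ℕ) :
    Measurable (X j) :=
  (hX.adapted j).mono (F.le _) le_rfl

lemma IsSolution.implicitMap_zero (hX : IsSolution F W N ν P b σ γ τ θ x X) :
    (fun ω => implicitMap b θ τ (X 0 ω)) =ᵐ[P] fun _ => implicitMap b θ τ x := by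
  filter_upwards [hX.init] with ω hω
  rw [hω]

/-- The inverse of the implicit part. -/
def implicitInv (b : EuclideanSpace ℝ (Fin d) → EuclideanSpace ℝ (Fin d)) (θ : ℝ) (τ : ℝ≥0) :
    EuclideanSpace ℝ (Fin d) → EuclideanSpace ℝ (Fin d) :=
  Function.invFun (implicitMap b θ τ)

lemma Admissible.implicitInv_implicitMap (D : Admissible b σ γ ν L₁ L₂ L₃ θ τ)
    (x : EuclideanSpace ℝ (Fin d)) : implicitInv b θ τ (implicitMap b θ τ x) = x :=
  Function.leftInverse_invFun (D.stronglyMonotone.injective (by norm_num)) x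

lemma continuous_implicitMap (hb : Continuous b) : Continuous (implicitMap b θ τ) :=
  continuous_id.sub (hb.const_smul (θ * τ : ℝ))

lemma Admissible.implicitMap_implicitInv (D : Admissible b σ γ ν L₁ L₂ L₃ θ τ) (hb : Continuous b)
    (y : EuclideanSpace ℝ (Fin d)) : implicitMap b θ τ (implicitInv b θ τ y) = y :=
  Function.rightInverse_invFun
    (D.stronglyMonotone.surjective (by norm_num) (continuous_implicitMap hb)) y

lemma Admissible.continuous_implicitInv (D : Admissible b σ γ ν L₁ L₂ L₃ θ τ)
    (hb : Continuous b) : Continuous (implicitInv b θ τ) := by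
  -- Strong monotonicity with constant 3/4 gives the Lipschitz constant 4/3; any larger one, such as
  -- 2, serves for continuity.
  refine LipschitzWith.continuous (K := 2) (LipschitzWith.of_dist_le_mul fun x y => ?_)
  have := D.stronglyMonotone.mul_norm_sub_le (implicitInv b θ τ x) (implicitInv b θ τ y)
  rw [D.implicitMap_implicitInv hb, D.implicitMap_implicitInv hb] at this
  rw [dist_eq_norm, dist_eq_norm]
  push_cast
  linarith [norm_nonneg (x - y)]

lemma measurable_explicitPart (D : Admissible b σ γ ν L₁ L₂ L₃ θ τ)
    (h : IsDrivingNoise F W N ν P) (hst : s ≤ t) {X I : Ω → EuclideanSpace ℝ (Fin d)}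
    (hX : Measurable[F s] X) (hI : Measurable[F t] I) :
    Measurable[F t] (explicitPart W b σ θ τ s t X I) := by
  have hX' : Measurable[F t] X := hX.mono (F.mono hst) le_rfl
  have hW : Measurable[F t] fun ω => W t ω - W s ω :=
    (h.adapted_wiener t).sub ((h.adapted_wiener s).mono (F.mono hst) le_rfl)
  have hWi : ∀ j, Measurable[F t] fun ω => (W t ω - W s ω) j := fun j =>
    (EuclideanSpace.proj j : EuclideanSpace ℝ (Fin m) →L[ℝ] ℝ).measurable.comp hW
  have e : explicitPart W b σ θ τ s t X I = fun ω => X ω + ((1 - θ) * τ) • b (X ω)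
      + ∑ j, (W t ω - W s ω) j • column (σ (X ω)) j + I ω := by
    ext ω : 1
    rw [explicitPart, toLp_mulVec]
  rw [e]
  exact ((hX'.add ((D.meas.drift.comp hX').const_smul ((1 - θ) * τ : ℝ))).add
    (Finset.measurable_sum _ fun j _ => (hWi j).smul
      (measurable_column (fun i j => (D.meas.diffusion i j).comp hX') j))).add hI

variable [IsProbabilityMeasure P]

namespace IsSolution

variable [SFinite ν]

/-- The initial value is deterministic, and each step preserves square integrability of T(X_n).
Integrability is thus a consequence of the recursion and not part of the notion of solution. -/
lemma memLp_implicitMap (D : Admissible b σ γ ν L₁ L₂ L₃ θ τ) (h : IsDrivingNoise F W N ν P)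
    (hX : IsSolution F W N ν P b σ γ τ θ x X) (n : ℕ) :
    MemLp (fun ω => implicitMap b θ τ (X n ω)) 2 P := by
  induction n with
  | zero => exact (memLp_congr_ae hX.implicitMap_zero).2 (memLp_const _)
  | succ n ih =>
    obtain ⟨I, hI, he⟩ := hX.exists_step n
    exact (memLp_congr_ae he).2
      (D.memLp_explicitPart h (succ_mul_eq n τ) (hX.adapted n) ih hI).1

lemma memLp (D : Admissible b σ γ ν L₁ L₂ L₃ θ τ) (h : IsDrivingNoise F W N ν P)
    (hX : IsSolution F W N ν P b σ γ τ θ x X) (n : ℕ) : MemLp (X n) 2 P :=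
  D.memLp_state (hX.measurable n) (hX.memLp_implicitMap D h n)

lemma energy_succ_le (D : Admissible b σ γ ν L₁ L₂ L₃ θ τ) (h : IsDrivingNoise F W N ν P)
    (hX : IsSolution F W N ν P b σ γ τ θ x X) (n : ℕ) :
    ∫ ω, ‖implicitMap b θ τ (X (n + 1) ω)‖ ^ 2 ∂P
      ≤ ∫ ω, ‖implicitMap b θ τ (X n ω)‖ ^ 2 ∂P + τ * (L₂ - L₃ * ∫ ω, ‖X n ω‖ ^ 2 ∂P) := by
  obtain ⟨I, hI, he⟩ := hX.exists_step n
  refine le_of_eq_of_le (integral_congr_ae ?_) (D.memLp_explicitPart h (succ_mul_eq n τ)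
    (hX.adapted n) (hX.memLp_implicitMap D h n) hI).2
  filter_upwards [he] with ω hω
  rw [hω]

lemma sum_integral_norm_sq_le (D : Admissible b σ γ ν L₁ L₂ L₃ θ τ)
    (h : IsDrivingNoise F W N ν P) (hX : IsSolution F W N ν P b σ γ τ θ x X) (n : ℕ) :
    τ * L₃ * ∑ k ∈ Finset.range n, ∫ ω, ‖X k ω‖ ^ 2 ∂P
      ≤ ‖implicitMap b θ τ x‖ ^ 2 + n * (τ * L₂) := by
  -- The terminal energy stays on the left so that the one-step inequalities telescope; it is
  -- dropped at the end because it is nonnegative.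
  have key : ∀ n : ℕ, ∫ ω, ‖implicitMap b θ τ (X n ω)‖ ^ 2 ∂P
      + τ * L₃ * ∑ k ∈ Finset.range n, ∫ ω, ‖X k ω‖ ^ 2 ∂P
      ≤ ‖implicitMap b θ τ x‖ ^ 2 + n * (τ * L₂) := by
    intro n
    induction n with
    | zero =>
      have : ∫ ω, ‖implicitMap b θ τ (X 0 ω)‖ ^ 2 ∂P = ‖implicitMap b θ τ x‖ ^ 2 := by
        have : ∫ ω, ‖implicitMap b θ τ (X 0 ω)‖ ^ 2 ∂P
            = ∫ _, ‖implicitMap b θ τ x‖ ^ 2 ∂P := by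
          refine integral_congr_ae ?_
          filter_upwards [hX.implicitMap_zero] with ω hω
          rw [hω]
        simpa using this
      simp [this]
    | succ n ih =>
      have := hX.energy_succ_le D h n
      rw [Finset.sum_range_succ]
      push_cast
      linarith
  have h0 : 0 ≤ ∫ ω, ‖implicitMap b θ τ (X n ω)‖ ^ 2 ∂P := integral_nonneg fun _ => by positivity
  linarith [key n]

lemma integral_implicitMap_sub_le (D : Admissible b σ γ ν L₁ L₂ L₃ θ τ)
    (h : IsDrivingNoise F W N ν P) (hX : IsSolution F W N ν P b σ γ τ θ x X)
    (hY : IsSolution F W N ν P b σ γ τ θ y Y) (n : ℕ) :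
    ∫ ω, ‖implicitMap b θ τ (X n ω) - implicitMap b θ τ (Y n ω)‖ ^ 2 ∂P
      ≤ (1 + 2 * L₁ * τ) ^ n * ‖implicitMap b θ τ x - implicitMap b θ τ y‖ ^ 2 := by
  induction n with
  | zero =>
    have : ∫ ω, ‖implicitMap b θ τ (X 0 ω) - implicitMap b θ τ (Y 0 ω)‖ ^ 2 ∂P
        = ∫ _, ‖implicitMap b θ τ x - implicitMap b θ τ y‖ ^ 2 ∂P := by
      refine integral_congr_ae ?_
      filter_upwards [hX.implicitMap_zero, hY.implicitMap_zero] with ω h1 h2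
      rw [h1, h2]
    simp [this]
  | succ n ih =>
    obtain ⟨I, hI, heX⟩ := hX.exists_step n
    obtain ⟨J, hJ, heY⟩ := hY.exists_step n
    have h1 := D.explicitPart_sub h (succ_mul_eq n τ) (hX.adapted n) (hY.adapted n)
      (hX.memLp_implicitMap D h n) (hY.memLp_implicitMap D h n) hI hJ
    have h2 : ∫ ω, ‖implicitMap b θ τ (X (n + 1) ω) - implicitMap b θ τ (Y (n + 1) ω)‖ ^ 2 ∂P
        = ∫ ω, ‖explicitPart W b σ θ τ (n * τ) ((n + 1) * τ) (X n) I ω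
          - explicitPart W b σ θ τ (n * τ) ((n + 1) * τ) (Y n) J ω‖ ^ 2 ∂P := by
      refine integral_congr_ae ?_
      filter_upwards [heX, heY] with ω h1 h2
      rw [h1, h2]
    have h3 : 0 ≤ 1 + 2 * L₁ * τ := by
      have := mul_nonneg D.coeffs.pos₁.le τ.2
      simp only [NNReal.val_eq_coe] at this
      linarith
    rw [h2, pow_succ', mul_assoc]
    exact h1.trans (mul_le_mul_of_nonneg_left ih h3)

/-- Mean square continuity of the method in the initial value. -/
theorem integral_norm_sub_sq_le (D : Admissible b σ γ ν L₁ L₂ L₃ θ τ)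
    (h : IsDrivingNoise F W N ν P) (hX : IsSolution F W N ν P b σ γ τ θ x X)
    (hY : IsSolution F W N ν P b σ γ τ θ y Y) (n : ℕ) :
    Integrable (fun ω => ‖X n ω - Y n ω‖ ^ 2) P ∧
      ∫ ω, ‖X n ω - Y n ω‖ ^ 2 ∂P ≤ Real.exp (2 * L₁ * (n * τ)) / (1 - L₁ * θ * τ)
        * ‖(x - y) - (θ * τ) • (b x - b y)‖ ^ 2 := by
  have hm := (hX.memLp D h n).sub (hY.memLp D h n)
  have hT := (hX.memLp_implicitMap D h n).sub (hY.memLp_implicitMap D h n)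
  have hi : Integrable (fun ω => ‖X n ω - Y n ω‖ ^ 2) P :=
    (memLp_two_iff_integrable_sq_norm hm.1).1 hm
  have hTi : Integrable
      (fun ω => ‖implicitMap b θ τ (X n ω) - implicitMap b θ τ (Y n ω)‖ ^ 2) P :=
    (memLp_two_iff_integrable_sq_norm hT.1).1 hT
  refine ⟨hi, ?_⟩
  have hpos : 0 < 1 - L₁ * θ * τ := by linarith [D.small]
  have h1 : (1 - L₁ * θ * τ) * ∫ ω, ‖X n ω - Y n ω‖ ^ 2 ∂P
      ≤ ∫ ω, ‖implicitMap b θ τ (X n ω) - implicitMap b θ τ (Y n ω)‖ ^ 2 ∂P := by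
    rw [← integral_const_mul]
    exact integral_mono (hi.const_mul _) hTi fun ω => D.norm_sub_sq_le (X n ω) (Y n ω)
  have h2 := hX.integral_implicitMap_sub_le D h hY n
  -- The elementary inequality 1 + u ≤ e^u with u = 2L₁τ, raised to the power n.
  have h3 : (1 + 2 * L₁ * τ) ^ n ≤ Real.exp (2 * L₁ * (n * τ)) := by
    have h0 : 0 ≤ 1 + 2 * L₁ * τ := by
      have := mul_nonneg D.coeffs.pos₁.le τ.2
      simp only [NNReal.val_eq_coe] at this
      linarith
    have h4 := pow_le_pow_left₀ h0 ((add_comm _ _).trans_le (Real.add_one_le_exp (2 * L₁ * τ))) n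
    rw [← Real.exp_nat_mul] at h4
    refine h4.trans_eq ?_
    ring_nf
  rw [← Admissible.implicitMap_sub, div_mul_eq_mul_div, le_div_iff₀ hpos, mul_comm]
  exact h1.trans (h2.trans (mul_le_mul_of_nonneg_right h3 (by positivity)))

end IsSolution

section Existence

variable [SigmaFinite ν]

/-- Existence of solutions of the method. -/
theorem Admissible.exists_isSolution (D : Admissible b σ γ ν L₁ L₂ L₃ θ τ)
    (h : IsDrivingNoise F W N ν P) (hb : Continuous b) (x : EuclideanSpace ℝ (Fin d)) :
    ∃ X, IsSolution F W N ν P b σ γ τ θ x X := by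
  -- The recursion runs over states carrying adaptedness and square integrability of T(Y): the first
  -- makes the next stochastic integral adapted, the second makes it exist. The implicit equation is
  -- solved by the continuous inverse of T.
  have hnext : ∀ (n : ℕ) (Y : {Y : Ω → EuclideanSpace ℝ (Fin d) // Measurable[F (n * τ)] Y ∧
      MemLp (fun ω => implicitMap b θ τ (Y ω)) 2 P}),
      ∃ Y' : {Y : Ω → EuclideanSpace ℝ (Fin d) // Measurable[F ((n + 1 : ℕ) * τ)] Y ∧
        MemLp (fun ω => implicitMap b θ τ (Y ω)) 2 P},
      ∃ I, IsCompensatedIntegral F N ν P (n * τ) ((n + 1) * τ) (fun ω z => γ (Y.1 ω) z) I ∧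
        ∀ ω, implicitMap b θ τ (Y'.1 ω)
          = explicitPart W b σ θ τ (n * τ) ((n + 1) * τ) Y.1 I ω := by
    rintro n ⟨Y, hYm, hY⟩
    have hst : (n * τ : ℝ≥0) ≤ (n + 1) * τ := by
      rw [succ_mul_eq]
      exact le_self_add
    obtain ⟨I, hIm, hI⟩ := IsCompensatedIntegral.exists_of_memLp h hst D.meas.jump hYm
      (D.memLp_jump (hYm.mono (F.le _) le_rfl) hY)
    have e : ((n + 1 : ℕ) : ℝ≥0) * τ = (n + 1) * τ := by push_cast; rfl
    refine ⟨⟨fun ω => implicitInv b θ τ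
      (explicitPart W b σ θ τ (n * τ) ((n + 1) * τ) Y I ω), ?_, ?_⟩, I, hI, fun ω => ?_⟩
    · rw [e]
      exact (D.continuous_implicitInv hb).measurable.comp
        (measurable_explicitPart D h hst hYm hIm)
    · simp only [D.implicitMap_implicitInv hb]
      exact (D.memLp_explicitPart h (succ_mul_eq n τ) hYm hY hI).1
    · exact D.implicitMap_implicitInv hb _
  choose next hn using hnext
  let X : ∀ n : ℕ, {Y : Ω → EuclideanSpace ℝ (Fin d) // Measurable[F (n * τ)] Y ∧
      MemLp (fun ω => implicitMap b θ τ (Y ω)) 2 P} := fun n =>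
    Nat.rec ⟨fun _ => x, measurable_const, memLp_const _⟩ next n
  refine ⟨fun n => (X n).1, Eventually.of_forall fun _ => rfl, fun n => (X n).2.1, fun n => ?_⟩
  obtain ⟨I, hI, he⟩ := hn n (X n)
  refine ⟨I, hI, Eventually.of_forall fun ω => ?_⟩
  have h1 : implicitMap b θ τ ((X (n + 1)).1 ω)
      = explicitPart W b σ θ τ (n * τ) ((n + 1) * τ) (X n).1 I ω := he ω
  rw [implicitMap, sub_eq_iff_eq_add] at h1
  conv_lhs => rw [h1]
  simp only [explicitPart]
  abel

end Existence
end Solutions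

/-! ### Stationarity and independence of the step from a deterministic state -/

section Laws

variable {d m : ℕ} {Ω Z : Type*} [mΩ : MeasurableSpace Ω] [MeasurableSpace Z]
  {F : Filtration ℝ≥0 mΩ} {W : ℝ≥0 → Ω → EuclideanSpace ℝ (Fin m)} {N : Ω → Measure (ℝ × Z)}
  {ν : Measure Z} {P : Measure Ω} {s t τ : ℝ≥0}

open Classical in
/-- A square integrable simple function on `Z`, as a deterministic simple integrand. -/
def SimpleIntegrand.ofSimpleFunc (𝓖 : MeasurableSpace Ω)
    (f : SimpleFunc Z (EuclideanSpace ℝ (Fin d))) (hf : MemLp f 2 ν) :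
    SimpleIntegrand Ω 𝓖 ν d where
  -- The value 0 is left out because its fibre may have infinite ν-measure.
  card := (f.range.filter (· ≠ 0)).card
  coef i _ := ((f.range.filter (· ≠ 0)).equivFin.symm i).1
  set i := f ⁻¹' {((f.range.filter (· ≠ 0)).equivFin.symm i).1}
  measurable_coef _ := measurable_const
  bounded_coef := (finite_range fun i =>
      ‖((f.range.filter (· ≠ 0)).equivFin.symm i).1‖).bddAbove.imp
    fun _ hC i _ => hC (mem_range_self i)
  measurableSet_set _ := f.measurableSet_fiber _
  measure_set_ne_top i := (f.measure_preimage_lt_top_of_memLp two_ne_zero ENNReal.ofNat_ne_top hf _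
    (Finset.mem_filter.1 ((f.range.filter (· ≠ 0)).equivFin.symm i).2).2).ne

lemma SimpleIntegrand.eval_ofSimpleFunc {Ω : Type*} (𝓖 : MeasurableSpace Ω)
    (f : SimpleFunc Z (EuclideanSpace ℝ (Fin d))) (hf : MemLp f 2 ν) (ω : Ω) (z : Z) :
    (ofSimpleFunc 𝓖 f hf).eval ω z = f z := by
  classical
  have h1 := (f.range.filter (· ≠ 0)).equivFin.symm.sum_comp
    fun c => (f ⁻¹' {c.1}).indicator (fun _ => c.1) z
  refine h1.trans ?_
  rw [Finset.sum_coe_sort (f.range.filter (· ≠ 0)) fun c => (f ⁻¹' {c}).indicator (fun _ => c) z,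
    Finset.sum_filter, Finset.sum_eq_single_of_mem (f z) (f.mem_range_self z)]
  · by_cases h0 : f z = 0 <;> simp [h0]
  · intro c _ hc
    have hz : z ∉ f ⁻¹' {c} := fun h => hc (mem_singleton_iff.1 h).symm
    rw [indicator_of_notMem hz, ite_self]

/-- Level sets of distinct values. Disjointness makes the Poisson counts independent, so that their
joint law is determined by the marginals. -/
lemma SimpleIntegrand.disjoint_set_ofSimpleFunc {Ω : Type*} (𝓖 : MeasurableSpace Ω)
    (f : SimpleFunc Z (EuclideanSpace ℝ (Fin d))) (hf : MemLp f 2 ν) :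
    Pairwise fun i j => Disjoint ((ofSimpleFunc 𝓖 f hf).set i) ((ofSimpleFunc 𝓖 f hf).set j) := by
  intro i j hij
  refine Disjoint.preimage _ (disjoint_singleton.2 fun h => hij ?_)
  exact (Equiv.injective _) (Subtype.ext h)

/-- The joint law of the increments of the Wiener process and of the numbers of points in
disjoint sets over a time interval of length `τ`. -/
def incrementLaw (m : ℕ) (ν : Measure Z) (τ : ℝ≥0) {k : ℕ} (A : Fin k → Set Z) :
    Measure ((Fin m → ℝ) × (Fin k → ℝ≥0∞)) :=
  (Measure.pi fun _ => gaussianReal 0 τ).prod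
    (Measure.pi fun i => (poissonMeasure (ENNReal.ofReal τ * ν (A i)).toNNReal).map
      fun n : ℕ => (n : ℝ≥0∞))

/-- Coordinates are independent within each of the two families and the families are independent of
each other, so the joint law is a product. It depends on (s, t] only through the length τ. -/
lemma IsDrivingNoise.hasLaw_increment [SFinite ν] [IsProbabilityMeasure P]
    (h : IsDrivingNoise F W N ν P) (ht : t = s + τ) {k : ℕ}
    {A : Fin k → Set Z} (hA : ∀ i, MeasurableSet (A i))
    (hd : Pairwise fun i j => Disjoint (A i) (A j)) (hν : ∀ i, ν (A i) ≠ ∞) :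
    HasLaw (fun ω => ((fun j => (W t ω - W s ω) j), fun i => N ω (Ioc (s : ℝ) t ×ˢ A i)))
      (incrementLaw m ν τ A) P := by
  have hst : s ≤ t := ht ▸ le_self_add
  have h1 := (h.iIndepFun_wienerIncrement s t).hasLaw_pi fun j => h.hasLaw_wienerIncrement hst j
  have h2 := (h.iIndepFun_strip (s := s) (t := t) hA hd).hasLaw_pi
    fun i => h.hasLaw_strip (hA i) (hν i)
  have e1 : t - s = τ := by rw [ht, add_tsub_cancel_left]
  have e2 : (t : ℝ) - s = τ := by rw [ht]; push_cast; ring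
  rw [e1] at h1
  rw [e2] at h2
  refine IndepFun.hasLaw_prod h1 h2 ?_
  have := (h.indepFun_wiener_poisson s t).comp
    (φ := fun w : EuclideanSpace ℝ (Fin m) => fun j => w j)
    (ψ := fun κ : Measure (ℝ × Z) => fun i => κ (Ioc (s : ℝ) t ×ˢ A i))
    (WithLp.measurable_ofLp 2 _)
    (measurable_pi_iff.2 fun i => Measure.measurable_coe (measurableSet_strip (hA i) s t))
  simpa only [Function.comp_def, restrict_strip_apply (hA _)] using! this

lemma IsDrivingNoise.indep_increment (h : IsDrivingNoise F W N ν P) (hst : s ≤ t) {k : ℕ}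
    {A : Fin k → Set Z} (hA : ∀ i, MeasurableSet (A i)) :
    Indep (F s) (MeasurableSpace.comap (fun ω => ((fun j => (W t ω - W s ω) j),
      fun i => N ω (Ioc (s : ℝ) t ×ˢ A i))) inferInstance) P := by
  refine indep_of_indep_of_le_right (h.indep_noiseIncrement hst) ?_
  have hm : Measurable fun p : EuclideanSpace ℝ (Fin m) × Measure (ℝ × Z) =>
      ((fun j => p.1 j), fun i => p.2 (Ioc (s : ℝ) t ×ˢ A i)) :=
    ((WithLp.measurable_ofLp 2 _).comp measurable_fst).prodMk (measurable_pi_iff.2 fun i =>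
      (Measure.measurable_coe (measurableSet_strip (hA i) s t)).comp measurable_snd)
  have e : (fun ω => ((fun j => (W t ω - W s ω) j), fun i => N ω (Ioc (s : ℝ) t ×ˢ A i)))
      = (fun p : EuclideanSpace ℝ (Fin m) × Measure (ℝ × Z) =>
        ((fun j => p.1 j), fun i => p.2 (Ioc (s : ℝ) t ×ˢ A i))) ∘ noiseIncrement W N s t := by
    ext ω : 1
    simp only [Function.comp, noiseIncrement, restrict_strip_apply (hA _)]
  rw [e, ← MeasurableSpace.comap_comp]
  exact MeasurableSpace.comap_mono hm.comap_le

variable [SFinite ν] [IsProbabilityMeasure P]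

lemma IsDrivingNoise.setIntegral_ofSimpleFunc (h : IsDrivingNoise F W N ν P) (ht : t = s + τ)
    (f : SimpleFunc Z (EuclideanSpace ℝ (Fin d))) (hf : MemLp f 2 ν)
    (a : EuclideanSpace ℝ (Fin d)) (B : Matrix (Fin d) (Fin m) ℝ)
    (φ : EuclideanSpace ℝ (Fin d) →ᵇ ℝ) {Λ : Set Ω} (hΛ : MeasurableSet[F s] Λ) :
    ∫ ω in Λ, φ (a + WithLp.toLp 2 (B.mulVec (WithLp.ofLp (W t ω - W s ω)))
        + (SimpleIntegrand.ofSimpleFunc (F s) f hf).integral N s t ω) ∂P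
      = P.real Λ * ∫ ω, φ (a + WithLp.toLp 2 (B.mulVec (WithLp.ofLp (W τ ω - W 0 ω)))
        + (SimpleIntegrand.ofSimpleFunc (F 0) f hf).integral N 0 τ ω) ∂P := by
  classical
  have hA := (SimpleIntegrand.ofSimpleFunc (F s) f hf).measurableSet_set
  have hν := (SimpleIntegrand.ofSimpleFunc (F s) f hf).measure_set_ne_top
  have hd := SimpleIntegrand.disjoint_set_ofSimpleFunc (F s) f hf
  -- The map Φ does not involve s and t separately. The step over (s, t] and the step over (0, τ]
  -- are the same function of noise vectors with the same law.
  let Φ : (Fin m → ℝ) × (Fin (f.range.filter (· ≠ 0)).card → ℝ≥0∞) →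
      EuclideanSpace ℝ (Fin d) := fun p => a + ∑ j, p.1 j • column B j
    + ∑ i, ((p.2 i).toReal - τ * (ν (f ⁻¹' {((f.range.filter (· ≠ 0)).equivFin.symm i).1})).toReal)
      • ((f.range.filter (· ≠ 0)).equivFin.symm i).1
  have hΦ : Measurable Φ := by
    refine (measurable_const.add (Finset.measurable_sum _ fun j _ => ?_)).add
      (Finset.measurable_sum _ fun i _ => ?_)
    · exact ((measurable_pi_apply j).comp measurable_fst).smul_const _
    · exact ((((measurable_pi_apply i).comp measurable_snd).ennreal_toReal).sub
        measurable_const).smul_const _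
  have hφ : AEStronglyMeasurable (fun p => φ (Φ p)) (incrementLaw m ν τ
      (SimpleIntegrand.ofSimpleFunc (F s) f hf).set) :=
    (φ.continuous.measurable.comp hΦ).aestronglyMeasurable
  have e : ∀ {s t : ℝ≥0} (_ : t = s + τ) (ω : Ω),
      a + WithLp.toLp 2 (B.mulVec (WithLp.ofLp (W t ω - W s ω)))
        + (SimpleIntegrand.ofSimpleFunc (F s) f hf).integral N s t ω
      = Φ ((fun j => (W t ω - W s ω) j), fun i => N ω (Ioc (s : ℝ) t ×ˢ
        (SimpleIntegrand.ofSimpleFunc (F s) f hf).set i)) := by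
    intro s t ht ω
    have e2 : (t : ℝ) - s = τ := by rw [ht]; push_cast; ring
    rw [toLp_mulVec, SimpleIntegrand.integral_eq]
    simp only [compensated, e2]
    rfl
  have h1 := h.hasLaw_increment ht hA hd hν
  have h0 := h.hasLaw_increment (zero_add τ).symm hA hd hν
  simp only [e ht, e (zero_add τ).symm]
  -- Independence of F s factors out P(Λ); equality of the two increment laws then identifies the
  -- remaining expectations.
  rw [(h.indep_increment (ht ▸ le_self_add) hA).setIntegral_eq_mul (F.le s) h1.aemeasurable hΛ
    (f := fun p => φ (Φ p)) (φ.continuous.measurable.comp hΦ).aestronglyMeasurable]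
  congr 1
  exact (h1.integral_comp hφ).trans (h0.integral_comp hφ).symm

/-- The one-step increments from a deterministic state are independent of the past and
stationary. -/
theorem IsCompensatedIntegral.setIntegral_const (h : IsDrivingNoise F W N ν P) (ht : t = s + τ)
    {g : Z → EuclideanSpace ℝ (Fin d)} (hg : Measurable g) (hg2 : MemLp g 2 ν)
    {I I₀ : Ω → EuclideanSpace ℝ (Fin d)}
    (hI : IsCompensatedIntegral F N ν P s t (fun _ z => g z) I)
    (hI₀ : IsCompensatedIntegral F N ν P 0 τ (fun _ z => g z) I₀)
    (a : EuclideanSpace ℝ (Fin d)) (B : Matrix (Fin d) (Fin m) ℝ)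
    (φ : EuclideanSpace ℝ (Fin d) →ᵇ ℝ) {Λ : Set Ω} (hΛ : MeasurableSet[F s] Λ) :
    ∫ ω in Λ, φ (a + WithLp.toLp 2 (B.mulVec (WithLp.ofLp (W t ω - W s ω))) + I ω) ∂P
      = P.real Λ * ∫ ω, φ (a + WithLp.toLp 2 (B.mulVec (WithLp.ofLp (W τ ω - W 0 ω)))
        + I₀ ω) ∂P := by
  have hap := fun k : ℕ => hg2.exists_simpleFunc_eLpNorm_sub_lt ENNReal.ofNat_ne_top
    (ε := ((k : ℝ≥0∞) + 1)⁻¹) (by simp)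
  choose f hf hf2 using hap
  have hlim0 : Tendsto (fun k : ℕ => ((k : ℝ≥0∞) + 1)⁻¹) atTop (𝓝 0) := by
    have := (tendsto_add_atTop_iff_nat 1).2 ENNReal.tendsto_inv_nat_nhds_zero
    simpa using this
  have hf0 := tendsto_of_tendsto_of_tendsto_of_le_of_le tendsto_const_nhds hlim0
    (fun _ => zero_le) fun k => (hf k).le
  -- The same simple functions f k approximate both integrals, over (s, t] and over (0, τ], so the
  -- identity for simple functions passes to the limit on both sides.
  have key : ∀ {s t : ℝ≥0} {I : Ω → EuclideanSpace ℝ (Fin d)} (_ : s ≤ t)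
      (_ : IsCompensatedIntegral F N ν P s t (fun _ z => g z) I) (Λ : Set Ω),
      Tendsto (fun k => ∫ ω in Λ, φ (a + WithLp.toLp 2 (B.mulVec (WithLp.ofLp (W t ω - W s ω)))
        + (SimpleIntegrand.ofSimpleFunc (F s) (f k) (hf2 k)).integral N s t ω) ∂P) atTop
      (𝓝 (∫ ω in Λ, φ (a + WithLp.toLp 2 (B.mulVec (WithLp.ofLp (W t ω - W s ω)))
        + I ω) ∂P)) := by
    intro s t I hst hI Λ
    have hV : Measurable fun ω => a + WithLp.toLp 2 (B.mulVec (WithLp.ofLp (W t ω - W s ω))) := by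
      simp only [toLp_mulVec]
      exact measurable_const.add (Finset.measurable_sum _ fun j _ =>
        (h.measurable_wienerIncrement j).smul_const _)
    refine tendsto_setIntegral_boundedContinuous (fun k => (hV.add
      (((SimpleIntegrand.ofSimpleFunc (F s) (f k) (hf2 k)).measurable_integral_filtration h
        hst).mono (F.le t) le_rfl)).aemeasurable) (hV.aemeasurable.add hI.1) ?_ φ Λ
    have e : ∀ k, eLpNorm (fun ω =>
        I ω - (SimpleIntegrand.ofSimpleFunc (F s) (f k) (hf2 k)).integral N s t ω) 2 P
        = ENNReal.ofReal (√((t : ℝ) - s)) * eLpNorm (g - ⇑(f k)) 2 ν := by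
      intro k
      have h1 := (SimpleIntegrand.ofSimpleFunc (F s) (f k) (hf2 k)).isCompensatedIntegral h hst
      have hm := (SimpleIntegrand.ofSimpleFunc (F s) (f k) (hf2 k)).measurable_uncurry_eval
      have hgm : Measurable (Function.uncurry fun (_ : Ω) z => g z) := hg.comp measurable_snd
      rw [(hI.sub hgm hm h hst h1).eLpNorm_eq
        (H := fun ω z => g z - (SimpleIntegrand.ofSimpleFunc (F s) (f k) (hf2 k)).eval ω z)
        h hst (hgm.sub hm)]
      congr 1
      rw [← eLpNorm_comp_measurePreserving (hg.sub (f k).measurable).aestronglyMeasurable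
        (measurePreserving_snd (μ := P) (ν := ν))]
      congr 1
      ext p : 1
      simp [Function.uncurry, SimpleIntegrand.eval_ofSimpleFunc]
    have h2 := ENNReal.Tendsto.const_mul (a := ENNReal.ofReal (√((t : ℝ) - s))) hf0
      (Or.inr ENNReal.ofReal_ne_top)
    rw [mul_zero] at h2
    refine h2.congr fun k => (e k).symm.trans ?_
    congr 1
    ext ω : 1
    simp
  refine tendsto_nhds_unique (key (ht ▸ le_self_add) hI Λ) ?_
  have h3 := (key zero_le hI₀ univ).const_mul (P.real Λ)
  simp only [setIntegral_univ] at h3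
  exact h3.congr fun k => (h.setIntegral_ofSimpleFunc ht (f k) (hf2 k) a B φ hΛ).symm

end Laws

/-! ### Weak continuity, measurability and finitely valued states -/

section Kernels

/-- A family of probability measures that is continuous for the weak topology is measurable. -/
lemma measurable_of_continuous_probabilityMeasure {E : Type*} [TopologicalSpace E]
    [MeasurableSpace E] [BorelSpace E] [HasOuterApproxClosed E] {μ : E → ProbabilityMeasure E}
    (hμ : Continuous μ) : Measurable fun x => (μ x : Measure E) := by
  refine Measurable.measure_of_isPiSystem_of_isProbabilityMeasure
    ((BorelSpace.measurable_eq (α := E)).trans borel_eq_generateFrom_isClosed)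
    isPiSystem_isClosed fun C hC => ?_
  -- Closed sets form a generating π-system, and the mass of a closed set is a limit of integrals of
  -- bounded continuous functions, each continuous in x.
  refine measurable_of_tendsto_metrizable
    (f := fun n x => ∫⁻ y, (IsClosed.apprSeq hC n y : ℝ≥0∞) ∂(μ x)) (fun n => ?_)
    (tendsto_pi_nhds.2 fun x => HasOuterApproxClosed.tendsto_lintegral_apprSeq hC (μ x : Measure E))
  have h1 := (FiniteMeasure.continuous_testAgainstNN_eval (IsClosed.apprSeq hC n)).comp
    (ProbabilityMeasure.toFiniteMeasure_continuous.comp hμ)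
  have h2 := (ENNReal.continuous_coe.comp h1).measurable
  simpa only [Function.comp_def, FiniteMeasure.testAgainstNN_coe_eq] using! h2

/-- The action of a kernel on bounded continuous functions. -/
def integralKernel {E : Type*} [TopologicalSpace E] [MeasurableSpace E]
    (κ : Kernel E E) [IsMarkovKernel κ]
    (hκ : ∀ φ : E →ᵇ ℝ, Continuous fun x => ∫ y, φ y ∂(κ x)) (φ : E →ᵇ ℝ) : E →ᵇ ℝ :=
  BoundedContinuousFunction.ofNormedAddCommGroup (fun x => ∫ y, φ y ∂(κ x)) (hκ φ) ‖φ‖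
    fun x => by
      simpa using norm_integral_le_of_norm_le_const (μ := κ x)
        (Eventually.of_forall fun y => φ.norm_coe_le_norm y)

lemma tendsto_eLpNorm_of_integral_norm_sq {α F : Type*} [MeasurableSpace α] {μ : Measure α}
    [NormedAddCommGroup F] {f : ℕ → α → F} (hf : ∀ k, MemLp (f k) 2 μ)
    (h : Tendsto (fun k => ∫ a, ‖f k a‖ ^ 2 ∂μ) atTop (𝓝 0)) :
    Tendsto (fun k => eLpNorm (f k) 2 μ) atTop (𝓝 0) := by
  have h1 := ENNReal.tendsto_ofReal (Real.continuous_sqrt.continuousAt.tendsto.comp h)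
  simp only [Real.sqrt_zero, ENNReal.ofReal_zero] at h1
  refine h1.congr fun k => ?_
  simp only [Function.comp_apply]
  rw [integral_norm_sq_eq (hf k).1, Real.sqrt_sq ENNReal.toReal_nonneg,
    ENNReal.ofReal_toReal (hf k).2.ne]

/-- On each fibre of q the first argument is frozen; this transfers statements about deterministic
states to finitely valued random ones. -/
lemma integral_simpleFunc_eq_sum {Ω E : Type*} [MeasurableSpace Ω] {P : Measure Ω}
    (q : SimpleFunc Ω E) {f : E → Ω → ℝ} (hf : ∀ v, Integrable (f v) P) :
    ∫ ω, f (q ω) ω ∂P = ∑ v ∈ q.range, ∫ ω in q ⁻¹' {v}, f v ω ∂P := by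
  simp only [← integral_indicator (q.measurableSet_fiber _)]
  rw [← integral_finsetSum _ fun v _ => (hf v).indicator (q.measurableSet_fiber v)]
  refine integral_congr_ae (Eventually.of_forall fun ω => ?_)
  simp only
  rw [Finset.sum_eq_single_of_mem (q ω) (q.mem_range_self ω)]
  · simp
  · intro v _ hv
    have hω : ω ∉ q ⁻¹' {v} := fun h => hv (mem_singleton_iff.1 h).symm
    exact indicator_of_notMem hω _

end Kernels

/-! ### The one-step transition kernel and the Markov property -/

section Transition

variable {d m : ℕ} {Ω Z : Type*} [mΩ : MeasurableSpace Ω] [MeasurableSpace Z]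
  {F : Filtration ℝ≥0 mΩ} {W : ℝ≥0 → Ω → EuclideanSpace ℝ (Fin m)} {N : Ω → Measure (ℝ × Z)}
  {ν : Measure Z} {P : Measure Ω} {s t : ℝ≥0}
  {b : EuclideanSpace ℝ (Fin d) → EuclideanSpace ℝ (Fin d)}
  {σ : EuclideanSpace ℝ (Fin d) → Matrix (Fin d) (Fin m) ℝ}
  {γ : EuclideanSpace ℝ (Fin d) → Z → EuclideanSpace ℝ (Fin d)}
  {L₁ L₂ L₃ θ : ℝ} {τ : ℝ≥0} {x : EuclideanSpace ℝ (Fin d)}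
  {κ : Kernel (EuclideanSpace ℝ (Fin d)) (EuclideanSpace ℝ (Fin d))}

/-- `κ v` is the law of one step of the method from the state `v`, at any time and conditionally
on the past. -/
structure IsTransitionKernel (F : Filtration ℝ≥0 mΩ) (W : ℝ≥0 → Ω → EuclideanSpace ℝ (Fin m))
    (N : Ω → Measure (ℝ × Z)) (ν : Measure Z) (P : Measure Ω)
    (b : EuclideanSpace ℝ (Fin d) → EuclideanSpace ℝ (Fin d))
    (σ : EuclideanSpace ℝ (Fin d) → Matrix (Fin d) (Fin m) ℝ)
    (γ : EuclideanSpace ℝ (Fin d) → Z → EuclideanSpace ℝ (Fin d)) (θ : ℝ) (τ : ℝ≥0)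
    (κ : Kernel (EuclideanSpace ℝ (Fin d)) (EuclideanSpace ℝ (Fin d))) : Prop where
  isMarkov : IsMarkovKernel κ
  continuous_integral : ∀ φ : EuclideanSpace ℝ (Fin d) →ᵇ ℝ, Continuous fun x => ∫ y, φ y ∂(κ x)
  setIntegral : ∀ (v : EuclideanSpace ℝ (Fin d)) (s : ℝ≥0) (I : Ω → EuclideanSpace ℝ (Fin d)),
    IsCompensatedIntegral F N ν P s (s + τ) (fun _ z => γ v z) I →
    ∀ (φ : EuclideanSpace ℝ (Fin d) →ᵇ ℝ) (Λ : Set Ω), MeasurableSet[F s] Λ →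
    ∫ ω in Λ, φ (implicitInv b θ τ (explicitPart W b σ θ τ s (s + τ) (fun _ => v) I ω)) ∂P
      = P.real Λ * ∫ y, φ y ∂(κ v)

variable [IsProbabilityMeasure P] [SigmaFinite ν]

/-- The one-step stability estimate, expressed in the L² norm. Convergence of states is measured
through T, as in that estimate. -/
lemma Admissible.tendsto_eLpNorm_explicitPart (D : Admissible b σ γ ν L₁ L₂ L₃ θ τ)
    (h : IsDrivingNoise F W N ν P) (ht : t = s + τ)
    {X I : Ω → EuclideanSpace ℝ (Fin d)} {Y J : ℕ → Ω → EuclideanSpace ℝ (Fin d)}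
    (hX : Measurable[F s] X) (hY : ∀ k, Measurable[F s] (Y k))
    (hTX : MemLp (fun ω => implicitMap b θ τ (X ω)) 2 P)
    (hTY : ∀ k, MemLp (fun ω => implicitMap b θ τ (Y k ω)) 2 P)
    (hI : IsCompensatedIntegral F N ν P s t (fun ω z => γ (X ω) z) I)
    (hJ : ∀ k, IsCompensatedIntegral F N ν P s t (fun ω z => γ (Y k ω) z) (J k))
    (hlim : Tendsto (fun k => ∫ ω, ‖implicitMap b θ τ (X ω) - implicitMap b θ τ (Y k ω)‖ ^ 2 ∂P)
      atTop (𝓝 0)) :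
    Tendsto (fun k => eLpNorm (explicitPart W b σ θ τ s t X I
      - explicitPart W b σ θ τ s t (Y k) (J k)) 2 P) atTop (𝓝 0) := by
  refine tendsto_eLpNorm_of_integral_norm_sq (fun k => (D.memLp_explicitPart h ht hX hTX hI).1.sub
    (D.memLp_explicitPart h ht (hY k) (hTY k) (hJ k)).1) ?_
  refine squeeze_zero (fun k => integral_nonneg fun _ => by positivity) (fun k =>
    D.explicitPart_sub h ht hX (hY k) hTX (hTY k) hI (hJ k)) ?_
  simpa using hlim.const_mul (1 + 2 * L₁ * τ)

/-- Bounded continuous functions of the state after one step. -/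
def Admissible.compInv (D : Admissible b σ γ ν L₁ L₂ L₃ θ τ) (hb : Continuous b)
    (φ : EuclideanSpace ℝ (Fin d) →ᵇ ℝ) : EuclideanSpace ℝ (Fin d) →ᵇ ℝ :=
  φ.compContinuous ⟨implicitInv b θ τ, D.continuous_implicitInv hb⟩

/-- The kernel is the law of T⁻¹(G) for the first step from v. The stability estimate and continuity
of T make it weakly continuous in v, hence measurable; stationarity and independence of increments
extend it to every starting time and every version of the integral. -/
theorem Admissible.exists_isTransitionKernel (D : Admissible b σ γ ν L₁ L₂ L₃ θ τ)
    (h : IsDrivingNoise F W N ν P) (hb : Continuous b) :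
    ∃ κ, IsTransitionKernel F W N ν P b σ γ θ τ κ := by
  have hT : ∀ v, MemLp (fun _ : Ω => implicitMap b θ τ v) 2 P := fun v => memLp_const _
  have hI : ∀ v, ∃ I, Measurable[F τ] I ∧
      IsCompensatedIntegral F N ν P 0 τ (fun _ z => γ v z) I := fun v =>
    IsCompensatedIntegral.exists_of_memLp h zero_le D.meas.jump (X := fun _ => v)
      measurable_const (D.memLp_jump measurable_const (hT v))
  choose I hIm hI using hI
  have hGm : ∀ v, Measurable (explicitPart W b σ θ τ 0 τ (fun _ => v) (I v)) := fun v =>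
    (measurable_explicitPart D h zero_le measurable_const (hIm v)).mono (F.le τ) le_rfl
  have hRm : Measurable (implicitInv b θ τ) := (D.continuous_implicitInv hb).measurable
  let μ : EuclideanSpace ℝ (Fin d) → ProbabilityMeasure (EuclideanSpace ℝ (Fin d)) := fun v =>
    ⟨P.map fun ω => implicitInv b θ τ (explicitPart W b σ θ τ 0 τ (fun _ => v) (I v) ω),
      Measure.isProbabilityMeasure_map (hRm.comp (hGm v)).aemeasurable⟩
  have hμ : ∀ v (φ : EuclideanSpace ℝ (Fin d) →ᵇ ℝ), ∫ y, φ y ∂(μ v : Measure _)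
      = ∫ ω, D.compInv hb φ (explicitPart W b σ θ τ 0 τ (fun _ => v) (I v) ω) ∂P := fun v φ =>
    integral_map (hRm.comp (hGm v)).aemeasurable φ.continuous.aestronglyMeasurable
  have hc : Continuous μ := by
    refine continuous_iff_seqContinuous.2 fun u v hu => ?_
    refine ProbabilityMeasure.tendsto_iff_forall_integral_tendsto.2 fun φ => ?_
    simp only [Function.comp_apply, hμ]
    have h1 := D.tendsto_eLpNorm_explicitPart h (zero_add τ).symm (X := fun _ => v)
      (Y := fun k _ => u k) measurable_const (fun _ => measurable_const) (hT v) (fun k => hT (u k))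
      (hI v) (fun k => hI (u k)) ?_
    · simpa only [setIntegral_univ] using tendsto_setIntegral_boundedContinuous
        (fun k => (hGm (u k)).aemeasurable) (hGm v).aemeasurable h1 (D.compInv hb φ) univ
    · have h2 : Continuous fun w => ‖implicitMap b θ τ v - implicitMap b θ τ w‖ ^ 2 :=
        (continuous_const.sub (continuous_implicitMap hb)).norm.pow 2
      have h3 := (h2.tendsto v).comp hu
      simpa [Function.comp_def] using h3
  let κ : Kernel (EuclideanSpace ℝ (Fin d)) (EuclideanSpace ℝ (Fin d)) :=
    ⟨fun v => (μ v : Measure _), measurable_of_continuous_probabilityMeasure hc⟩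
  refine ⟨κ, ⟨fun v => (μ v).2⟩, fun φ => ?_, fun v s J hJ φ Λ hΛ => ?_⟩
  · refine continuous_iff_continuousAt.2 fun v => ?_
    exact ProbabilityMeasure.tendsto_iff_forall_integral_tendsto.1 (hc.tendsto v) φ
  · have hg : Measurable (γ v) := D.meas.jump.comp measurable_prodMk_left
    have hg2 : MemLp (γ v) 2 ν :=
      (memLp_two_iff_integrable_sq_norm hg.aestronglyMeasurable).2 (D.coeffs.sq_integrable v)
    have h1 := IsCompensatedIntegral.setIntegral_const h rfl hg hg2 hJ (hI v)
      (v + ((1 - θ) * τ) • b v) (σ v) (D.compInv hb φ) hΛ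
    exact h1.trans (congrArg _ (hμ v φ).symm)

/-- One step of the method is Markovian with the transition kernel `κ`. -/
theorem IsTransitionKernel.integral_explicitPart (hκ : IsTransitionKernel F W N ν P b σ γ θ τ κ)
    (D : Admissible b σ γ ν L₁ L₂ L₃ θ τ) (h : IsDrivingNoise F W N ν P) (hb : Continuous b)
    {X I : Ω → EuclideanSpace ℝ (Fin d)} (hX : Measurable[F s] X)
    (hTX : MemLp (fun ω => implicitMap b θ τ (X ω)) 2 P)
    (hI : IsCompensatedIntegral F N ν P s (s + τ) (fun ω z => γ (X ω) z) I)
    (φ : EuclideanSpace ℝ (Fin d) →ᵇ ℝ) :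
    ∫ ω, φ (implicitInv b θ τ (explicitPart W b σ θ τ s (s + τ) X I ω)) ∂P
      = ∫ ω, ∫ y, φ y ∂(κ (X ω)) ∂P := by
  have := hκ.isMarkov
  have hst : s ≤ s + τ := le_self_add
  have hX' : Measurable X := hX.mono (F.le s) le_rfl
  have hTm : Measurable (implicitMap b θ τ) := (continuous_implicitMap hb).measurable
  have hRm : Measurable (implicitInv b θ τ) := (D.continuous_implicitInv hb).measurable
  have hY : Measurable fun ω => implicitMap b θ τ (X ω) := hTm.comp hX'
  have hJ : ∀ v, ∃ J, Measurable[F (s + τ)] J ∧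
      IsCompensatedIntegral F N ν P s (s + τ) (fun _ z => γ v z) J := fun v =>
    IsCompensatedIntegral.exists_of_memLp h hst D.meas.jump (X := fun _ => v)
      measurable_const (D.memLp_jump measurable_const (memLp_const _))
  choose J hJm hJ using hJ
  -- The approximation is made on T(X) rather than on X, because the stability estimate requires T(ξ
  -- k) → T(X) in L². The approximants of X are then ξ k = T⁻¹(y k (T(X))).
  let y : ℕ → SimpleFunc (EuclideanSpace ℝ (Fin d)) (EuclideanSpace ℝ (Fin d)) :=
    SimpleFunc.approxOn id measurable_id univ 0 (mem_univ 0)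
  have hy : ∀ a, Tendsto (fun k => y k a) atTop (𝓝 a) := fun a =>
    SimpleFunc.tendsto_approxOn measurable_id (mem_univ 0) (by simp)
  have hy2 : Tendsto (fun k => ∫ ω, ‖implicitMap b θ τ (X ω) - y k (implicitMap b θ τ (X ω))‖ ^ 2 ∂P)
      atTop (𝓝 0) := by
    have hle : ∀ k a, ‖a - y k a‖ ≤ ‖a‖ := fun k a => by
      have := SimpleFunc.nnnorm_approxOn_le measurable_id (mem_univ (0 : EuclideanSpace ℝ (Fin d)))
        a k
      rw [sub_zero] at this
      rw [norm_sub_rev]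
      exact this
    have h1 := tendsto_integral_of_dominated_convergence
      (F := fun k ω => ‖implicitMap b θ τ (X ω) - y k (implicitMap b θ τ (X ω))‖ ^ 2)
      (f := fun _ => (0 : ℝ)) (fun ω => ‖implicitMap b θ τ (X ω)‖ ^ 2)
      (fun k => ((hY.sub ((y k).measurable.comp hY)).norm.pow_const 2).aestronglyMeasurable)
      ((memLp_two_iff_integrable_sq_norm hTX.1).1 hTX)
      (fun k => Eventually.of_forall fun ω => ?_) (Eventually.of_forall fun ω => ?_)
    · simpa using h1
    · rw [norm_pow, norm_norm]
      exact pow_le_pow_left₀ (norm_nonneg _) (hle k _) 2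
    · have h2 := ((hy (implicitMap b θ τ (X ω))).const_sub (implicitMap b θ τ (X ω))).norm.pow 2
      simpa using h2
  let q : ℕ → SimpleFunc (EuclideanSpace ℝ (Fin d)) (EuclideanSpace ℝ (Fin d)) := fun k =>
    ((y k).comp (implicitMap b θ τ) hTm).map (implicitInv b θ τ)
  let ξ : ℕ → SimpleFunc Ω (EuclideanSpace ℝ (Fin d)) := fun k => (q k).comp X hX'
  have hξT : ∀ k ω, implicitMap b θ τ (ξ k ω) = y k (implicitMap b θ τ (X ω)) := fun k ω =>
    D.implicitMap_implicitInv hb _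
  have hξ : ∀ ω, Tendsto (fun k => ξ k ω) atTop (𝓝 (X ω)) := by
    intro ω
    have h1 := ((D.continuous_implicitInv hb).tendsto _).comp (hy (implicitMap b θ τ (X ω)))
    rwa [D.implicitInv_implicitMap] at h1
  have hξm : ∀ k, Measurable[F s] (ξ k) := fun k => (q k).measurable.comp hX
  have hξ2 : ∀ k, MemLp (fun ω => implicitMap b θ τ (ξ k ω)) 2 P := fun k =>
    ((ξ k).map (implicitMap b θ τ)).memLp_of_isFiniteMeasure 2 P
  let c : ℕ → EuclideanSpace ℝ (Fin d) → Ω → ℝ := fun k v => (ξ k ⁻¹' {v}).indicator fun _ => 1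
  have hcm : ∀ k v, Measurable[F s] (c k v) := fun k v =>
    (measurable_const : Measurable[F s] fun _ : Ω => (1 : ℝ)).indicator
      (hξm k (measurableSet_singleton v))
  have hsum : ∀ k ω (f : EuclideanSpace ℝ (Fin d) → EuclideanSpace ℝ (Fin d)),
      ∑ v ∈ (ξ k).range, c k v ω • f v = f (ξ k ω) := by
    intro k ω f
    rw [Finset.sum_eq_single_of_mem (ξ k ω) ((ξ k).mem_range_self ω)]
    · simp [c]
    · intro v _ hv
      have : ω ∉ ξ k ⁻¹' {v} := fun h => hv (mem_singleton_iff.1 h).symm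
      simp only [c, indicator_of_notMem this, zero_smul]
  -- For a finitely valued state the integral is glued from those of the deterministic states v,
  -- each multiplied by the indicator of the F s-event {ξ k = v}.
  have hIk : ∀ k, IsCompensatedIntegral F N ν P s (s + τ) (fun ω z => γ (ξ k ω) z)
      fun ω => J (ξ k ω) ω := by
    intro k
    have hγ : ∀ v, Measurable (Function.uncurry fun (_ : Ω) z => γ v z) := fun v =>
      D.measurable_jump measurable_const
    have h1 := IsCompensatedIntegral.sum h hst (ξ k).range
      (G := fun v ω z => c k v ω • γ v z) (J := fun v ω => c k v ω • J v ω)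
      (fun v => (((hcm k v).mono (F.le s) le_rfl).comp measurable_fst).smul (hγ v))
      (fun v => (hJ v).smul (hγ v) (hcm k v) fun ω => ?_)
    · simpa only [fun ω z => hsum k ω fun v => γ v z, fun ω => hsum k ω fun v => J v ω] using h1
    · by_cases hω : ω ∈ ξ k ⁻¹' {v}
      · simp only [c, indicator_of_mem hω, abs_one, le_refl]
      · simp only [c, indicator_of_notMem hω, abs_zero, zero_le_one]
  have hmeas : ∀ v, Measurable fun ω => D.compInv hb φ
      (explicitPart W b σ θ τ s (s + τ) (fun _ => v) (J v) ω) := fun v =>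
    (D.compInv hb φ).continuous.measurable.comp
      ((measurable_explicitPart D h hst measurable_const (hJm v)).mono (F.le _) le_rfl)
  have hstep : ∀ k, ∫ ω, D.compInv hb φ (explicitPart W b σ θ τ s (s + τ) (ξ k)
      (fun ω => J (ξ k ω) ω) ω) ∂P = ∫ ω, ∫ y, φ y ∂(κ (ξ k ω)) ∂P := by
    intro k
    have h1 := integral_simpleFunc_eq_sum (P := P) (ξ k) (f := fun v ω => D.compInv hb φ
      (explicitPart W b σ θ τ s (s + τ) (fun _ => v) (J v) ω)) fun v =>
      (integrable_const ‖D.compInv hb φ‖).mono' (hmeas v).aestronglyMeasurable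
        (Eventually.of_forall fun ω => (D.compInv hb φ).norm_coe_le_norm _)
    have h2 := integral_simpleFunc_eq_sum (P := P) (ξ k) (f := fun v _ => ∫ y, φ y ∂(κ v))
      fun v => integrable_const _
    refine h1.trans ((Finset.sum_congr rfl fun v _ => ?_).trans h2.symm)
    rw [setIntegral_const, smul_eq_mul]
    exact hκ.setIntegral v s (J v) (hJ v) φ _ (hξm k (measurableSet_singleton v))
  have hl := tendsto_setIntegral_boundedContinuous
    (fun k => (D.memLp_explicitPart h rfl (hξm k) (hξ2 k) (hIk k)).1.1.aemeasurable)
    (D.memLp_explicitPart h rfl hX hTX hI).1.1.aemeasurable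
    (D.tendsto_eLpNorm_explicitPart h rfl hX hξm hTX hξ2 hI hIk (by simpa only [hξT] using hy2))
    (D.compInv hb φ) univ
  -- The left sides converge by stability. The right sides converge because the kernel is weakly
  -- continuous and ξ k → X pointwise.
  simp only [setIntegral_univ, hstep] at hl
  refine tendsto_nhds_unique hl (tendsto_integral_of_dominated_convergence (fun _ => ‖φ‖)
    (fun k => ?_) (integrable_const _) (fun k => Eventually.of_forall fun ω => ?_)
    (Eventually.of_forall fun ω => ((hκ.continuous_integral φ).tendsto _).comp (hξ ω)))
  · exact ((hκ.continuous_integral φ).measurable.comp (ξ k).measurable).aestronglyMeasurable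
  · exact (integralKernel κ hκ.continuous_integral φ).norm_coe_le_norm (ξ k ω) |>.trans
      (BoundedContinuousFunction.norm_ofNormedAddCommGroup_le (hκ.continuous_integral φ)
        (norm_nonneg φ) _)

end Transition

/-! ### Krylov–Bogoliubov -/

section Invariant

variable {E : Type*} [MeasurableSpace E]

lemma integral_bind_kernel [TopologicalSpace E] [OpensMeasurableSpace E] {μ : Measure E}
    [IsProbabilityMeasure μ] (κ : Kernel E E) [IsMarkovKernel κ] (φ : E →ᵇ ℝ) :
    ∫ y, φ y ∂(μ.bind κ) = ∫ x, ∫ y, φ y ∂(κ x) ∂μ := by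
  have h := Kernel.integral_comp (κ := Kernel.const Unit μ) (η := κ) (a := ()) (f := φ)
    (φ.integrable _)
  rwa [Kernel.comp_const, Kernel.const_apply, Kernel.const_apply] at h

lemma isMarkovKernel_pow (κ : Kernel E E) [IsMarkovKernel κ] (n : ℕ) : IsMarkovKernel (κ ^ n) := by
  induction n with
  | zero => exact inferInstanceAs (IsMarkovKernel Kernel.id)
  | succ n ih => rw [pow_succ]; exact inferInstanceAs (IsMarkovKernel ((κ ^ n) ∘ₖ κ))

lemma pow_succ_apply_eq_bind (κ : Kernel E E) (n : ℕ) (x : E) :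
    (κ ^ (n + 1)) x = ((κ ^ n) x).bind κ := by
  rw [pow_succ']
  exact Kernel.comp_apply κ (κ ^ n) x

lemma invariant_pow {κ : Kernel E E} {π : Measure E} (h : Kernel.Invariant κ π) (n : ℕ) :
    Kernel.Invariant (κ ^ n) π := by
  induction n with
  | zero => exact Measure.id_comp
  | succ n ih => rw [pow_succ]; exact ih.comp h

/-- The averages `(n + 1)⁻¹ ∑_{k ≤ n} μ k`. -/
def average (μ : ℕ → Measure E) (n : ℕ) : Measure E :=
  ((n : ℝ≥0∞) + 1)⁻¹ • ∑ k ∈ Finset.range (n + 1), μ k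

lemma isProbabilityMeasure_average {μ : ℕ → Measure E} (hμ : ∀ k, IsProbabilityMeasure (μ k))
    (n : ℕ) : IsProbabilityMeasure (average μ n) := by
  constructor
  simp only [average, Measure.smul_apply, Measure.finsetSum_apply, measure_univ,
    Finset.sum_const, Finset.card_range, smul_eq_mul, nsmul_eq_mul, mul_one]
  push_cast
  exact ENNReal.inv_mul_cancel (by simp) (by finiteness)

variable [NormedAddCommGroup E] [BorelSpace E]

lemma integral_average {μ : ℕ → Measure E} (hμ : ∀ k, IsProbabilityMeasure (μ k)) (n : ℕ)
    (φ : E →ᵇ ℝ) :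
    ∫ x, φ x ∂(average μ n) = ((n : ℝ) + 1)⁻¹ * ∑ k ∈ Finset.range (n + 1), ∫ x, φ x ∂(μ k) := by
  rw [average, integral_smul_measure, integral_finsetSum_measure fun k _ => φ.integrable (μ k),
    smul_eq_mul, ENNReal.toReal_inv]
  norm_cast

/-- The Krylov--Bogoliubov theorem, for tightness given by second moments. -/
theorem exists_invariant [ProperSpace E] (κ : Kernel E E) [IsMarkovKernel κ]
    (hκ : ∀ φ : E →ᵇ ℝ, Continuous fun x => ∫ y, φ y ∂(κ x)) (x : E) {C : ℝ≥0}
    (hC : ∀ n, ∫⁻ y, ‖y‖ₑ ^ 2 ∂(average (fun k => (κ ^ k) x) n) ≤ C) :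
    ∃ π : Measure E, IsProbabilityMeasure π ∧ Kernel.Invariant κ π := by
  have hM := isMarkovKernel_pow κ
  have hp : ∀ k, IsProbabilityMeasure ((κ ^ k) x) := fun k => inferInstance
  let A : ℕ → ProbabilityMeasure E := fun n =>
    ⟨average (fun k => (κ ^ k) x) n, isProbabilityMeasure_average hp n⟩
  have htight : IsTightMeasureSet {((μ : ProbabilityMeasure E) : Measure E) | μ ∈ range A} := by
    rw [isTightMeasureSet_iff_exists_isCompact_measure_compl_le]
    intro ε hε
    have hlim : Tendsto (fun k : ℕ => (C : ℝ≥0∞) * (k : ℝ≥0∞)⁻¹) atTop (𝓝 0) := by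
      have := ENNReal.Tendsto.const_mul (a := (C : ℝ≥0∞)) ENNReal.tendsto_inv_nat_nhds_zero
        (Or.inr ENNReal.coe_ne_top)
      rwa [mul_zero] at this
    obtain ⟨R, hR, hR1⟩ :=
      ((hlim.eventually (gt_mem_nhds hε)).and (eventually_ge_atTop 1)).exists
    refine ⟨Metric.closedBall 0 R, isCompact_closedBall _ _, ?_⟩
    rintro _ ⟨_, ⟨n, rfl⟩, rfl⟩
    refine le_trans ?_ hR.le
    -- Markov's inequality for |y|² at level R: since R ≥ 1, |y| > R implies |y|² ≥ R, so the mass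
    -- outside the ball is at most C/R.
    refine (measure_mono fun y hy => ?_).trans ((meas_ge_le_lintegral_div
      (f := fun y => ‖y‖ₑ ^ 2) (ε := (R : ℝ≥0∞)) (by fun_prop) (by simp; omega) (by simp)).trans
      (ENNReal.div_le_div_right (hC n) _))
    have hy1 : (R : ℝ) < ‖y‖ := by simpa using hy
    have hR2 : (1 : ℝ) ≤ R := by exact_mod_cast hR1
    rw [mem_ofPred_eq, ← ofReal_norm, ← ENNReal.ofReal_pow (norm_nonneg _),
      ← ENNReal.ofReal_natCast]
    exact ENNReal.ofReal_le_ofReal (by nlinarith)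
  have hc := isCompact_closure_of_isTightMeasureSet htight
  -- By Prokhorov the closure is compact; a limit along a nonprincipal ultrafilter replaces the
  -- extraction of a subsequence.
  obtain ⟨π, -, hπ⟩ := hc.ultrafilter_le_nhds ((hyperfilter ℕ).map A)
    (le_principal_iff.2 (mem_map.2 (univ_mem' fun n => subset_closure (mem_range_self n))))
  have hπ' : Tendsto A (hyperfilter ℕ) (𝓝 π) := hπ
  rw [ProbabilityMeasure.tendsto_iff_forall_integral_tendsto] at hπ'
  refine ⟨π, inferInstance, ext_of_forall_integral_eq_of_IsFiniteMeasure fun φ => ?_⟩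
  rw [integral_bind_kernel]
  have h1 := (hπ' (integralKernel κ hκ φ)).sub (hπ' φ)
  -- Applying κ shifts the average by one index, so the difference telescopes to its two end terms
  -- and is at most 2‖φ‖/(n+1).
  have h2 : Tendsto (fun n => ∫ y, integralKernel κ hκ φ y ∂(A n : Measure E)
      - ∫ y, φ y ∂(A n : Measure E)) atTop (𝓝 0) := by
    have e : ∀ n, ∫ y, integralKernel κ hκ φ y ∂(A n : Measure E) - ∫ y, φ y ∂(A n : Measure E)
        = ((n : ℝ) + 1)⁻¹ * (∫ y, φ y ∂((κ ^ (n + 1)) x) - ∫ y, φ y ∂((κ ^ 0) x)) := by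
      intro n
      have e1 : ∀ k, ∫ y, integralKernel κ hκ φ y ∂((κ ^ k) x) = ∫ y, φ y ∂((κ ^ (k + 1)) x) := by
        intro k
        rw [pow_succ_apply_eq_bind, integral_bind_kernel]
        rfl
      simp only [A, ProbabilityMeasure.coe_mk, integral_average hp, e1]
      rw [← mul_sub, ← Finset.sum_sub_distrib,
        Finset.sum_range_sub fun k => ∫ y, φ y ∂((κ ^ k) x)]
    simp only [e]
    refine squeeze_zero_norm (a := fun n : ℕ => 2 * ‖φ‖ * (1 / ((n : ℝ) + 1))) (fun n => ?_) ?_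
    · have hb : ∀ k, ‖∫ y, φ y ∂((κ ^ k) x)‖ ≤ ‖φ‖ := fun k => by
        simpa using norm_integral_le_of_norm_le_const (μ := (κ ^ k) x)
          (Eventually.of_forall fun y => φ.norm_coe_le_norm y)
      rw [norm_mul, norm_inv, Real.norm_of_nonneg (by positivity), mul_comm, ← one_div]
      refine mul_le_mul_of_nonneg_right ((norm_sub_le _ _).trans ?_) (by positivity)
      linarith [hb (n + 1), hb 0]
    · simpa using tendsto_one_div_add_atTop_nhds_zero_nat.const_mul (2 * ‖φ‖)
  exact sub_eq_zero.1 (tendsto_nhds_unique h1 (h2.mono_left Nat.hyperfilter_le_atTop))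

end Invariant

/-! ### The semigroup of the method and its invariant measure -/

section Semigroup

variable {d m : ℕ} {Ω Z : Type*} [mΩ : MeasurableSpace Ω] [MeasurableSpace Z]
  {F : Filtration ℝ≥0 mΩ} {W : ℝ≥0 → Ω → EuclideanSpace ℝ (Fin m)} {N : Ω → Measure (ℝ × Z)}
  {ν : Measure Z} {P : Measure Ω}
  {b : EuclideanSpace ℝ (Fin d) → EuclideanSpace ℝ (Fin d)}
  {σ : EuclideanSpace ℝ (Fin d) → Matrix (Fin d) (Fin m) ℝ}
  {γ : EuclideanSpace ℝ (Fin d) → Z → EuclideanSpace ℝ (Fin d)}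
  {L₁ L₂ L₃ θ : ℝ} {τ : ℝ≥0} {x : EuclideanSpace ℝ (Fin d)}
  {X : ℕ → Ω → EuclideanSpace ℝ (Fin d)}
  {κ : Kernel (EuclideanSpace ℝ (Fin d)) (EuclideanSpace ℝ (Fin d))}

namespace IsTransitionKernel

/-- The integral of φ against κⁿ⁺¹(x) is that of the bounded continuous function κφ against κⁿ(x),
so the one-step property propagates by induction. -/
theorem isFeller (hκ : IsTransitionKernel F W N ν P b σ γ θ τ κ) : IsFeller fun n => κ ^ n := by
  have := hκ.isMarkov
  have hM := isMarkovKernel_pow κ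
  intro n
  induction n with
  | zero =>
    intro φ
    have e : ∀ x, ∫ y, φ y ∂((κ ^ 0) x) = φ x := fun x => integral_dirac _ _
    simpa only [e] using φ.continuous
  | succ n ih =>
    intro φ
    simp only [pow_succ_apply_eq_bind, integral_bind_kernel]
    exact ih (integralKernel κ hκ.continuous_integral φ)

variable [IsProbabilityMeasure P] [SigmaFinite ν]

/-- The law of the method after `n` steps. -/
theorem hasLaw (hκ : IsTransitionKernel F W N ν P b σ γ θ τ κ)
    (D : Admissible b σ γ ν L₁ L₂ L₃ θ τ) (h : IsDrivingNoise F W N ν P) (hb : Continuous b)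
    (hX : IsSolution F W N ν P b σ γ τ θ x X) (n : ℕ) : HasLaw (X n) ((κ ^ n) x) P := by
  have := hκ.isMarkov
  have hM := isMarkovKernel_pow κ
  induction n with
  | zero => exact hasLaw_dirac_of_ae_eq hX.init
  | succ n ih =>
    refine ⟨(hX.measurable _).aemeasurable, ?_⟩
    have := Measure.isProbabilityMeasure_map (μ := P) (hX.measurable (n + 1)).aemeasurable
    refine ext_of_forall_integral_eq_of_IsFiniteMeasure fun φ => ?_
    -- Any solution satisfies X_{n+1} = T⁻¹(G_n) almost surely by injectivity of T, so its next law
    -- is determined by its current law. This is why the choice of the solution does not matter.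
    obtain ⟨I, hI, he⟩ := hX.exists_step n
    rw [succ_mul_eq] at hI he
    have h1 : ∫ ω, φ (X (n + 1) ω) ∂P = ∫ ω, φ (implicitInv b θ τ
        (explicitPart W b σ θ τ (n * τ) (n * τ + τ) (X n) I ω)) ∂P := by
      refine integral_congr_ae ?_
      filter_upwards [he] with ω hω
      rw [← hω, D.implicitInv_implicitMap]
    rw [integral_map (hX.measurable (n + 1)).aemeasurable φ.continuous.aestronglyMeasurable, h1,
      hκ.integral_explicitPart D h hb (hX.adapted n) (hX.memLp_implicitMap D h n) hI,
      pow_succ_apply_eq_bind, integral_bind_kernel]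
    exact ih.integral_comp (hκ.continuous_integral φ).aestronglyMeasurable

theorem isMarkovSemigroup (hκ : IsTransitionKernel F W N ν P b σ γ θ τ κ)
    (D : Admissible b σ γ ν L₁ L₂ L₃ θ τ) (h : IsDrivingNoise F W N ν P) (hb : Continuous b) :
    IsMarkovSemigroup F W N ν P b σ γ τ θ fun n => κ ^ n where
  exists_solution := D.exists_isSolution h hb
  law _ _ hX n := hκ.hasLaw D h hb hX n
  isMarkov := by
    have := hκ.isMarkov
    exact isMarkovKernel_pow κ
  zero := rfl
  add n k := by rw [add_comm, Kernel.pow_add]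

/-- The summed energy inequality, for the solution started at 0, bounds the time averages of second
moments, which is the tightness that Krylov–Bogoliubov needs. The negative term −L₃|x|² of the
coercivity condition is essential here. -/
theorem exists_isInvariantMeasure (hκ : IsTransitionKernel F W N ν P b σ γ θ τ κ)
    (D : Admissible b σ γ ν L₁ L₂ L₃ θ τ) (h : IsDrivingNoise F W N ν P) (hb : Continuous b) :
    ∃ π, IsInvariantMeasure (fun n => κ ^ n) π := by
  have := hκ.isMarkov
  obtain ⟨X, hX⟩ := D.exists_isSolution h hb 0
  have hpos : 0 < τ * L₃ := mul_pos (NNReal.coe_pos.2 D.pos) D.coeffs.pos₃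
  -- Dividing the energy bound |T(0)|² + (n+1)τL₂ by (n+1)τL₃ and using n + 1 ≥ 1 gives the constant
  -- C, uniform in n.
  obtain ⟨π, hπ, hi⟩ := exists_invariant κ hκ.continuous_integral 0
    (C := ((‖implicitMap b θ τ 0‖ ^ 2 + τ * L₂) / (τ * L₃)).toNNReal) fun n => by
      have h1 : ∀ k, ∫⁻ y, ‖y‖ₑ ^ 2 ∂((κ ^ k) 0) = ENNReal.ofReal (∫ ω, ‖X k ω‖ ^ 2 ∂P) :=
        fun k => by
          rw [← (hκ.hasLaw D h hb hX k).lintegral_comp (by fun_prop),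
            lintegral_enorm_sq_eq_ofReal (hX.memLp D h k)]
      have h2 := hX.sum_integral_norm_sq_le D h (n + 1)
      have h3 : (0 : ℝ) < (n : ℝ) + 1 := by positivity
      have h4 : ((n : ℝ≥0∞) + 1)⁻¹ = ENNReal.ofReal ((n : ℝ) + 1)⁻¹ := by
        rw [ENNReal.ofReal_inv_of_pos h3, ENNReal.ofReal_add (by positivity) zero_le_one]
        simp
      rw [average, lintegral_smul_measure, lintegral_finsetSum_measure, smul_eq_mul]
      simp only [h1]
      rw [← ENNReal.ofReal_sum_of_nonneg fun k _ => integral_nonneg fun _ => by positivity, h4,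
        ← ENNReal.ofReal_mul (by positivity)]
      refine ENNReal.ofReal_le_ofReal ?_
      rw [inv_mul_le_iff₀ h3, ← mul_div_assoc, le_div_iff₀ hpos, mul_comm]
      refine h2.trans ?_
      push_cast
      nlinarith [sq_nonneg ‖implicitMap b θ τ 0‖, Nat.cast_nonneg (α := ℝ) n]
  exact ⟨π, hπ, invariant_pow hi⟩

end IsTransitionKernel
end Semigroup

end STM

end

theorem mainTheorem3 {d m : ℕ} {Ω Z : Type*} [mΩ : MeasurableSpace Ω] [MeasurableSpace Z]
    (P : Measure Ω) [IsProbabilityMeasure P] (F : Filtration ℝ≥0 mΩ)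
    (ν : Measure Z) [SigmaFinite ν]
    (W : ℝ≥0 → Ω → EuclideanSpace ℝ (Fin m)) (N : Ω → Measure (ℝ × Z))
    (hnoise : STM.IsDrivingNoise F W N ν P)
    (b : EuclideanSpace ℝ (Fin d) → EuclideanSpace ℝ (Fin d))
    (σ : EuclideanSpace ℝ (Fin d) → Matrix (Fin d) (Fin m) ℝ)
    (γ : EuclideanSpace ℝ (Fin d) → Z → EuclideanSpace ℝ (Fin d))
    (hmeas : STM.MeasurableCoeffs b σ γ)
    (L₁ L₂ L₃ : ℝ) (hL : STM.CoupledMonotoneCoercive b σ γ ν L₁ L₂ L₃)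
    (θ : ℝ) (hθ : θ ∈ Set.Icc (1 / 2 : ℝ) 1)
    (τ : ℝ≥0) (hτ₀ : 0 < τ) (hτ₁ : τ < 1) (hLτ : L₁ * θ * τ ≤ 1 / 2) :
    (∀ (x y : EuclideanSpace ℝ (Fin d)) (X Y : ℕ → Ω → EuclideanSpace ℝ (Fin d)),
      STM.IsSolution F W N ν P b σ γ τ θ x X →
      STM.IsSolution F W N ν P b σ γ τ θ y Y →
      ∀ n : ℕ,
        Integrable (fun ω => ‖X n ω - Y n ω‖ ^ 2) P ∧
        ∫ ω, ‖X n ω - Y n ω‖ ^ 2 ∂P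
          ≤ Real.exp (2 * L₁ * (n * τ)) / (1 - L₁ * θ * τ)
            * ‖(x - y) - (θ * τ) • (b x - b y)‖ ^ 2) ∧
    (Continuous b →
      ∃ κ : ℕ → Kernel (EuclideanSpace ℝ (Fin d)) (EuclideanSpace ℝ (Fin d)),
        STM.IsMarkovSemigroup F W N ν P b σ γ τ θ κ ∧
        STM.IsFeller κ ∧
        ∃ π, STM.IsInvariantMeasure κ π) := by
  have D : STM.Admissible b σ γ ν L₁ L₂ L₃ θ τ := ⟨hmeas, hL, hθ.1, hτ₀, hLτ⟩
  refine ⟨fun x y X Y hX hY n => hX.integral_norm_sub_sq_le D hnoise hY n, fun hb => ?_⟩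
  obtain ⟨κ, hκ⟩ := D.exists_isTransitionKernel hnoise hb
  exact ⟨fun n => κ ^ n, hκ.isMarkovSemigroup D hnoise hb, hκ.isFeller,
    hκ.exists_isInvariantMeasure D hnoise hb⟩
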